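/- Let $h=\langle\cdot,\cdot\rangle$ be the standard round metric on the unit sphere $\mathbb S^2\subset\mathbb R^3$, $\Phi(\mathbf y)=\sqrt{h(\mathbf y,\mathbf y)}$, and let $\mathbf v$ be the rotation field $\mathbf v_p=(-y,x,0)$ at $p=(x,y,z)\in\mathbb S^2$. Let $\epsilon\in\mathbb R$ and $U_\epsilon=\{p\in\mathbb S^2:\epsilon^2h(\mathbf v_p,\mathbf v_p)<1\}$. Then $U_\epsilon$ is the set of points $p$ such that for every nonzero $\mathbf y\in T_p\mathbb S^2$ the equation $\Phi(\mathbf y/F-\epsilon\mathbf v_p)=1$ has exactly one solution $F=F(\mathbf y)>0$. One has $U_\epsilon=\mathbb S^2$ if $|\epsilon|<1$, while for $|\epsilon|\ge 1$ the set $U_\epsilon$ is the union of the two open metric disks of radius $\sin^{-1}(1/|\epsilon|)$ around the north and the south pole. On $U_\epsilon$ the solution is the Randers metric $F=\alpha+\beta$ with $$\alpha(\mathbf y)=\frac{\sqrt{\epsilon^2h(\mathbf v,\mathbf y)^2+h(\mathbf y,\mathbf y)\,(1-\epsilon^2h(\mathbf v,\mathbf v))}}{1-\epsilon^2h(\mathbf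 v,\mathbf v)},\qquad \beta(\mathbf y)=-\frac{\epsilon\,h(\mathbf v,\mathbf y)}{1-\epsilon^2h(\mathbf v,\mathbf v)}$$ (that is, $\alpha$ is a Riemannian norm, $\beta$ is a smooth $1$-form with $\sup_{\mathbf y}\beta(\mathbf y)/\alpha(\mathbf y)<1$ at every point, and $F$ is a Finsler metric), and: (a) $F$ has constant flag curvature $\mathbf K=1$: in local coordinates, with $g_{ij}=\frac12[F^2]_{y^iy^j}$, $G^i=\frac14g^{ik}\{2\,\partial g_{pk}/\partial x^q-\partial g_{pq}/\partial x^k\}y^py^q$ and $R^i{}_k=2\frac{\partial G^i}{\partial x^k}-y^j\frac{\partial^2G^i}{\partial x^j\partial y^k}+2G^j\frac{\partial^2G^i}{\partial y^j\partial y^k}-\frac{\partial G^i}{\partial y^j}\frac{\partial G^j}{\partial y^k}$, one has $R^i{}_k=F^2\delta^i_k-FF_{y^k}y^i$. (b) The S-curvature of $F$ vanishes: $\mathbf S=\frac{\partial G^i}{\partial y^i}-\frac{y^i}{\sigma}\frac{\partial\sigma}{\partial x^i}=0$, where $\sigma(x)\,dx^1dx^2$ is the Busemann–Hausdorff volume form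 of $F$. (c) If $\epsilon\neq0$, then $F$ is not locally projectively flat, on any nonempty open subset of $U_\epsilon$; here locally projectively flat means that around every point there are local coordinates in which the geodesics are straight lines, i.e. $G^i=P(x,y)\,y^i$ for some function $P$. (d) If $\epsilon\notin\{0,1,-1\}$, then the Gauss curvature $\bar{\mathbf K}$ of $\alpha$ is not constant, on any nonempty open subset of $U_\epsilon$. If $\epsilon=0$, then $\bar{\mathbf K}=1$. If $\epsilon=\pm1$, then $\bar{\mathbf K}=-4$. -/

import Mathlib

open scoped ContDiff Manifold RealInnerProductSpace

noncomputable section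

namespace Finsler

/-! ## Finsler geometry in local coordinates

A Finsler function in coordinates is a function `F x y` of the position `x` and of the tangent
vector `y`; all quantities below are evaluated at `y ≠ 0`. -/

/-- Coordinate space `ℝⁿ`. -/
abbrev Coord (n : ℕ) : Type := EuclideanSpace ℝ (Fin n)

/-- The partial derivative `∂f/∂xᵏ` at `x`. -/
def pderiv {n : ℕ} (k : Fin n) (f : Coord n → ℝ) (x : Coord n) : ℝ :=
  fderiv ℝ f x (EuclideanSpace.single k 1)

/-- The fundamental tensor `g_ij = ½ [F²]_{yⁱ yʲ}`. -/
def fundTensor {n : ℕ} (F : Coord n → Coord n → ℝ) (x y : Coord n) : Matrix (Fin n) (Fin n) ℝ :=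
  Matrix.of fun i j =>
    (1 / 2) * pderiv j (fun y' => pderiv i (fun y'' => F x y'' ^ 2) y') y

/-- The geodesic coefficients
`Gⁱ = ¼ gⁱᵏ (2 ∂g_pk/∂x^q - ∂g_pq/∂xᵏ) yᵖ y^q`. -/
def geodesicCoeff {n : ℕ} (F : Coord n → Coord n → ℝ) (i : Fin n) (x y : Coord n) : ℝ :=
  (1 / 4) * ∑ k, (fundTensor F x y)⁻¹ i k * ∑ p, ∑ q,
    (2 * pderiv q (fun x' => fundTensor F x' y p k) x
      - pderiv k (fun x' => fundTensor F x' y p q) x) * y p * y q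

/-- The coefficients of the Riemann curvature
`Rⁱ_k = 2 ∂Gⁱ/∂xᵏ - yʲ ∂²Gⁱ/∂xʲ∂yᵏ + 2 Gʲ ∂²Gⁱ/∂yʲ∂yᵏ - ∂Gⁱ/∂yʲ ∂Gʲ/∂yᵏ`. -/
def riemannCurv {n : ℕ} (F : Coord n → Coord n → ℝ) (i k : Fin n) (x y : Coord n) : ℝ :=
  2 * pderiv k (fun x' => geodesicCoeff F i x' y) x
    - ∑ j, y j * pderiv j (fun x' => pderiv k (fun y' => geodesicCoeff F i x' y') y) x
    + 2 * ∑ j, geodesicCoeff F j x y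
        * pderiv j (fun y' => pderiv k (fun y'' => geodesicCoeff F i x y'') y') y
    - ∑ j, pderiv j (fun y' => geodesicCoeff F i x y') y
        * pderiv k (fun y' => geodesicCoeff F j x y') y

/-- The density `σ` of the Busemann-Hausdorff volume form `σ(x) dx¹ ⋯ dxⁿ`: the volume of the
Euclidean unit ball divided by the volume of the unit ball of `F` at `x`. -/
def bhDensity {n : ℕ} (F : Coord n → Coord n → ℝ) (x : Coord n) : ℝ :=
  (MeasureTheory.volume (Metric.ball (0 : Coord n) 1)).toReal /
    (MeasureTheory.volume {y : Coord n | F x y < 1}).toReal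

/-- The S-curvature `S = ∂Gⁱ/∂yⁱ - (yⁱ / σ) ∂σ/∂xⁱ`. -/
def sCurv {n : ℕ} (F : Coord n → Coord n → ℝ) (x y : Coord n) : ℝ :=
  (∑ i, pderiv i (fun y' => geodesicCoeff F i x y') y)
    - ∑ i, y i / bhDensity F x * pderiv i (bhDensity F) x

/-! ## Finsler metrics on (open subsets of) the unit sphere -/

/-- Euclidean three-space. -/
abbrev E3 : Type := EuclideanSpace ℝ (Fin 3)

instance factFinrankE3 : Fact (Module.finrank ℝ E3 = 2 + 1) := ⟨by simp⟩

/-- The unit sphere `𝕊²`, with the smooth structure that it has in Mathlib. -/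
abbrev S2 : Type := Metric.sphere (0 : E3) 1

/-- The smooth local coordinate systems of `𝕊²`. -/
abbrev charts : Set (OpenPartialHomeomorph S2 (Coord 2)) :=
  IsManifold.maximalAtlas (𝓡 2) ∞ S2

/-- A tangent vector of `𝕊²` at `p` is a vector of `ℝ³` orthogonal to `p`. -/
def IsTangent (p : S2) (y : E3) : Prop := ⟪(p : E3), y⟫ = 0

/-- The expression `F(x, y)` of a function `F` of tangent vectors in the local coordinates `e`. -/
def inChart (F : S2 → E3 → ℝ) (e : OpenPartialHomeomorph S2 (Coord 2)) (x y : Coord 2) : ℝ :=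
  F (e.symm x) (fderiv ℝ (fun x' => (e.symm x' : E3)) x y)

/-- The part of the coordinate domain of `e` that corresponds to `U`. -/
def coordDomain (e : OpenPartialHomeomorph S2 (Coord 2)) (U : Set S2) : Set (Coord 2) :=
  {x | x ∈ e.target ∧ e.symm x ∈ U}

/-- `F` is a Finsler metric on the open set `U ⊆ 𝕊²`: positive and smooth away from the zero
section, positively homogeneous of degree one, and strongly convex. -/
structure IsFinslerMetric (F : S2 → E3 → ℝ) (U : Set S2) : Prop where
  pos : ∀ p ∈ U, ∀ y, IsTangent p y → y ≠ 0 → 0 < F p y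
  homogeneous : ∀ p ∈ U, ∀ y, IsTangent p y → ∀ c : ℝ, 0 ≤ c → F p (c • y) = c * F p y
  smooth : ∀ e ∈ charts, ContDiffOn ℝ ∞ (fun z : Coord 2 × Coord 2 => inChart F e z.1 z.2)
    {z | z.1 ∈ coordDomain e U ∧ z.2 ≠ 0}
  convex : ∀ e ∈ charts, ∀ x ∈ coordDomain e U, ∀ y ≠ 0, (fundTensor (inChart F e) x y).PosDef

/-- `α` is (the norm of) a Riemannian metric on `U`: locally `α = √(a_ij(x) yⁱ yʲ)`. -/
def IsRiemannianNorm (α : S2 → E3 → ℝ) (U : Set S2) : Prop :=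
  ∀ e ∈ charts, ∃ a : Coord 2 → Matrix (Fin 2) (Fin 2) ℝ,
    (∀ i j, ContDiffOn ℝ ∞ (fun x => a x i j) (coordDomain e U)) ∧
    ∀ x ∈ coordDomain e U, (a x).PosDef ∧
      ∀ y, inChart α e x y = √(∑ i, ∑ j, a x i j * y i * y j)

/-- `β` is a smooth 1-form on `U`: locally `β = b_i(x) yⁱ`. -/
def IsOneForm (β : S2 → E3 → ℝ) (U : Set S2) : Prop :=
  ∀ e ∈ charts, ∃ b : Coord 2 → Fin 2 → ℝ,
    (∀ i, ContDiffOn ℝ ∞ (fun x => b x i) (coordDomain e U)) ∧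
    ∀ x ∈ coordDomain e U, ∀ y, inChart β e x y = ∑ i, b x i * y i

/-- `α + β` is a Randers metric on `U`: a Finsler metric that is the sum of a Riemannian metric
and of a 1-form with `sup_y β(y) / α(y) < 1` at every point. -/
structure IsRandersMetric (α β : S2 → E3 → ℝ) (U : Set S2) : Prop where
  riemannian : IsRiemannianNorm α U
  oneForm : IsOneForm β U
  norm_lt_one : ∀ p ∈ U, ∃ c < 1, ∀ y, IsTangent p y → β p y ≤ c * α p y
  finsler : IsFinslerMetric (fun p y => α p y + β p y) U

/-- On `U` the flag curvature of `F` is the function `κ` of the point alone: in all local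
coordinates, `Rⁱ_k = κ (F² δⁱ_k - F F_{yᵏ} yⁱ)`. For a Riemannian metric on a surface, `κ` is the
Gauss curvature. -/
def HasFlagCurvature (F : S2 → E3 → ℝ) (U : Set S2) (κ : S2 → ℝ) : Prop :=
  ∀ e ∈ charts, ∀ x ∈ coordDomain e U, ∀ y ≠ 0, ∀ i k,
    riemannCurv (inChart F e) i k x y = κ (e.symm x) *
      (inChart F e x y ^ 2 * (if i = k then 1 else 0)
        - inChart F e x y * pderiv k (inChart F e x) y * y i)

/-- The S-curvature of `F` vanishes on `U`. -/
def HasZeroSCurvature (F : S2 → E3 → ℝ) (U : Set S2) : Prop :=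
  ∀ e ∈ charts, ∀ x ∈ coordDomain e U, ∀ y ≠ 0, sCurv (inChart F e) x y = 0

/-- `F` is locally projectively flat on `U`: around every point there are local coordinates in
which the geodesics are straight lines, that is, `Gⁱ = P(x, y) yⁱ`. -/
def IsLocallyProjectivelyFlat (F : S2 → E3 → ℝ) (U : Set S2) : Prop :=
  ∀ p ∈ U, ∃ e ∈ charts, p ∈ e.source ∧ ∃ P : Coord 2 → Coord 2 → ℝ,
    ∀ x ∈ coordDomain e U, ∀ y ≠ 0, ∀ i, geodesicCoeff (inChart F e) i x y = P x y * y i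

/-! ## The example -/

/-- The rotation field `v = (-y, x, 0)` at `p = (x, y, z)`. -/
def rot (p : S2) : E3 := !₂[-((p : E3) 1), (p : E3) 0, 0]

/-- The north pole, as a vector of `ℝ³`. -/
def northPole : E3 := !₂[0, 0, 1]

/-- The set of points at which `ε² h(v, v) < 1`. -/
def domain (ε : ℝ) : Set S2 := {p | ε ^ 2 * ⟪rot p, rot p⟫ < 1}

/-- `α = √(ε² h(v, y)² + h(y, y) (1 - ε² h(v, v))) / (1 - ε² h(v, v))`. -/
def alpha (ε : ℝ) (p : S2) (y : E3) : ℝ :=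
  √(ε ^ 2 * ⟪rot p, y⟫ ^ 2 + ⟪y, y⟫ * (1 - ε ^ 2 * ⟪rot p, rot p⟫)) /
    (1 - ε ^ 2 * ⟪rot p, rot p⟫)

/-- `β = - ε h(v, y) / (1 - ε² h(v, v))`. -/
def beta (ε : ℝ) (p : S2) (y : E3) : ℝ :=
  -(ε * ⟪rot p, y⟫) / (1 - ε ^ 2 * ⟪rot p, rot p⟫)

/-- `F = α + β`. -/
def randers (ε : ℝ) (p : S2) (y : E3) : ℝ := alpha ε p y + beta ε p y

/-- The positive number `t` solves `Φ(y / t - ε v) = 1`, with `Φ` the norm of the round metric. -/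
def Solves (ε : ℝ) (p : S2) (y : E3) (t : ℝ) : Prop :=
  0 < t ∧ ‖t⁻¹ • y - ε • rot p‖ = 1

end Finsler

end

/-! The mechanism is Zermelo navigation. The unit ball of `F` in a tangent plane is the round unit
disk translated by `ε v`; equivalently `w = y - F ε v` has round length `F`. Write `J` for the
linear map `rotLin`, so that `v = J p`. Since `J` is skew, the flow of `ε v` consists of isometries,
and the geodesics with `F = 1` should be unit speed great circles carried along by it: `γ(t) = exp(ε
t J) c(t)`, hence `γ'' = 2 ε J γ' - ε² J² γ - γ`. Homogeneity turns this into `randersAcc`. The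
formula need not be derived, only verified, and the verification takes place in `ℝ³`.

Two general facts make this possible. For a strongly convex `F`, the geodesic coefficients are the
unique solution of the Euler-Lagrange equation of `F²` (`IsFinslerOn.spray_eq`). If `X` is the
inverse of a chart, regarded as a map into `ℝ³`, and `dX(G) = ½ (D²X(y, y) - a)` with `a` the
ambient acceleration, then the Riemann curvature is expressed through `a`, its derivatives and the
connection alone: the third derivatives of `X` cancel (`IsFinslerOn.map_curvOp`).

(a) Implicit differentiation of `|w|² = F²` gives all derivatives of `F`. They confirm `randersAcc`
(`fderiv_spray_randersCoord`), and the curvature formula collapses to `F² u - F F_y(u) y`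
(`curvOp_randersCoord`).

(b) Translation preserves volume, so the Busemann-Hausdorff form is the area form of the round
sphere. The trace of the connection is the logarithmic derivative of the area density plus two terms
that vanish because `J` is skew.

(c) If `G = P y` at a point, the even and the odd parts in `y` of the acceleration along a meridian
must agree. This forces the point onto the equator, and the equator contains no nonempty open set.

(d) For `α` the same scheme is run with an explicit bilinear acceleration `alphaChr`. An orthonormal
frame adapted to the rotation reduces both the geodesic equation and the curvature to rational
identities. The curvature is a Möbius function of `|v|²` with determinant `6 ε² (1 - ε²)`, and
`|v|²` is not constant on any nonempty open set. -/

noncomputable section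

namespace Finsler

/-! ### Derivatives of smooth maps on open sets -/

section Calculus

variable {E V : Type*} [NormedAddCommGroup E] [NormedSpace ℝ E] [NormedAddCommGroup V]
  [NormedSpace ℝ V]

theorem smoothOn_fderiv_apply {f : E → V} {O : Set E} (hf : ContDiffOn ℝ ∞ f O) (hO : IsOpen O)
    (ξ : E) : ContDiffOn ℝ ∞ (fun z => fderiv ℝ f z ξ) O :=
  (hf.fderiv_of_isOpen hO (by simp)).clm_apply contDiffOn_const

theorem smoothOn_fderiv {f : E → V} {O : Set E} (hf : ContDiffOn ℝ ∞ f O) (hO : IsOpen O) :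
    ContDiffOn ℝ ∞ (fderiv ℝ f) O :=
  hf.fderiv_of_isOpen hO (by simp)

theorem smoothOn_differentiableAt {f : E → V} {O : Set E} (hf : ContDiffOn ℝ ∞ f O)
    (hO : IsOpen O) {z : E} (hz : z ∈ O) : DifferentiableAt ℝ f z :=
  (hf.contDiffAt (hO.mem_nhds hz)).differentiableAt (by simp)

theorem smoothOn_fderiv_fderiv_apply {f : E → V} {O : Set E} (hf : ContDiffOn ℝ ∞ f O)
    (hO : IsOpen O) {z : E} (hz : z ∈ O) (ξ η : E) :
    fderiv ℝ (fun z => fderiv ℝ f z ξ) z η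
      = fderiv ℝ (fderiv ℝ f) z η ξ := by
  rw [fderiv_clm_apply (smoothOn_differentiableAt (smoothOn_fderiv hf hO) hO hz)
    (differentiableAt_const _)]
  simp

theorem smoothOn_fderiv_fderiv_comm {f : E → V} {O : Set E} (hf : ContDiffOn ℝ ∞ f O)
    (hO : IsOpen O) {z : E} (hz : z ∈ O) (ξ η : E) :
    fderiv ℝ (fun z => fderiv ℝ f z ξ) z η
      = fderiv ℝ (fun z => fderiv ℝ f z η) z ξ := by
  rw [smoothOn_fderiv_fderiv_apply hf hO hz, smoothOn_fderiv_fderiv_apply hf hO hz]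
  exact ((hf.contDiffAt (hO.mem_nhds hz)).isSymmSndFDerivAt
    (by simpa using WithTop.coe_le_coe.2 (le_top : (2 : ℕ∞) ≤ ⊤))).eq _ _

theorem fderiv_eq_of_eqOn {f g : E → V} {O : Set E} (hO : IsOpen O) (h : Set.EqOn f g O) {z : E}
    (hz : z ∈ O) : fderiv ℝ f z = fderiv ℝ g z :=
  (h.eventuallyEq_of_mem (hO.mem_nhds hz)).fderiv_eq

end Calculus

/-! ### Partial derivatives as derivatives on a product -/

section Slices

variable {E E' V : Type*} [NormedAddCommGroup E] [NormedSpace ℝ E] [NormedAddCommGroup E']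
  [NormedSpace ℝ E'] [NormedAddCommGroup V] [NormedSpace ℝ V]

theorem fderiv_slice_left {f : E × E' → V} {x : E} {y : E'} (h : DifferentiableAt ℝ f (x, y))
    (u : E) : fderiv ℝ (fun x' => f (x', y)) x u = fderiv ℝ f (x, y) (u, 0) := by
  have h1 : HasFDerivAt (fun x' : E => (x', y)) (ContinuousLinearMap.inl ℝ E E') x := by
    simpa using hasFDerivAt_prodMk_left (𝕜 := ℝ) x y
  rw [HasFDerivAt.fderiv (f := fun x' => f (x', y)) (h.hasFDerivAt.comp x h1)]
  simp

theorem fderiv_slice_right {f : E × E' → V} {x : E} {y : E'} (h : DifferentiableAt ℝ f (x, y))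
    (u : E') : fderiv ℝ (fun y' => f (x, y')) y u = fderiv ℝ f (x, y) (0, u) := by
  have h1 : HasFDerivAt (fun y' : E' => (x, y')) (ContinuousLinearMap.inr ℝ E E') y := by
    simpa using hasFDerivAt_prodMk_right (𝕜 := ℝ) x y
  rw [HasFDerivAt.fderiv (f := fun y' => f (x, y')) (h.hasFDerivAt.comp y h1)]
  simp

end Slices

/-! ## Regular Finsler functions in local coordinates -/

variable {n : ℕ}

/-- The slit tangent bundle over `Ω`. -/
abbrev slit (Ω : Set (Coord n)) : Set (Coord n × Coord n) := {z | z.1 ∈ Ω ∧ z.2 ≠ 0}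

theorem isOpen_slit {Ω : Set (Coord n)} (h : IsOpen Ω) : IsOpen (slit Ω) :=
  (h.preimage continuous_fst).inter (isOpen_ne.preimage continuous_snd)

/-- The coordinate vector `eᵢ`. -/
abbrev unit (i : Fin n) : Coord n := EuclideanSpace.single i 1

theorem sum_smul_unit (y : Coord n) : ∑ i, y i • unit i = y := by
  have := (EuclideanSpace.basisFun (Fin n) ℝ).sum_repr y
  simpa using this

theorem map_eq_sum_unit {V : Type*} [NormedAddCommGroup V] [NormedSpace ℝ V]
    (T : Coord n →L[ℝ] V) (y : Coord n) : T y = ∑ i, y i • T (unit i) := by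
  conv_lhs => rw [← sum_smul_unit y]
  simp

/-- The function `F²` on the tangent bundle. -/
def energy (F : Coord n → Coord n → ℝ) (z : Coord n × Coord n) : ℝ := F z.1 z.2 ^ 2

/-- The vector of the geodesic coefficients. -/
def spray (F : Coord n → Coord n → ℝ) (z : Coord n × Coord n) : Coord n :=
  WithLp.toLp 2 fun i => geodesicCoeff F i z.1 z.2

/-- `F` is smooth on the slit tangent bundle over `Ω`, positively homogeneous and strongly convex. -/
structure IsFinslerOn (F : Coord n → Coord n → ℝ) (Ω : Set (Coord n)) : Prop where
  isOpen : IsOpen Ω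
  smooth : ContDiffOn ℝ ∞ (fun z : Coord n × Coord n => F z.1 z.2) (slit Ω)
  homogeneous : ∀ x ∈ Ω, ∀ y : Coord n, y ≠ 0 → ∀ c : ℝ, 0 < c → F x (c • y) = c * F x y
  posDef : ∀ x ∈ Ω, ∀ y : Coord n, y ≠ 0 → (fundTensor F x y).PosDef

/-! ### The fundamental tensor as a second derivative of `F²` -/

section FundTensor

variable {F : Coord n → Coord n → ℝ} {Ω : Set (Coord n)}

theorem smoothOn_energy (hF : ContDiffOn ℝ ∞ (fun z : Coord n × Coord n => F z.1 z.2) (slit Ω)) :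
    ContDiffOn ℝ ∞ (energy F) (slit Ω) := hF.pow 2

theorem fundTensor_apply (hΩ : IsOpen Ω)
    (hF : ContDiffOn ℝ ∞ (fun z : Coord n × Coord n => F z.1 z.2) (slit Ω))
    {z : Coord n × Coord n} (hz : z ∈ slit Ω) (i j : Fin n) :
    fundTensor F z.1 z.2 i j = 1 / 2 *
      fderiv ℝ (fun z => fderiv ℝ (energy F) z (0, unit i)) z (0, unit j) := by
  have hO := isOpen_slit hΩ
  have hL := smoothOn_energy hF
  have hL' := smoothOn_fderiv_apply hL hO (0, unit i)
  obtain ⟨x, y⟩ := z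
  simp only [fundTensor, pderiv, Matrix.of_apply]
  congr 1
  have h1 : ∀ y' ∈ {y' : Coord n | y' ≠ 0},
      fderiv ℝ (fun y'' => F x y'' ^ 2) y' (EuclideanSpace.single i 1)
        = fderiv ℝ (energy F) (x, y') (0, unit i) := fun y' hy' =>
    fderiv_slice_right (f := energy F)
      (smoothOn_differentiableAt hL hO (show (x, y') ∈ slit Ω from ⟨hz.1, hy'⟩)) _
  rw [fderiv_eq_of_eqOn isOpen_ne h1 hz.2]
  exact fderiv_slice_right (f := fun z => fderiv ℝ (energy F) z (0, unit i))
    (smoothOn_differentiableAt hL' hO hz) _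

theorem fundTensor_quadratic (hΩ : IsOpen Ω)
    (hF : ContDiffOn ℝ ∞ (fun z : Coord n × Coord n => F z.1 z.2) (slit Ω))
    {z : Coord n × Coord n} (hz : z ∈ slit Ω) (u v : Coord n) :
    ∑ i, ∑ j, fundTensor F z.1 z.2 i j * u i * v j = 1 / 2 *
      fderiv ℝ (fun z => fderiv ℝ (energy F) z (0, u)) z (0, v) := by
  have hO := isOpen_slit hΩ
  have hL := smoothOn_energy hF
  simp only [fundTensor_apply hΩ hF hz, smoothOn_fderiv_fderiv_apply hL hO hz]
  set B := fderiv ℝ (fderiv ℝ (energy F)) z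
  have h2 : ∀ u : Coord n, ((0 : Coord n), u) = ∑ i, u i • ((0 : Coord n), unit i) := fun u => by
    conv_lhs => rw [← sum_smul_unit u]
    ext1 <;> simp [Prod.fst_sum, Prod.snd_sum]
  conv_rhs => rw [h2 u, h2 v]
  simp only [map_sum, map_smul, sum_apply, smul_apply,
    smul_eq_mul, Finset.mul_sum]
  refine Finset.sum_congr rfl fun i _ => Finset.sum_congr rfl fun j _ => by ring

theorem fundTensor_symm (hΩ : IsOpen Ω)
    (hF : ContDiffOn ℝ ∞ (fun z : Coord n × Coord n => F z.1 z.2) (slit Ω))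
    {z : Coord n × Coord n} (hz : z ∈ slit Ω) (i j : Fin n) :
    fundTensor F z.1 z.2 i j = fundTensor F z.1 z.2 j i := by
  rw [fundTensor_apply hΩ hF hz, fundTensor_apply hΩ hF hz,
    smoothOn_fderiv_fderiv_comm (smoothOn_energy hF) (isOpen_slit hΩ) hz]

theorem fundTensor_posDef (hΩ : IsOpen Ω)
    (hF : ContDiffOn ℝ ∞ (fun z : Coord n × Coord n => F z.1 z.2) (slit Ω))
    {z : Coord n × Coord n} (hz : z ∈ slit Ω)
    (h : ∀ u : Coord n, u ≠ 0 →
      0 < fderiv ℝ (fun z => fderiv ℝ (energy F) z (0, u)) z (0, u)) :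
    (fundTensor F z.1 z.2).PosDef := by
  refine Matrix.PosDef.of_dotProduct_mulVec_pos ?_ fun u hu => ?_
  · ext i j
    simpa using fundTensor_symm hΩ hF hz j i
  · have := h (WithLp.toLp 2 u) (by simpa using hu)
    have h2 := fundTensor_quadratic hΩ hF hz (WithLp.toLp 2 u) (WithLp.toLp 2 u)
    simp only [dotProduct, Matrix.mulVec, star_trivial, Finset.mul_sum]
    have h3 : ∀ i j, u i * (fundTensor F z.1 z.2 i j * u j)
      = fundTensor F z.1 z.2 i j * u i * u j := fun i j => by ring
    simp only [h3]
    change _ = _ at h2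
    simp only at h2
    linarith

end FundTensor

/-! ### Homogeneity and the Euler-Lagrange characterization of the spray -/

namespace IsFinslerOn

variable {F : Coord n → Coord n → ℝ} {Ω : Set (Coord n)}
  {z : Coord n × Coord n}

theorem euler (hF : IsFinslerOn F Ω) (hz : z ∈ slit Ω) :
    fderiv ℝ (energy F) z (0, z.2) = 2 * energy F z := by
  have hO := isOpen_slit hF.isOpen
  have hd := smoothOn_differentiableAt (smoothOn_energy hF.smooth) hO hz
  -- The ray `t ↦ (x, t y)`, parametrized from its value `z` at `t = 1`; on it `F²` equals `t² F²(x,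
  -- y)`.
  have hline : HasDerivAt (fun t : ℝ => z + (t - 1) • ((0 : Coord n), z.2))
      ((0 : Coord n), z.2) 1 := by
    simpa using (((hasDerivAt_id (1 : ℝ)).sub_const 1).smul_const ((0 : Coord n), z.2)).const_add z
  have h1 : HasDerivAt (fun t : ℝ => energy F (z + (t - 1) • ((0 : Coord n), z.2)))
      (fderiv ℝ (energy F) z (0, z.2)) 1 := by
    have h3 : HasFDerivAt (energy F) (fderiv ℝ (energy F) z)
        (z + ((1 : ℝ) - 1) • ((0 : Coord n), z.2)) := by simpa using hd.hasFDerivAt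
    exact h3.comp_hasDerivAt (1 : ℝ) hline
  have h2 : HasDerivAt (fun t : ℝ => t ^ 2 * energy F z) (2 * energy F z) 1 := by
    simpa using ((hasDerivAt_id (1 : ℝ)).pow 2).mul_const (energy F z)
  refine h1.unique (h2.congr_of_eventuallyEq ?_)
  filter_upwards [lt_mem_nhds (show (0 : ℝ) < 1 by norm_num)] with t ht
  have h3 : z.2 + (t - 1) • z.2 = t • z.2 := by module
  simp [energy, h3, hF.homogeneous z.1 hz.1 z.2 hz.2 t ht, mul_pow]

/-- Differentiating Euler's identity `L_y(y) = 2 L` in the direction `u` gives `L_yy(y, u) + L_y(u)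
= 2 L_y(u)`. -/
theorem euler_fderiv (hF : IsFinslerOn F Ω) (hz : z ∈ slit Ω) (u : Coord n) :
    fderiv ℝ (fun z => fderiv ℝ (energy F) z (0, u)) z (0, z.2)
      = fderiv ℝ (energy F) z (0, u) := by
  have hO := isOpen_slit hF.isOpen
  have hL := smoothOn_energy hF.smooth
  have h1 : Set.EqOn (fun z : Coord n × Coord n => fderiv ℝ (energy F) z (0, z.2))
    (fun z => 2 * energy F z) (slit Ω) := fun z hz => hF.euler hz
  have h2 := congrArg (fun T => T ((0 : Coord n), u)) (fderiv_eq_of_eqOn hO h1 hz)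
  have hd := smoothOn_differentiableAt (smoothOn_fderiv hL hO) hO hz
  rw [fderiv_clm_apply hd (by fun_prop),
    fderiv_const_mul (smoothOn_differentiableAt hL hO hz)] at h2
  have h3 : fderiv ℝ (fun z : Coord n × Coord n => ((0 : Coord n), z.2)) z
    = (0 : Coord n × Coord n →L[ℝ] Coord n).prod (ContinuousLinearMap.snd ℝ _ _) :=
    ((hasFDerivAt_const (0 : Coord n) z).prodMk hasFDerivAt_snd).fderiv
  rw [h3] at h2
  simp only [add_apply, ContinuousLinearMap.comp_apply,
    ContinuousLinearMap.flip_apply, smul_apply, smul_eq_mul,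
    ContinuousLinearMap.prod_apply, zero_apply,
    ContinuousLinearMap.coe_snd'] at h2
  rw [← smoothOn_fderiv_fderiv_apply hL hO hz, smoothOn_fderiv_fderiv_comm hL hO hz] at h2
  linarith

theorem sum_fundTensor_mul (hF : IsFinslerOn F Ω) (hz : z ∈ slit Ω) (k : Fin n) :
    ∑ p, fundTensor F z.1 z.2 p k * z.2 p = 1 / 2 * fderiv ℝ (energy F) z (0, unit k) := by
  have h := fundTensor_quadratic hF.isOpen hF.smooth hz z.2 (unit k)
  rw [smoothOn_fderiv_fderiv_comm (smoothOn_energy hF.smooth) (isOpen_slit hF.isOpen) hz,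
    hF.euler_fderiv hz] at h
  rw [← h]
  simp [PiLp.single_apply]

theorem sum_sum_fundTensor_mul (hF : IsFinslerOn F Ω) (hz : z ∈ slit Ω) :
    ∑ p, ∑ q, fundTensor F z.1 z.2 p q * z.2 p * z.2 q = energy F z := by
  rw [fundTensor_quadratic hF.isOpen hF.smooth hz, hF.euler_fderiv hz, hF.euler hz]
  ring

theorem smoothOn_fundTensor (hF : IsFinslerOn F Ω) (i j : Fin n) :
    ContDiffOn ℝ ∞ (fun z : Coord n × Coord n => fundTensor F z.1 z.2 i j) (slit Ω) := by
  refine ContDiffOn.congr (f := fun z => 1 / 2 *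
      fderiv ℝ (fun z => fderiv ℝ (energy F) z (0, unit i)) z (0, unit j)) ?_
    fun z hz => fundTensor_apply hF.isOpen hF.smooth hz i j
  have hO := isOpen_slit hF.isOpen
  exact contDiffOn_const.mul (smoothOn_fderiv_apply (smoothOn_fderiv_apply
    (smoothOn_energy hF.smooth) hO _) hO _)

/-- Cramer's rule: the entries are quotients of determinants of smooth matrices, and the denominator
is positive by convexity. -/
theorem smoothOn_fundTensor_inv (hF : IsFinslerOn F Ω) (i j : Fin n) :
    ContDiffOn ℝ ∞ (fun z : Coord n × Coord n => (fundTensor F z.1 z.2)⁻¹ i j) (slit Ω) := by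
  have hdet : ∀ M : Coord n × Coord n → Matrix (Fin n) (Fin n) ℝ,
      (∀ i j, ContDiffOn ℝ ∞ (fun z => M z i j) (slit Ω)) →
      ContDiffOn ℝ ∞ (fun z => (M z).det) (slit Ω) := by
    intro M hM
    simp only [Matrix.det_apply]
    exact ContDiffOn.sum fun σ _ => (contDiffOn_prod fun k _ => hM _ _).const_smul _
  simp only [Matrix.inv_def, Ring.inverse_eq_inv', Matrix.smul_apply, smul_eq_mul,
    Matrix.adjugate_apply]
  refine ContDiffOn.mul (ContDiffOn.inv (hdet _ fun i j => hF.smoothOn_fundTensor i j)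
    fun z hz => (hF.posDef z.1 hz.1 z.2 hz.2).det_pos.ne') (hdet _ fun k l => ?_)
  by_cases h : k = j
  · subst h
    simpa using contDiffOn_const
  · simpa [Matrix.updateRow_ne h] using hF.smoothOn_fundTensor k l

/-- By homogeneity `g_pk yᵖ` is half of `∂F²/∂yᵏ` and `g_pq yᵖ y^q` is `F²`. Both contractions hold
for all `x` at fixed `y`, so they may be differentiated in `x`; the third derivatives of `F²` then
disappear from the definition of `G`. -/
theorem sum_sum_pderiv_fundTensor (hF : IsFinslerOn F Ω) (hz : z ∈ slit Ω) (k : Fin n) :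
    ∑ p, ∑ q, (2 * pderiv q (fun x' => fundTensor F x' z.2 p k) z.1
      - pderiv k (fun x' => fundTensor F x' z.2 p q) z.1) * z.2 p * z.2 q
      = fderiv ℝ (fun z => fderiv ℝ (energy F) z (0, unit k)) z (z.2, 0)
        - fderiv ℝ (energy F) z (unit k, 0) := by
  have hO := isOpen_slit hF.isOpen
  have hL := smoothOn_energy hF.smooth
  obtain ⟨x, y⟩ := z
  have hd : ∀ p q, DifferentiableAt ℝ (fun x' => fundTensor F x' y p q) x := fun p q =>
    (smoothOn_differentiableAt (hF.smoothOn_fundTensor p q) hO hz).comp x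
      (f := fun x' => (x', y)) (by fun_prop)
  have h1 : ∀ u : Coord n, ∑ p, y p * fderiv ℝ (fun x' => fundTensor F x' y p k) x u
      = 1 / 2 * fderiv ℝ (fun z => fderiv ℝ (energy F) z (0, unit k)) (x, y) (u, 0) := by
    intro u
    have h2 : Set.EqOn (fun x' => ∑ p, fundTensor F x' y p k * y p)
        (fun x' => 1 / 2 * fderiv ℝ (energy F) (x', y) (0, unit k)) Ω := fun x' hx' =>
      hF.sum_fundTensor_mul (z := (x', y)) ⟨hx', hz.2⟩ k
    have h3 := smoothOn_differentiableAt (smoothOn_fderiv_apply hL hO (0, unit k)) hO hz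
    have h3' : DifferentiableAt ℝ (fun x' => fderiv ℝ (energy F) (x', y) (0, unit k)) x :=
      h3.comp x (f := fun x' => (x', y)) (by fun_prop)
    have h4 := congrArg (fun T => T u) (fderiv_eq_of_eqOn hF.isOpen h2 hz.1)
    dsimp only at h4
    rw [fderiv_fun_sum fun p _ => (hd p k).mul_const _, fderiv_const_mul h3'] at h4
    simp only [fderiv_mul_const (hd _ _), sum_apply, smul_apply, smul_eq_mul] at h4
    rw [h4]
    congr 1
    exact fderiv_slice_left (f := fun z => fderiv ℝ (energy F) z (0, unit k)) h3 u
  have h5 : ∑ p, ∑ q, y p * y q * fderiv ℝ (fun x' => fundTensor F x' y p q) x (unit k)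
      = fderiv ℝ (energy F) (x, y) (unit k, 0) := by
    have h2 : Set.EqOn (fun x' => ∑ p, ∑ q, fundTensor F x' y p q * (y p * y q))
        (fun x' => energy F (x', y)) Ω := fun x' hx' => by
      simpa only [mul_assoc] using hF.sum_sum_fundTensor_mul (z := (x', y)) ⟨hx', hz.2⟩
    have h4 := congrArg (fun T => T (unit k)) (fderiv_eq_of_eqOn hF.isOpen h2 hz.1)
    rw [fderiv_fun_sum fun p _ => DifferentiableAt.fun_sum fun q _ => (hd p q).mul_const _,
      fderiv_slice_left (smoothOn_differentiableAt hL hO hz)] at h4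
    rw [← h4, sum_apply]
    refine Finset.sum_congr rfl fun p _ => ?_
    rw [fderiv_fun_sum fun q _ => (hd p q).mul_const _, sum_apply]
    refine Finset.sum_congr rfl fun q _ => ?_
    rw [fderiv_mul_const (hd _ _)]
    simp
  have h6 : fderiv ℝ (fun z => fderiv ℝ (energy F) z (0, unit k)) (x, y) (y, 0)
      = ∑ q, ∑ p, 2 * (y q * (y p * fderiv ℝ (fun x' => fundTensor F x' y p k) x (unit q))) := by
    have h7 := map_eq_sum_unit ((fderiv ℝ (fun z => fderiv ℝ (energy F) z (0, unit k)) (x, y)).comp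
      (ContinuousLinearMap.inl ℝ _ _)) y
    simp only [ContinuousLinearMap.comp_apply, ContinuousLinearMap.inl_apply, smul_eq_mul] at h7
    rw [h7]
    refine Finset.sum_congr rfl fun q _ => ?_
    rw [← Finset.mul_sum, ← Finset.mul_sum, h1]
    ring
  simp only [pderiv]
  rw [h6, Finset.sum_comm (f := fun q p => 2 * (y q * (y p * _))), ← h5, ← Finset.sum_sub_distrib]
  refine Finset.sum_congr rfl fun p _ => ?_
  rw [← Finset.sum_sub_distrib]
  refine Finset.sum_congr rfl fun q _ => ?_
  ring

theorem sum_fundTensor_mul_spray (hF : IsFinslerOn F Ω) (hz : z ∈ slit Ω) (k : Fin n) :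
    ∑ i, fundTensor F z.1 z.2 k i * spray F z i
      = 1 / 4 * (fderiv ℝ (fun z => fderiv ℝ (energy F) z (0, unit k)) z (z.2, 0)
        - fderiv ℝ (energy F) z (unit k, 0)) := by
  rw [← hF.sum_sum_pderiv_fundTensor hz]
  set c : Fin n → ℝ := fun k => ∑ p, ∑ q, (2 * pderiv q (fun x' => fundTensor F x' z.2 p k) z.1
      - pderiv k (fun x' => fundTensor F x' z.2 p q) z.1) * z.2 p * z.2 q with hc
  set g := fundTensor F z.1 z.2 with hg
  have h1 : ∀ i, spray F z i = 1 / 4 * (g⁻¹.mulVec c) i := fun i => rfl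
  have h2 : g.mulVec (g⁻¹.mulVec c) = c := by
    rw [Matrix.mulVec_mulVec, Matrix.mul_nonsing_inv _
      ((Matrix.isUnit_iff_isUnit_det _).1 (hF.posDef z.1 hz.1 z.2 hz.2).isUnit),
      Matrix.one_mulVec]
  have h3 := congrFun h2 k
  change _ = 1 / 4 * c k
  rw [← h3]
  simp only [h1, Matrix.mulVec, dotProduct, Finset.mul_sum]
  refine Finset.sum_congr rfl fun i _ => Finset.sum_congr rfl fun j _ => by ring

/-- The vector `(y, -2 G)` is the geodesic field on the tangent bundle, so this is the equation
`d/dt L_y = L_x` for `L = F²`, tested on `u`. It is linear in `u`, hence follows from the coordinate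
vectors. -/
theorem euler_lagrange (hF : IsFinslerOn F Ω) (hz : z ∈ slit Ω) (u : Coord n) :
    fderiv ℝ (fun z => fderiv ℝ (energy F) z (0, u)) z (z.2, -(2 : ℝ) • spray F z)
      = fderiv ℝ (energy F) z (u, 0) := by
  have hO := isOpen_slit hF.isOpen
  have hL := smoothOn_energy hF.smooth
  have key : ∀ k, fderiv ℝ (fun z => fderiv ℝ (energy F) z (0, unit k)) z
      (z.2, -(2 : ℝ) • spray F z) = fderiv ℝ (energy F) z (unit k, 0) := by
    intro k
    have h1 := fundTensor_quadratic hF.isOpen hF.smooth hz (unit k) (spray F z)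
    have h2 := hF.sum_fundTensor_mul_spray hz k
    have h3 : ∑ i, ∑ j, fundTensor F z.1 z.2 i j * unit k i * spray F z j
        = ∑ i, fundTensor F z.1 z.2 k i * spray F z i := by
      rw [Finset.sum_comm]
      refine Finset.sum_congr rfl fun i _ => ?_
      simp [PiLp.single_apply]
    have h4 : (z.2, -(2 : ℝ) • spray F z)
        = (z.2, (0 : Coord n)) - (2 : ℝ) • ((0 : Coord n), spray F z) := by
      ext1 <;> simp
    rw [h4, map_sub, map_smul, smul_eq_mul]
    linarith
  have h5 := map_eq_sum_unit (((fderiv ℝ (fderiv ℝ (energy F)) z)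
    (z.2, -(2 : ℝ) • spray F z)).comp (ContinuousLinearMap.inr ℝ _ _)) u
  have h6 := map_eq_sum_unit ((fderiv ℝ (energy F) z).comp (ContinuousLinearMap.inl ℝ _ _)) u
  simp only [ContinuousLinearMap.comp_apply, ContinuousLinearMap.inl_apply,
    ContinuousLinearMap.inr_apply] at h5 h6
  rw [smoothOn_fderiv_fderiv_apply hL hO hz, h5, h6]
  refine Finset.sum_congr rfl fun k _ => ?_
  rw [← key, smoothOn_fderiv_fderiv_apply hL hO hz]

/-- Two solutions differ by a vector in the kernel of the fundamental tensor, which is positive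
definite. This allows a spray to be verified without inverting that tensor. -/
theorem spray_eq (hF : IsFinslerOn F Ω) (hz : z ∈ slit Ω) {G : Coord n}
    (hG : ∀ u, fderiv ℝ (fun z => fderiv ℝ (energy F) z (0, u)) z (z.2, -(2 : ℝ) • G)
      = fderiv ℝ (energy F) z (u, 0)) : spray F z = G := by
  by_contra hne
  have hne' : spray F z - G ≠ 0 := sub_ne_zero.2 hne
  have hp := (hF.posDef z.1 hz.1 z.2 hz.2).dotProduct_mulVec_pos
    (x := (spray F z - G).ofLp) (fun h => hne' (by ext i; exact congrFun h i))
  have h1 := fundTensor_quadratic hF.isOpen hF.smooth hz (spray F z - G) (spray F z - G)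
  have h2 := (hF.euler_lagrange hz (spray F z - G)).trans (hG _).symm
  have h4 : (z.2, -(2 : ℝ) • spray F z)
      = (z.2, -(2 : ℝ) • G) - (2 : ℝ) • ((0 : Coord n), spray F z - G) := by
    ext1
    · simp
    · simp only [Prod.snd_sub, Prod.smul_snd]; module
  rw [h4, map_sub, map_smul, smul_eq_mul] at h2
  have h5 : ∑ i, ∑ j, fundTensor F z.1 z.2 i j * (spray F z - G) i * (spray F z - G) j = 0 := by
    rw [h1]; linarith
  simp only [dotProduct, Matrix.mulVec, star_trivial, Finset.mul_sum] at hp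
  refine hp.ne' (h5 ▸ Finset.sum_congr rfl fun i _ => Finset.sum_congr rfl fun j _ => ?_)
  ring

theorem smoothOn_spray (hF : IsFinslerOn F Ω) : ContDiffOn ℝ ∞ (spray F) (slit Ω) := by
  have hO := isOpen_slit hF.isOpen
  have hL := smoothOn_energy hF.smooth
  rw [contDiffOn_piLp]
  intro i
  have h : ContDiffOn ℝ ∞ (fun z => 1 / 4 * ∑ k, (fundTensor F z.1 z.2)⁻¹ i k *
      (fderiv ℝ (fderiv ℝ (energy F)) z (z.2, 0) (0, unit k)
        - fderiv ℝ (energy F) z (unit k, 0))) (slit Ω) := by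
    refine contDiffOn_const.mul (ContDiffOn.sum fun k _ => (hF.smoothOn_fundTensor_inv i k).mul ?_)
    refine ContDiffOn.sub ?_ (smoothOn_fderiv_apply hL hO _)
    refine ((smoothOn_fderiv (smoothOn_fderiv hL hO) hO).clm_apply ?_).clm_apply contDiffOn_const
    exact (contDiff_snd.prodMk contDiff_const).contDiffOn
  refine h.congr fun z hz => ?_
  change geodesicCoeff F i z.1 z.2 = _
  simp only [geodesicCoeff, hF.sum_sum_pderiv_fundTensor hz,
    smoothOn_fderiv_fderiv_apply hL hO hz]

end IsFinslerOn

/-- The linear map `u ↦ ∂G/∂y · u`, evaluated at `z`. -/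
def connection (F : Coord n → Coord n → ℝ) (u : Coord n) (z : Coord n × Coord n) : Coord n :=
  fderiv ℝ (spray F) z (0, u)

/-- The Riemann curvature as a linear map on coordinate vectors. -/
def curvOp (F : Coord n → Coord n → ℝ) (z : Coord n × Coord n) (u : Coord n) : Coord n :=
  (2 : ℝ) • fderiv ℝ (spray F) z (u, 0)
    - fderiv ℝ (connection F u) z (z.2, -(2 : ℝ) • spray F z)
    - connection F (connection F u z) z

/-! ### The Riemann curvature in index-free form -/

namespace IsFinslerOn

variable {F : Coord n → Coord n → ℝ} {Ω : Set (Coord n)} {z : Coord n × Coord n}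

theorem smoothOn_connection (hF : IsFinslerOn F Ω) (u : Coord n) :
    ContDiffOn ℝ ∞ (connection F u) (slit Ω) :=
  smoothOn_fderiv_apply hF.smoothOn_spray (isOpen_slit hF.isOpen) _

theorem fderiv_ofLp {E : Type*} [NormedAddCommGroup E] [NormedSpace ℝ E] {f : E → Coord n} {z : E}
    (hf : DifferentiableAt ℝ f z) (i : Fin n) (ξ : E) :
    fderiv ℝ (fun z => f z i) z ξ = fderiv ℝ f z ξ i := by
  have h := ((EuclideanSpace.proj i : Coord n →L[ℝ] ℝ).hasFDerivAt.comp z hf.hasFDerivAt).fderiv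
  exact congrArg (fun T => T ξ) h

theorem pderiv_geodesicCoeff_left (hF : IsFinslerOn F Ω) (hz : z ∈ slit Ω) (i k : Fin n) :
    pderiv k (fun x' => geodesicCoeff F i x' z.2) z.1 = fderiv ℝ (spray F) z (unit k, 0) i := by
  have hd := smoothOn_differentiableAt hF.smoothOn_spray (isOpen_slit hF.isOpen) hz
  rw [← fderiv_ofLp hd]
  exact fderiv_slice_left (f := fun z => spray F z i) (differentiableAt_euclidean.1 hd i) _

theorem pderiv_geodesicCoeff_right (hF : IsFinslerOn F Ω) (hz : z ∈ slit Ω) (i k : Fin n) :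
    pderiv k (fun y' => geodesicCoeff F i z.1 y') z.2 = connection F (unit k) z i := by
  have hd := smoothOn_differentiableAt hF.smoothOn_spray (isOpen_slit hF.isOpen) hz
  rw [connection, ← fderiv_ofLp hd]
  exact fderiv_slice_right (f := fun z => spray F z i) (differentiableAt_euclidean.1 hd i) _

/-- The two sums with second derivatives of `G`, weighted by `yʲ` and by `-2 Gʲ`, together form the
derivative of the connection along the geodesic field `(y, -2 G)`. -/
theorem riemannCurv_eq (hF : IsFinslerOn F Ω) (hz : z ∈ slit Ω) (i k : Fin n) :
    riemannCurv F i k z.1 z.2 = curvOp F z (unit k) i := by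
  have hO := isOpen_slit hF.isOpen
  have hN := smoothOn_differentiableAt (hF.smoothOn_connection (unit k)) hO hz
  have hNi := differentiableAt_euclidean.1 hN i
  have h1 : ∀ j, pderiv j (fun x' => pderiv k (fun y' => geodesicCoeff F i x' y') z.2) z.1
      = fderiv ℝ (connection F (unit k)) z (unit j, 0) i := by
    intro j
    rw [← fderiv_ofLp hN, pderiv, ← fderiv_slice_left hNi]
    congr 1
    exact fderiv_eq_of_eqOn hF.isOpen (fun x' hx' =>
      hF.pderiv_geodesicCoeff_right (z := (x', z.2)) ⟨hx', hz.2⟩ i k) hz.1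
  have h2 : ∀ j, pderiv j (fun y' => pderiv k (fun y'' => geodesicCoeff F i z.1 y'') y') z.2
      = fderiv ℝ (connection F (unit k)) z (0, unit j) i := by
    intro j
    rw [← fderiv_ofLp hN, pderiv, ← fderiv_slice_right hNi]
    congr 1
    exact fderiv_eq_of_eqOn isOpen_ne (fun y' hy' =>
      hF.pderiv_geodesicCoeff_right (z := (z.1, y')) ⟨hz.1, hy'⟩ i k) hz.2
  have h3 : ∀ j, geodesicCoeff F j z.1 z.2 = spray F z j := fun j => rfl
  have h4 := congrArg (fun v : Coord n => v i) (map_eq_sum_unit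
    ((fderiv ℝ (connection F (unit k)) z).comp (ContinuousLinearMap.inl ℝ _ _)) z.2)
  have h5 := congrArg (fun v : Coord n => v i) (map_eq_sum_unit
    ((fderiv ℝ (connection F (unit k)) z).comp (ContinuousLinearMap.inr ℝ _ _)) (spray F z))
  have h6 := congrArg (fun v : Coord n => v i) (map_eq_sum_unit
    ((fderiv ℝ (spray F) z).comp (ContinuousLinearMap.inr ℝ _ _)) (connection F (unit k) z))
  simp only [ContinuousLinearMap.comp_apply, ContinuousLinearMap.inl_apply,
    ContinuousLinearMap.inr_apply, WithLp.ofLp_sum, WithLp.ofLp_smul, Finset.sum_apply,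
    Pi.smul_apply, smul_eq_mul] at h4 h5 h6
  have h7 : (z.2, -(2 : ℝ) • spray F z)
      = (z.2, (0 : Coord n)) - (2 : ℝ) • ((0 : Coord n), spray F z) := by
    ext1 <;> simp
  have h8 : ∀ v, connection F v z = fderiv ℝ (spray F) z (0, v) := fun _ => rfl
  simp only [riemannCurv, h1, h2, h3, hF.pderiv_geodesicCoeff_left hz,
    hF.pderiv_geodesicCoeff_right hz, curvOp, h7, map_sub, map_smul, WithLp.ofLp_sub,
    WithLp.ofLp_smul, Pi.sub_apply, Pi.smul_apply, smul_eq_mul]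
  rw [h8 (connection F (unit k) z), h4, h5, h6]
  simp only [h8, mul_comm]
  ring

end IsFinslerOn

end Finsler

namespace Finsler

/-! ## Sprays of immersed coordinate systems -/

section Bundle

variable {E E' V W W' : Type*} [NormedAddCommGroup E] [NormedSpace ℝ E] [NormedAddCommGroup E']
  [NormedSpace ℝ E'] [NormedAddCommGroup V] [NormedSpace ℝ V] [NormedAddCommGroup W]
  [NormedSpace ℝ W] [NormedAddCommGroup W'] [NormedSpace ℝ W']

theorem fderiv_comp_fst {f : E → V} {z : E × E'} (hf : DifferentiableAt ℝ f z.1) (ξ : E × E') :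
    fderiv ℝ (fun z : E × E' => f z.1) z ξ = fderiv ℝ f z.1 ξ.1 := by
  rw [fderiv_fun_comp z hf differentiableAt_fst, fderiv_fst]
  rfl

theorem fderiv_clm_comp_fst {T : E → W →L[ℝ] V} {g : E × E' → W} {z : E × E'}
    (hT : DifferentiableAt ℝ T z.1) (hg : DifferentiableAt ℝ g z) (ξ : E × E') :
    fderiv ℝ (fun z : E × E' => T z.1 (g z)) z ξ
      = fderiv ℝ T z.1 ξ.1 (g z) + T z.1 (fderiv ℝ g z ξ) := by
  have h := fderiv_comp_fst hT ξ
  rw [fderiv_clm_apply (c := fun z : E × E' => T z.1) (hT.comp z differentiableAt_fst) hg]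
  simp [h, add_comm]

theorem fderiv_bilinear_comp_fst {T : E → W →L[ℝ] W' →L[ℝ] V} {g : E × E' → W} {h : E × E' → W'}
    {z : E × E'} (hT : DifferentiableAt ℝ T z.1) (hg : DifferentiableAt ℝ g z)
    (hh : DifferentiableAt ℝ h z) (ξ : E × E') :
    fderiv ℝ (fun z : E × E' => T z.1 (g z) (h z)) z ξ
      = fderiv ℝ T z.1 ξ.1 (g z) (h z) + T z.1 (fderiv ℝ g z ξ) (h z)
        + T z.1 (g z) (fderiv ℝ h z ξ) := by
  have h1 := fderiv_clm_comp_fst (T := T) hT hg ξ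
  rw [fderiv_clm_apply (c := fun z : E × E' => T z.1 (g z))
    ((hT.comp z differentiableAt_fst).clm_apply hg) hh]
  simp [h1, add_comm]

end Bundle

/-! ### Symmetry of second and third derivatives -/

section Symmetry

variable {E V : Type*} [NormedAddCommGroup E] [NormedSpace ℝ E] [NormedAddCommGroup V]
  [NormedSpace ℝ V] {X : E → V} {Ω : Set E}

theorem smoothOn_snd_symm (hX : ContDiffOn ℝ ∞ X Ω) (hΩ : IsOpen Ω) {x : E} (hx : x ∈ Ω)
    (u v : E) : fderiv ℝ (fderiv ℝ X) x u v = fderiv ℝ (fderiv ℝ X) x v u := by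
  rw [← smoothOn_fderiv_fderiv_apply hX hΩ hx, smoothOn_fderiv_fderiv_comm hX hΩ hx,
    smoothOn_fderiv_fderiv_apply hX hΩ hx]

/-- The first two arguments may be exchanged by symmetry of the second derivative of `DX`, the last
two by differentiating the symmetry of `D²X`. -/
theorem smoothOn_third_symm (hX : ContDiffOn ℝ ∞ X Ω) (hΩ : IsOpen Ω) {x : E} (hx : x ∈ Ω)
    (u v w : E) : fderiv ℝ (fderiv ℝ (fderiv ℝ X)) x u v w
      = fderiv ℝ (fderiv ℝ (fderiv ℝ X)) x v w u := by
  rw [smoothOn_snd_symm (smoothOn_fderiv hX hΩ) hΩ hx]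
  have h3 := smoothOn_differentiableAt (smoothOn_fderiv (smoothOn_fderiv hX hΩ) hΩ) hΩ hx
  have h1 : Set.EqOn (fun x => fderiv ℝ (fderiv ℝ X) x u w)
    (fun x => fderiv ℝ (fderiv ℝ X) x w u) Ω := fun x hx => smoothOn_snd_symm hX hΩ hx u w
  have h2 := congrArg (fun T => T v) (fderiv_eq_of_eqOn hΩ h1 hx)
  have h4 : ∀ u w, fderiv ℝ (fun x => fderiv ℝ (fderiv ℝ X) x u w) x v
      = fderiv ℝ (fderiv ℝ (fderiv ℝ X)) x v u w := by
    intro u w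
    rw [fderiv_clm_apply (h3.clm_apply (differentiableAt_const _)) (differentiableAt_const _),
      fderiv_clm_apply h3 (differentiableAt_const _)]
    simp
  simpa only [h4] using h2

end Symmetry

/-! ### Connection and curvature from the ambient acceleration -/

section Extrinsic

variable {n : ℕ} {V : Type*} [NormedAddCommGroup V] [NormedSpace ℝ V]
  {F : Coord n → Coord n → ℝ} {Ω : Set (Coord n)} {X : Coord n → V} {a : Coord n × Coord n → V}
  {z : Coord n × Coord n}

/-- The `y`-derivative of the formula for `dX(G)`, where `a` is the acceleration in the ambient
space of the image under `X` of a geodesic. -/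
theorem IsFinslerOn.map_connection (hF : IsFinslerOn F Ω) (hX : ContDiffOn ℝ ∞ X Ω)
    (ha : ContDiffOn ℝ ∞ a (slit Ω))
    (hG : ∀ z ∈ slit Ω, fderiv ℝ X z.1 (spray F z)
      = (1 / 2 : ℝ) • (fderiv ℝ (fderiv ℝ X) z.1 z.2 z.2 - a z))
    (hz : z ∈ slit Ω) (u : Coord n) :
    fderiv ℝ X z.1 (connection F u z)
      = fderiv ℝ (fderiv ℝ X) z.1 z.2 u - (1 / 2 : ℝ) • fderiv ℝ a z (0, u) := by
  have hO := isOpen_slit hF.isOpen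
  have hX1 := smoothOn_differentiableAt (smoothOn_fderiv hX hF.isOpen) hF.isOpen hz.1
  have hX2 := smoothOn_differentiableAt
    (smoothOn_fderiv (smoothOn_fderiv hX hF.isOpen) hF.isOpen) hF.isOpen hz.1
  have hS := smoothOn_differentiableAt hF.smoothOn_spray hO hz
  have hA := smoothOn_differentiableAt ha hO hz
  have h := congrArg (fun T => T ((0 : Coord n), u)) (fderiv_eq_of_eqOn hO hG hz)
  have hd : DifferentiableAt ℝ
      (fun z : Coord n × Coord n => fderiv ℝ (fderiv ℝ X) z.1 z.2 z.2) z :=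
    ((hX2.comp z differentiableAt_fst).clm_apply differentiableAt_snd).clm_apply
      differentiableAt_snd
  rw [fderiv_clm_comp_fst hX1 hS, fderiv_fun_const_smul (hd.fun_sub hA), fderiv_fun_sub hd hA,
    smul_apply, sub_apply, fderiv_bilinear_comp_fst hX2 differentiableAt_snd differentiableAt_snd,
    fderiv_snd] at h
  simp only [map_zero, zero_apply, zero_add, ContinuousLinearMap.coe_snd'] at h
  rw [connection, h, smoothOn_snd_symm hX hF.isOpen hz.1 u z.2]
  module

/-- The formula for `dX(G)` is differentiated in `x`, the one for the connection along the geodesic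
field. All second and third derivatives of `X` then cancel, so that explicit second derivatives of
the parametrization are absent from the result. -/
theorem IsFinslerOn.map_curvOp (hF : IsFinslerOn F Ω) (hX : ContDiffOn ℝ ∞ X Ω)
    (ha : ContDiffOn ℝ ∞ a (slit Ω))
    (hG : ∀ z ∈ slit Ω, fderiv ℝ X z.1 (spray F z)
      = (1 / 2 : ℝ) • (fderiv ℝ (fderiv ℝ X) z.1 z.2 z.2 - a z))
    (hz : z ∈ slit Ω) (u : Coord n) :
    fderiv ℝ X z.1 (curvOp F z u) = -fderiv ℝ a z (u, 0)
      + (1 / 2 : ℝ) • fderiv ℝ (fun z => fderiv ℝ a z (0, u)) z (z.2, -(2 : ℝ) • spray F z)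
      + (1 / 2 : ℝ) • fderiv ℝ a z (0, connection F u z) := by
  have hO := isOpen_slit hF.isOpen
  have hX1 := smoothOn_differentiableAt (smoothOn_fderiv hX hF.isOpen) hF.isOpen hz.1
  have hX2 := smoothOn_differentiableAt
    (smoothOn_fderiv (smoothOn_fderiv hX hF.isOpen) hF.isOpen) hF.isOpen hz.1
  have hS := smoothOn_differentiableAt hF.smoothOn_spray hO hz
  have hN := smoothOn_differentiableAt (hF.smoothOn_connection u) hO hz
  have hA := smoothOn_differentiableAt ha hO hz
  have hAu := smoothOn_differentiableAt (smoothOn_fderiv_apply ha hO (0, u)) hO hz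
  have hd : DifferentiableAt ℝ
      (fun z : Coord n × Coord n => fderiv ℝ (fderiv ℝ X) z.1 z.2 z.2) z :=
    ((hX2.comp z differentiableAt_fst).clm_apply differentiableAt_snd).clm_apply
      differentiableAt_snd
  have hd' : DifferentiableAt ℝ (fun z : Coord n × Coord n => fderiv ℝ (fderiv ℝ X) z.1 z.2 u) z :=
    ((hX2.comp z differentiableAt_fst).clm_apply differentiableAt_snd).clm_apply
      (differentiableAt_const _)
  have h := congrArg (fun T => T (u, (0 : Coord n))) (fderiv_eq_of_eqOn hO hG hz)
  rw [fderiv_clm_comp_fst hX1 hS, fderiv_fun_const_smul (hd.fun_sub hA), fderiv_fun_sub hd hA,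
    smul_apply, sub_apply, fderiv_bilinear_comp_fst hX2 differentiableAt_snd differentiableAt_snd,
    fderiv_snd] at h
  simp only [map_zero, zero_apply, add_zero, ContinuousLinearMap.coe_snd'] at h
  have h' := congrArg (fun T => T (z.2, -(2 : ℝ) • spray F z)) (fderiv_eq_of_eqOn hO
    (fun z hz => hF.map_connection hX ha hG hz u) hz)
  rw [fderiv_clm_comp_fst hX1 hN, fderiv_fun_sub hd' (hAu.fun_const_smul _),
    fderiv_fun_const_smul hAu, sub_apply, smul_apply,
    fderiv_bilinear_comp_fst hX2 differentiableAt_snd (differentiableAt_const _),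
    fderiv_snd, fderiv_fun_const] at h'
  simp only [Pi.zero_apply, map_zero, zero_apply, add_zero, ContinuousLinearMap.coe_snd', map_smul,
    smul_apply] at h'
  have h'' := hF.map_connection hX ha hG hz (connection F u z)
  -- The third derivatives occur as `D³X(u, y, y)` and `D³X(y, y, u)`; they must be brought to the
  -- same order before they cancel.
  rw [smoothOn_third_symm hX hF.isOpen hz.1 u z.2 z.2] at h
  rw [smoothOn_snd_symm hX hF.isOpen hz.1 (spray F z) u] at h'
  rw [curvOp, map_sub, map_sub, map_smul, h'', eq_sub_of_add_eq' h, eq_sub_of_add_eq' h']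
  module

end Extrinsic

end Finsler

namespace Finsler

/-! ## The rotation field and adapted frames -/

/-- The infinitesimal rotation `(x, y, z) ↦ (-y, x, 0)` as a linear map. -/
def rotLin : E3 →L[ℝ] E3 :=
  LinearMap.toContinuousLinearMap
    { toFun := fun p => !₂[-(p 1), p 0, 0]
      map_add' := fun p q => by ext i; fin_cases i <;> simp [add_comm]
      map_smul' := fun c p => by ext i; fin_cases i <;> simp }

theorem rotLin_apply (p : E3) : rotLin p = !₂[-(p 1), p 0, 0] := rfl

theorem inner_E3 (p q : E3) : ⟪p, q⟫ = p 0 * q 0 + p 1 * q 1 + p 2 * q 2 := by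
  simp [PiLp.inner_apply, Fin.sum_univ_three, mul_comm]

theorem inner_rotLin_left (p q : E3) : ⟪rotLin p, q⟫ = -⟪p, rotLin q⟫ := by
  simp [inner_E3, rotLin_apply]

theorem inner_rotLin_self (p : E3) : ⟪p, rotLin p⟫ = 0 := by
  simp [inner_E3, rotLin_apply]; ring

theorem inner_rotLin_rotLin (p : E3) : ⟪rotLin p, rotLin p⟫ = p 0 ^ 2 + p 1 ^ 2 := by
  rw [inner_E3]; simp [rotLin_apply]; ring

/-- `p, f, g` is an orthonormal basis of `ℝ³` such that the axis of rotation is `a f + c p`. -/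
structure IsFrame (p f g : E3) (a c : ℝ) : Prop where
  pp : ⟪p, p⟫ = 1
  ff : ⟪f, f⟫ = 1
  gg : ⟪g, g⟫ = 1
  pf : ⟪p, f⟫ = 0
  pg : ⟪p, g⟫ = 0
  fg : ⟪f, g⟫ = 0
  rot_p : rotLin p = -a • g
  rot_f : rotLin f = c • g
  rot_g : rotLin g = a • p - c • f
  sq_add_sq : a ^ 2 + c ^ 2 = 1

/-- Here `f` points along the meridian and `g` along the parallel; `a` is the distance from the axis
and `c` the height. -/
theorem exists_isFrame {p : E3} (hp : ⟪p, p⟫ = 1) : ∃ f g a c, IsFrame p f g a c := by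
  have hp' := hp
  rw [inner_E3] at hp'
  by_cases h : p 0 ^ 2 + p 1 ^ 2 = 0
  · have h0 : p 0 = 0 := by nlinarith [sq_nonneg (p 0), sq_nonneg (p 1)]
    have h1 : p 1 = 0 := by nlinarith [sq_nonneg (p 0), sq_nonneg (p 1)]
    have h2 : p 2 * p 2 = 1 := by simpa [h0, h1] using hp'
    -- At the poles any horizontal `f` would do; the sign `p 2 = ±1` in `g` fixes the orientation.
    refine ⟨!₂[1, 0, 0], !₂[0, p 2, 0], 0, p 2, hp, ?_, ?_, ?_, ?_, ?_, ?_, ?_, ?_, ?_⟩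
    all_goals first
      | (rw [inner_E3]; simp [h0, h1, h2])
      | (ext i; fin_cases i <;> simp [rotLin_apply, h0, h1, h2])
      | (rw [sq (p 2), h2]; norm_num)
  · have hpos : 0 < p 0 ^ 2 + p 1 ^ 2 := lt_of_le_of_ne (by positivity) (Ne.symm h)
    set a := √(p 0 ^ 2 + p 1 ^ 2) with ha
    have ha0 : 0 < a := Real.sqrt_pos.2 hpos
    have hane := ha0.ne'
    have ha2 : a ^ 2 = p 0 ^ 2 + p 1 ^ 2 := Real.sq_sqrt hpos.le
    have hc : p 2 ^ 2 = 1 - a ^ 2 := by rw [ha2]; linarith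
    -- With `e` the unit vector of the axis, `f = (e - c p) / a` is the normalized gradient of the
    -- height, and `g = -v / a`.
    refine ⟨!₂[-(p 2 * p 0) / a, -(p 2 * p 1) / a, a], !₂[p 1 / a, -p 0 / a, 0], a, p 2, hp,
      ?_, ?_, ?_, ?_, ?_, ?_, ?_, ?_, ?_⟩
    · simp only [inner_E3]; simp; field_simp; nlinarith
    · simp only [inner_E3]; simp; field_simp; linarith
    · simp only [inner_E3]; simp; field_simp; linear_combination p 2 * ha2
    · simp only [inner_E3]; simp; field_simp; ring
    · simp only [inner_E3]; simp; field_simp; ring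
    · ext i; fin_cases i <;> simp [rotLin_apply] <;> field_simp
    · ext i; fin_cases i <;> simp [rotLin_apply] <;> field_simp
    · ext i; fin_cases i <;> simp [rotLin_apply] <;> field_simp <;>
        first | ring1 | (rw [hc]; ring1)
    · rw [hc]; ring

namespace IsFrame

variable {p f g : E3} {a c : ℝ}

theorem eq_sum (h : IsFrame p f g a c) (y : E3) :
    y = ⟪p, y⟫ • p + ⟪f, y⟫ • f + ⟪g, y⟫ • g := by
  have ho : Orthonormal ℝ ![p, f, g] := by
    rw [orthonormal_iff_ite]
    intro i j
    have h1 := (real_inner_comm p f).trans h.pf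
    have h2 := (real_inner_comm p g).trans h.pg
    have h3 := (real_inner_comm f g).trans h.fg
    have h4 := h.pp
    have h5 := h.ff
    have h6 := h.gg
    fin_cases i <;> fin_cases j <;> simp_all [h.pf, h.pg, h.fg]
  have hb : ⊤ ≤ Submodule.span ℝ (Set.range ![p, f, g]) := by
    rw [← (basisOfOrthonormalOfCardEqFinrank ho (by simp)).span_eq]
    simp
  have := (OrthonormalBasis.mk ho hb).sum_repr' y
  simpa [Fin.sum_univ_three] using this.symm

theorem eq_sum_of_tangent (h : IsFrame p f g a c) {y : E3} (hy : ⟪p, y⟫ = 0) :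
    y = ⟪f, y⟫ • f + ⟪g, y⟫ • g := by
  conv_lhs => rw [h.eq_sum y, hy]
  module

theorem inner_rot_self (h : IsFrame p f g a c) : ⟪rotLin p, rotLin p⟫ = a ^ 2 := by
  rw [h.rot_p, real_inner_smul_left, real_inner_smul_right, h.gg]; ring

end IsFrame

/-! ## Local parametrizations of the sphere -/

/-- `X` is an immersion of the open set `Ω` into the unit sphere. -/
structure IsSphereParam (X : Coord 2 → E3) (Ω : Set (Coord 2)) : Prop where
  isOpen : IsOpen Ω
  smooth : ContDiffOn ℝ ∞ X Ω
  inner_self : ∀ x ∈ Ω, ⟪X x, X x⟫ = 1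
  injective : ∀ x ∈ Ω, Function.Injective (fderiv ℝ X x)

namespace IsSphereParam

variable {X : Coord 2 → E3} {Ω : Set (Coord 2)} {x : Coord 2}

theorem inner_fderiv (h : IsSphereParam X Ω) (hx : x ∈ Ω) (u : Coord 2) :
    ⟪X x, fderiv ℝ X x u⟫ = 0 := by
  have hd := smoothOn_differentiableAt h.smooth h.isOpen hx
  have h1 := congrArg (fun T => T u) (fderiv_eq_of_eqOn h.isOpen
    (f := fun x => ⟪X x, X x⟫) (g := fun _ => 1) h.inner_self hx)
  rw [fderiv_inner_apply ℝ hd hd, fderiv_fun_const, real_inner_comm] at h1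
  simp only [Pi.zero_apply, zero_apply] at h1
  rw [real_inner_comm]
  linarith

theorem inner_fderiv_fderiv (h : IsSphereParam X Ω) (hx : x ∈ Ω) (u v : Coord 2) :
    ⟪X x, fderiv ℝ (fderiv ℝ X) x v u⟫ = -⟪fderiv ℝ X x u, fderiv ℝ X x v⟫ := by
  have hd := smoothOn_differentiableAt h.smooth h.isOpen hx
  have hd' := smoothOn_differentiableAt (smoothOn_fderiv_apply h.smooth h.isOpen u) h.isOpen hx
  have h1 := congrArg (fun T => T v) (fderiv_eq_of_eqOn h.isOpen
    (f := fun x => ⟪X x, fderiv ℝ X x u⟫) (g := fun _ => 0)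
    (fun x hx => h.inner_fderiv hx u) hx)
  rw [fderiv_inner_apply ℝ hd hd', fderiv_fun_const, smoothOn_fderiv_fderiv_apply h.smooth
    h.isOpen hx] at h1
  simp only [Pi.zero_apply, zero_apply] at h1
  rw [real_inner_comm (fderiv ℝ X x v)]
  linarith

/-- The image of the injective differential is a plane inside the plane orthogonal to `X x`, hence
equal to it. -/
theorem exists_fderiv_eq (h : IsSphereParam X Ω) (hx : x ∈ Ω) {y : E3} (hy : ⟪X x, y⟫ = 0) :
    ∃ u, fderiv ℝ X x u = y := by
  have hne : X x ≠ 0 := fun h0 => by simpa [h0] using h.inner_self x hx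
  have hle : LinearMap.range (fderiv ℝ X x : Coord 2 →ₗ[ℝ] E3) ≤ (ℝ ∙ X x)ᗮ := by
    rintro _ ⟨u, rfl⟩
    exact Submodule.mem_orthogonal_singleton_iff_inner_right.2 (h.inner_fderiv hx u)
  have heq := Submodule.eq_of_le_of_finrank_eq hle (by
    rw [LinearMap.finrank_range_of_inj (h.injective x hx), Submodule.finrank_orthogonal_span_singleton
      (n := 2) hne]
    simp)
  have hy' : y ∈ (ℝ ∙ X x)ᗮ := Submodule.mem_orthogonal_singleton_iff_inner_right.2 hy
  rw [← heq] at hy'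
  exact hy'

/-- The velocity `dX(x) y`. -/
def velocity (X : Coord 2 → E3) (z : Coord 2 × Coord 2) : E3 := fderiv ℝ X z.1 z.2

variable {z : Coord 2 × Coord 2}

theorem velocity_ne_zero (h : IsSphereParam X Ω) (hz : z ∈ slit Ω) : velocity X z ≠ 0 := fun h0 =>
  hz.2 (h.injective z.1 hz.1 (h0.trans (map_zero _).symm))

theorem inner_velocity (h : IsSphereParam X Ω) (hz : z ∈ slit Ω) : ⟪X z.1, velocity X z⟫ = 0 :=
  h.inner_fderiv hz.1 z.2

theorem smoothOn_position (h : IsSphereParam X Ω) :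
    ContDiffOn ℝ ∞ (fun z : Coord 2 × Coord 2 => X z.1) (slit Ω) :=
  h.smooth.comp contDiffOn_fst fun _ hz => hz.1

theorem smoothOn_velocity (h : IsSphereParam X Ω) : ContDiffOn ℝ ∞ (velocity X) (slit Ω) :=
  ((smoothOn_fderiv h.smooth h.isOpen).comp contDiffOn_fst fun _ hz => hz.1).clm_apply
    contDiffOn_snd

theorem differentiableAt_position (h : IsSphereParam X Ω) (hz : z ∈ slit Ω) :
    DifferentiableAt ℝ (fun z : Coord 2 × Coord 2 => X z.1) z :=
  smoothOn_differentiableAt h.smoothOn_position (isOpen_slit h.isOpen) hz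

theorem differentiableAt_velocity (h : IsSphereParam X Ω) (hz : z ∈ slit Ω) :
    DifferentiableAt ℝ (velocity X) z :=
  smoothOn_differentiableAt h.smoothOn_velocity (isOpen_slit h.isOpen) hz

theorem fderiv_position (h : IsSphereParam X Ω) (hz : z ∈ slit Ω) (ξ : Coord 2 × Coord 2) :
    fderiv ℝ (fun z : Coord 2 × Coord 2 => X z.1) z ξ = fderiv ℝ X z.1 ξ.1 :=
  fderiv_comp_fst (smoothOn_differentiableAt h.smooth h.isOpen hz.1) ξ

theorem fderiv_velocity (h : IsSphereParam X Ω) (hz : z ∈ slit Ω) (ξ : Coord 2 × Coord 2) :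
    fderiv ℝ (velocity X) z ξ = fderiv ℝ (fderiv ℝ X) z.1 ξ.1 z.2 + fderiv ℝ X z.1 ξ.2 := by
  have := fderiv_clm_comp_fst (smoothOn_differentiableAt (smoothOn_fderiv h.smooth h.isOpen)
    h.isOpen hz.1) (g := Prod.snd) differentiableAt_snd ξ
  rw [fderiv_snd] at this
  exact this

end IsSphereParam

end Finsler

namespace Finsler

/-! ## The Randers metric in local coordinates -/

/-- The expression for `α` at an arbitrary point of `ℝ³`. -/
def alphaAmb (ε : ℝ) (p y : E3) : ℝ :=
  √(ε ^ 2 * ⟪rotLin p, y⟫ ^ 2 + ⟪y, y⟫ * (1 - ε ^ 2 * ⟪rotLin p, rotLin p⟫)) /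
    (1 - ε ^ 2 * ⟪rotLin p, rotLin p⟫)

/-- The expression for `β` at an arbitrary point of `ℝ³`. -/
def betaAmb (ε : ℝ) (p y : E3) : ℝ :=
  -(ε * ⟪rotLin p, y⟫) / (1 - ε ^ 2 * ⟪rotLin p, rotLin p⟫)

/-- The expression for `α + β` at an arbitrary point of `ℝ³`. -/
def randersAmb (ε : ℝ) (p y : E3) : ℝ := alphaAmb ε p y + betaAmb ε p y

section Ambient

variable {ε : ℝ} {p y : E3}

theorem discrim_pos (hl : 0 < 1 - ε ^ 2 * ⟪rotLin p, rotLin p⟫) (hy : y ≠ 0) :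
    0 < ε ^ 2 * ⟪rotLin p, y⟫ ^ 2 + ⟪y, y⟫ * (1 - ε ^ 2 * ⟪rotLin p, rotLin p⟫) :=
  add_pos_of_nonneg_of_pos (by positivity) (mul_pos (real_inner_self_pos.2 hy) hl)

theorem mul_randersAmb_add (hl : 0 < 1 - ε ^ 2 * ⟪rotLin p, rotLin p⟫) :
    (1 - ε ^ 2 * ⟪rotLin p, rotLin p⟫) * randersAmb ε p y + ε * ⟪rotLin p, y⟫
      = √(ε ^ 2 * ⟪rotLin p, y⟫ ^ 2 + ⟪y, y⟫ * (1 - ε ^ 2 * ⟪rotLin p, rotLin p⟫)) := by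
  have := hl.ne'
  rw [randersAmb, alphaAmb, betaAmb]
  field_simp
  ring

/-- The navigation equation `|y - F ε v|² = F²` multiplied out; `α + β` is the root given by the
quadratic formula. -/
theorem mul_randersAmb_sq (hl : 0 < 1 - ε ^ 2 * ⟪rotLin p, rotLin p⟫) :
    (1 - ε ^ 2 * ⟪rotLin p, rotLin p⟫) * randersAmb ε p y ^ 2
      + 2 * ε * randersAmb ε p y * ⟪rotLin p, y⟫ = ⟪y, y⟫ := by
  have h1 := mul_randersAmb_add (y := y) hl
  have h2 : 0 ≤ ⟪y, y⟫ := real_inner_self_nonneg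
  have h3 := Real.sq_sqrt (show 0 ≤ ε ^ 2 * ⟪rotLin p, y⟫ ^ 2
    + ⟪y, y⟫ * (1 - ε ^ 2 * ⟪rotLin p, rotLin p⟫) by positivity)
  rw [← h1] at h3
  refine mul_left_cancel₀ hl.ne' ?_
  linear_combination h3

theorem randersAmb_pos (hl : 0 < 1 - ε ^ 2 * ⟪rotLin p, rotLin p⟫) (hy : y ≠ 0) :
    0 < randersAmb ε p y := by
  have h1 := mul_randersAmb_add (y := y) hl
  have h2 : ε * ⟪rotLin p, y⟫
      < √(ε ^ 2 * ⟪rotLin p, y⟫ ^ 2 + ⟪y, y⟫ * (1 - ε ^ 2 * ⟪rotLin p, rotLin p⟫)) := by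
    refine Real.lt_sqrt_of_sq_lt ?_
    have := mul_pos (real_inner_self_pos.2 hy) hl
    linarith [mul_pow ε ⟪rotLin p, y⟫ 2]
  exact pos_of_mul_pos_right (by linarith) hl.le

theorem alphaAmb_smul (c : ℝ) (hc : 0 ≤ c) : alphaAmb ε p (c • y) = c * alphaAmb ε p y := by
  rw [alphaAmb, alphaAmb, ← mul_div_assoc]
  congr 1
  conv_rhs => rw [← Real.sqrt_sq hc]
  rw [← Real.sqrt_mul (sq_nonneg c)]
  simp only [real_inner_smul_left, real_inner_smul_right]
  congr 1
  ring

theorem betaAmb_smul (c : ℝ) : betaAmb ε p (c • y) = c * betaAmb ε p y := by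
  simp only [betaAmb, real_inner_smul_right]
  ring

theorem randersAmb_smul (c : ℝ) (hc : 0 ≤ c) : randersAmb ε p (c • y) = c * randersAmb ε p y := by
  rw [randersAmb, alphaAmb_smul c hc, betaAmb_smul, randersAmb, mul_add]

end Ambient

open IsSphereParam

/-- `α + β` as a function on the tangent bundle of the parameter domain. -/
def randersFun (ε : ℝ) (X : Coord 2 → E3) (z : Coord 2 × Coord 2) : ℝ :=
  randersAmb ε (X z.1) (velocity X z)

/-- `α + β` in the coordinates given by `X`. -/
def randersCoord (ε : ℝ) (X : Coord 2 → E3) (x y : Coord 2) : ℝ := randersFun ε X (x, y)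

/-- The part of the domain of `X` on which `ε v` is shorter than `1`. -/
abbrev IsSlow (ε : ℝ) (X : Coord 2 → E3) (Ω : Set (Coord 2)) : Prop :=
  ∀ x ∈ Ω, 0 < 1 - ε ^ 2 * ⟪rotLin (X x), rotLin (X x)⟫

/-- The vector `y - F ε v` of length `F`. -/
def navVec (ε : ℝ) (X : Coord 2 → E3) (z : Coord 2 × Coord 2) : E3 :=
  velocity X z - (ε * randersFun ε X z) • rotLin (X z.1)

/-- The derivative of the navigation equation with respect to `F`, divided by `-2`. -/
def navDen (ε : ℝ) (X : Coord 2 → E3) (z : Coord 2 × Coord 2) : ℝ :=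
  randersFun ε X z + ε * ⟪navVec ε X z, rotLin (X z.1)⟫

/-- The acceleration in `ℝ³` of the geodesics of `α + β`. -/
def randersAcc (ε : ℝ) (X : Coord 2 → E3) (z : Coord 2 × Coord 2) : E3 :=
  (2 * ε * randersFun ε X z) • rotLin (velocity X z)
    - (randersFun ε X z ^ 2) • (ε ^ 2 • rotLin (rotLin (X z.1)) + X z.1)

/-! ### Implicit differentiation of the navigation equation; convexity and spray of `α + β` -/

section Coordinates

variable {ε : ℝ} {X : Coord 2 → E3} {Ω : Set (Coord 2)} {z : Coord 2 × Coord 2}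

theorem smoothOn_randersFun (hX : IsSphereParam X Ω) (hl : IsSlow ε X Ω) :
    ContDiffOn ℝ ∞ (randersFun ε X) (slit Ω) := by
  have h0 := hX.smoothOn_position
  have h1 : ContDiffOn ℝ ∞ (fun z : Coord 2 × Coord 2 => rotLin (X z.1)) (slit Ω) :=
    rotLin.contDiff.comp_contDiffOn h0
  have h2 := hX.smoothOn_velocity
  have h3 : ContDiffOn ℝ ∞ (fun z : Coord 2 × Coord 2 =>
      1 - ε ^ 2 * ⟪rotLin (X z.1), rotLin (X z.1)⟫) (slit Ω) :=
    contDiffOn_const.sub (contDiffOn_const.mul (h1.inner ℝ h1))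
  have h4 : ∀ z ∈ slit Ω, 1 - ε ^ 2 * ⟪rotLin (X z.1), rotLin (X z.1)⟫ ≠ 0 :=
    fun z hz => (hl z.1 hz.1).ne'
  refine ContDiffOn.add (ContDiffOn.div (ContDiffOn.sqrt ?_ fun z hz =>
    (discrim_pos (hl z.1 hz.1) (hX.velocity_ne_zero hz)).ne') h3 h4)
    (ContDiffOn.div (contDiffOn_const.mul (h1.inner ℝ h2)).neg h3 h4)
  exact (contDiffOn_const.mul ((h1.inner ℝ h2).pow 2)).add ((h2.inner ℝ h2).mul h3)

theorem randersFun_pos (hX : IsSphereParam X Ω) (hl : IsSlow ε X Ω) (hz : z ∈ slit Ω) :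
    0 < randersFun ε X z :=
  randersAmb_pos (hl z.1 hz.1) (hX.velocity_ne_zero hz)

theorem navDen_eq : navDen ε X z =
    (1 - ε ^ 2 * ⟪rotLin (X z.1), rotLin (X z.1)⟫) * randersFun ε X z
      + ε * ⟪rotLin (X z.1), velocity X z⟫ := by
  rw [navDen, navVec, inner_sub_left, real_inner_smul_left, real_inner_comm]
  ring

/-- It is the square root of the discriminant of the navigation equation, so `F` is a simple root
and its derivatives can be found by division. -/
theorem navDen_pos (hX : IsSphereParam X Ω) (hl : IsSlow ε X Ω) (hz : z ∈ slit Ω) :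
    0 < navDen ε X z := by
  rw [navDen_eq, randersFun, mul_randersAmb_add (hl z.1 hz.1)]
  exact Real.sqrt_pos.2 (discrim_pos (hl z.1 hz.1) (hX.velocity_ne_zero hz))

theorem inner_velocity_self (hl : IsSlow ε X Ω) (hz : z ∈ slit Ω) :
    ⟪velocity X z, velocity X z⟫
      = (1 - ε ^ 2 * ⟪rotLin (X z.1), rotLin (X z.1)⟫) * randersFun ε X z ^ 2
      + 2 * ε * randersFun ε X z * ⟪rotLin (X z.1), velocity X z⟫ :=
  (mul_randersAmb_sq (hl z.1 hz.1)).symm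

theorem inner_navVec_self (hl : IsSlow ε X Ω) (hz : z ∈ slit Ω) :
    ⟪navVec ε X z, navVec ε X z⟫ = randersFun ε X z ^ 2 := by
  have h := inner_velocity_self hl hz
  have h' := real_inner_comm (velocity X z) (rotLin (X z.1))
  simp only [navVec, inner_sub_left, inner_sub_right, real_inner_smul_left, real_inner_smul_right]
  linear_combination h + ε * randersFun ε X z * h'

theorem inner_navVec_position (hX : IsSphereParam X Ω) (hz : z ∈ slit Ω) :
    ⟪navVec ε X z, X z.1⟫ = 0 := by
  rw [navVec, real_inner_comm, inner_sub_right, hX.inner_velocity hz, real_inner_smul_right,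
    inner_rotLin_self]
  simp

theorem differentiableAt_randersFun (hX : IsSphereParam X Ω) (hl : IsSlow ε X Ω)
    (hz : z ∈ slit Ω) : DifferentiableAt ℝ (randersFun ε X) z :=
  smoothOn_differentiableAt (smoothOn_randersFun hX hl) (isOpen_slit hX.isOpen) hz

theorem fderiv_rotLin_position (hX : IsSphereParam X Ω) (hz : z ∈ slit Ω) (ξ : Coord 2 × Coord 2) :
    fderiv ℝ (fun z : Coord 2 × Coord 2 => rotLin (X z.1)) z ξ = rotLin (fderiv ℝ X z.1 ξ.1) := by
  rw [fderiv_fun_comp z rotLin.differentiableAt (hX.differentiableAt_position hz),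
    ContinuousLinearMap.fderiv, ContinuousLinearMap.comp_apply, hX.fderiv_position hz]

theorem differentiableAt_rotLin_position (hX : IsSphereParam X Ω) (hz : z ∈ slit Ω) :
    DifferentiableAt ℝ (fun z : Coord 2 × Coord 2 => rotLin (X z.1)) z :=
  rotLin.differentiableAt.comp z (hX.differentiableAt_position hz)

theorem differentiableAt_navVec (hX : IsSphereParam X Ω) (hl : IsSlow ε X Ω)
    (hz : z ∈ slit Ω) : DifferentiableAt ℝ (navVec ε X) z :=
  (hX.differentiableAt_velocity hz).fun_sub
    (((differentiableAt_randersFun hX hl hz).const_mul ε).fun_smul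
      (differentiableAt_rotLin_position hX hz))

theorem fderiv_navVec (hX : IsSphereParam X Ω) (hl : IsSlow ε X Ω) (hz : z ∈ slit Ω)
    (ξ : Coord 2 × Coord 2) :
    fderiv ℝ (navVec ε X) z ξ = fderiv ℝ (velocity X) z ξ
      - (ε * fderiv ℝ (randersFun ε X) z ξ) • rotLin (X z.1)
      - (ε * randersFun ε X z) • rotLin (fderiv ℝ X z.1 ξ.1) := by
  have h1 := (differentiableAt_randersFun hX hl hz).const_mul ε
  have h2 := differentiableAt_rotLin_position hX hz
  have h : navVec ε X = fun z => velocity X z - (ε * randersFun ε X z) • rotLin (X z.1) := rfl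
  rw [h, fderiv_fun_sub (hX.differentiableAt_velocity hz) (h1.fun_smul h2),
    fderiv_fun_smul h1 h2, fderiv_const_mul (differentiableAt_randersFun hX hl hz)]
  simp only [sub_apply, add_apply, smul_apply, ContinuousLinearMap.smulRight_apply, smul_eq_mul,
    fderiv_rotLin_position hX hz]
  module

theorem fderiv_navDen (hX : IsSphereParam X Ω) (hl : IsSlow ε X Ω) (hz : z ∈ slit Ω)
    (ξ : Coord 2 × Coord 2) :
    fderiv ℝ (navDen ε X) z ξ = fderiv ℝ (randersFun ε X) z ξ
      + ε * (⟪fderiv ℝ (navVec ε X) z ξ, rotLin (X z.1)⟫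
        + ⟪navVec ε X z, rotLin (fderiv ℝ X z.1 ξ.1)⟫) := by
  have h1 := differentiableAt_randersFun hX hl hz
  have h2 := differentiableAt_rotLin_position hX hz
  have h3 := differentiableAt_navVec hX hl hz
  have h : navDen ε X = fun z => randersFun ε X z + ε * ⟪navVec ε X z, rotLin (X z.1)⟫ := rfl
  rw [h, fderiv_fun_add h1 ((h3.inner ℝ h2).const_mul ε), fderiv_const_mul (h3.inner ℝ h2),
    add_apply, smul_apply, fderiv_inner_apply ℝ h3 h2, fderiv_rotLin_position hX hz, smul_eq_mul]
  ring

theorem differentiableAt_navDen (hX : IsSphereParam X Ω) (hl : IsSlow ε X Ω)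
    (hz : z ∈ slit Ω) : DifferentiableAt ℝ (navDen ε X) z :=
  (differentiableAt_randersFun hX hl hz).fun_add
    (((differentiableAt_navVec hX hl hz).inner ℝ (differentiableAt_rotLin_position hX hz)).const_mul
      ε)

theorem inner_navVec_fderiv (hX : IsSphereParam X Ω) (hl : IsSlow ε X Ω) (hz : z ∈ slit Ω)
    (ξ : Coord 2 × Coord 2) :
    ⟪navVec ε X z, fderiv ℝ (navVec ε X) z ξ⟫
      = randersFun ε X z * fderiv ℝ (randersFun ε X) z ξ := by
  have h1 := differentiableAt_randersFun hX hl hz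
  have h3 := differentiableAt_navVec hX hl hz
  have h := congrArg (fun T => T ξ) (fderiv_eq_of_eqOn (isOpen_slit hX.isOpen)
    (f := fun z => ⟪navVec ε X z, navVec ε X z⟫) (g := fun z => randersFun ε X z ^ 2)
    (fun z hz => inner_navVec_self hl hz) hz)
  rw [fderiv_inner_apply ℝ h3 h3, fderiv_fun_pow 2 h1, real_inner_comm (navVec ε X z)] at h
  simp only [smul_apply, nsmul_eq_mul, smul_eq_mul] at h
  norm_num at h
  linarith

/-- Differentiating `|w|² = F²` and collecting the terms with `dF`. -/
theorem fderiv_randersFun_mul (hX : IsSphereParam X Ω) (hl : IsSlow ε X Ω) (hz : z ∈ slit Ω)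
    (ξ : Coord 2 × Coord 2) :
    fderiv ℝ (randersFun ε X) z ξ * navDen ε X z = ⟪navVec ε X z, fderiv ℝ (velocity X) z ξ
      - (ε * randersFun ε X z) • rotLin (fderiv ℝ X z.1 ξ.1)⟫ := by
  have h := inner_navVec_fderiv hX hl hz ξ
  rw [fderiv_navVec hX hl hz] at h
  simp only [inner_sub_right, real_inner_smul_right] at h ⊢
  rw [navDen]
  linear_combination -h

theorem fderiv_randersFun_right_mul (hX : IsSphereParam X Ω) (hl : IsSlow ε X Ω)
    (hz : z ∈ slit Ω) (u : Coord 2) :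
    fderiv ℝ (randersFun ε X) z (0, u) * navDen ε X z = ⟪navVec ε X z, fderiv ℝ X z.1 u⟫ := by
  rw [fderiv_randersFun_mul hX hl hz, hX.fderiv_velocity hz]
  simp

/-- The derivative of `F_y u` in a direction of the total space. -/
theorem fderiv_fderiv_randersFun_mul (hX : IsSphereParam X Ω) (hl : IsSlow ε X Ω)
    (hz : z ∈ slit Ω) (u : Coord 2) (ξ : Coord 2 × Coord 2) :
    fderiv ℝ (fun z => fderiv ℝ (randersFun ε X) z (0, u)) z ξ * navDen ε X z
      + fderiv ℝ (randersFun ε X) z (0, u) * fderiv ℝ (navDen ε X) z ξ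
      = ⟪fderiv ℝ (navVec ε X) z ξ, fderiv ℝ X z.1 u⟫
        + ⟪navVec ε X z, fderiv ℝ (fderiv ℝ X) z.1 ξ.1 u⟫ := by
  have hO := isOpen_slit hX.isOpen
  have hX1 := smoothOn_fderiv_apply hX.smooth hX.isOpen u
  have h1 := smoothOn_differentiableAt (smoothOn_fderiv_apply (smoothOn_randersFun hX hl) hO (0, u))
    hO hz
  have h2 := differentiableAt_navDen hX hl hz
  have h3 := differentiableAt_navVec hX hl hz
  have h4 := smoothOn_differentiableAt hX1 hX.isOpen hz.1
  have h5 : DifferentiableAt ℝ (fun z : Coord 2 × Coord 2 => fderiv ℝ X z.1 u) z :=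
    h4.comp z differentiableAt_fst
  have h := congrArg (fun T => T ξ) (fderiv_eq_of_eqOn hO
    (fun z hz => fderiv_randersFun_right_mul hX hl hz u) hz)
  rw [fderiv_fun_mul h1 h2, fderiv_inner_apply ℝ h3 h5] at h
  have h6 := fderiv_comp_fst h4 ξ
  rw [smoothOn_fderiv_fderiv_apply hX.smooth hX.isOpen hz.1] at h6
  simp only [add_apply, smul_apply, smul_eq_mul, h6] at h
  linarith

theorem energy_randersCoord : energy (randersCoord ε X) = fun z => randersFun ε X z ^ 2 := rfl

theorem fderiv_energy_randersCoord (hX : IsSphereParam X Ω) (hl : IsSlow ε X Ω) (hz : z ∈ slit Ω)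
    (ξ : Coord 2 × Coord 2) : fderiv ℝ (energy (randersCoord ε X)) z ξ
      = 2 * randersFun ε X z * fderiv ℝ (randersFun ε X) z ξ := by
  rw [energy_randersCoord, fderiv_fun_pow 2 (differentiableAt_randersFun hX hl hz)]
  simp

theorem fderiv_fderiv_energy_randersCoord (hX : IsSphereParam X Ω) (hl : IsSlow ε X Ω)
    (hz : z ∈ slit Ω) (ξ η : Coord 2 × Coord 2) :
    fderiv ℝ (fun z => fderiv ℝ (energy (randersCoord ε X)) z ξ) z η
      = 2 * (fderiv ℝ (randersFun ε X) z η * fderiv ℝ (randersFun ε X) z ξ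
        + randersFun ε X z * fderiv ℝ (fun z => fderiv ℝ (randersFun ε X) z ξ) z η) := by
  have hO := isOpen_slit hX.isOpen
  have h1 := differentiableAt_randersFun hX hl hz
  have h2 := smoothOn_differentiableAt (smoothOn_fderiv_apply (smoothOn_randersFun hX hl) hO ξ)
    hO hz
  rw [fderiv_eq_of_eqOn hO (fun z hz => fderiv_energy_randersCoord hX hl hz ξ) hz,
    fderiv_fun_mul (h1.const_mul 2) h2, fderiv_const_mul h1]
  simp only [add_apply, smul_apply, smul_eq_mul]
  ring

theorem isFinslerOn_randersCoord (hX : IsSphereParam X Ω) (hl : IsSlow ε X Ω) :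
    IsFinslerOn (randersCoord ε X) Ω where
  isOpen := hX.isOpen
  smooth := smoothOn_randersFun hX hl
  homogeneous x hx y hy c hc := by
    simp only [randersCoord, randersFun, velocity, map_smul]
    exact randersAmb_smul c hc.le
  posDef x hx y hy := by
    have hz : (x, y) ∈ slit Ω := ⟨hx, hy⟩
    refine fundTensor_posDef (z := (x, y)) hX.isOpen (smoothOn_randersFun hX hl) hz fun u hu => ?_
    rw [fderiv_fderiv_energy_randersCoord hX hl hz]
    set z := (x, y)
    have hF := randersFun_pos hX hl hz
    have hD := navDen_pos hX hl hz
    have h1 := fderiv_fderiv_randersFun_mul hX hl hz u (0, u)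
    have h2 := inner_navVec_fderiv hX hl hz (0, u)
    have h3 := fderiv_navVec hX hl hz (0, u)
    rw [fderiv_navDen hX hl hz] at h1
    rw [hX.fderiv_velocity hz] at h3
    simp only [map_zero, zero_apply, inner_zero_right, smul_zero, sub_zero, zero_add,
      add_zero] at h1 h3
    set V := fderiv ℝ (navVec ε X) z (0, u)
    set f := fderiv ℝ (randersFun ε X) z (0, u)
    set f' := fderiv ℝ (fun z => fderiv ℝ (randersFun ε X) z (0, u)) z (0, u)
    have h4 : fderiv ℝ X z.1 u = V + (ε * f) • rotLin (X z.1) := by rw [h3]; module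
    rw [h4, inner_add_right, real_inner_smul_right] at h1
    have h5 : f' * navDen ε X z = ⟪V, V⟫ - f ^ 2 := by linear_combination h1
    -- Cauchy-Schwarz for `⟪w, V⟫ = F f` with `|w| = F`.
    have h6 : f ^ 2 ≤ ⟪V, V⟫ := by
      have h7 := real_inner_mul_inner_self_le (navVec ε X z) V
      rw [h2, inner_navVec_self hl hz] at h7
      have h8 : 0 < randersFun ε X z ^ 2 := by positivity
      nlinarith
    refine mul_pos two_pos (pos_of_mul_pos_left (b := navDen ε X z) ?_ hD.le)
    have h9 : (f * f + randersFun ε X z * f') * navDen ε X z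
        = f ^ 2 * navDen ε X z + randersFun ε X z * (⟪V, V⟫ - f ^ 2) := by
      linear_combination randersFun ε X z * h5
    rw [h9]
    -- Both summands are nonnegative. If `f ≠ 0` the first is positive; if `f = 0` then `V = dX(u) ≠
    -- 0` and the second is.
    by_cases hf : f = 0
    · have hV : V ≠ 0 := by
        intro hV
        rw [hV, hf] at h4
        exact hu (hX.injective x hx (by simpa using h4))
      have := real_inner_self_pos.2 hV
      rw [hf]
      nlinarith [mul_pos hF this]
    · have h10 : 0 < f ^ 2 * navDen ε X z := mul_pos (by positivity) hD
      nlinarith [mul_nonneg hF.le (sub_nonneg.2 h6)]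

/-- The acceleration of the geodesics is determined by the spray. -/
theorem inner_position_randersAcc (hX : IsSphereParam X Ω) (hl : IsSlow ε X Ω) (hz : z ∈ slit Ω) :
    ⟪X z.1, randersAcc ε X z⟫ = -⟪velocity X z, velocity X z⟫ := by
  rw [inner_velocity_self hl hz]
  have h1 := inner_rotLin_left (X z.1) (velocity X z)
  have h2 := inner_rotLin_left (X z.1) (rotLin (X z.1))
  have h3 := hX.inner_self z.1 hz.1
  simp only [randersAcc, inner_sub_right, inner_add_right, real_inner_smul_right]
  linear_combination 2 * ε * randersFun ε X z * h1 - randersFun ε X z ^ 2 * h3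
    - ε ^ 2 * randersFun ε X z ^ 2 * h2

/-- Along a curve with acceleration `randersAcc`, the vector `navVec` satisfies a linear ODE. -/
theorem randersAcc_sub : randersAcc ε X z - (ε * randersFun ε X z) • rotLin (velocity X z)
    = (ε * randersFun ε X z) • rotLin (navVec ε X z) - (randersFun ε X z ^ 2) • X z.1 := by
  simp only [randersAcc, navVec, map_sub, map_smul]
  module

/-- The vector `J w` is orthogonal to `w` by skewness, and `p` because `w` is tangent. This is what
keeps `F` constant along geodesics. -/
theorem inner_navVec_randersAcc_sub (hX : IsSphereParam X Ω) (hz : z ∈ slit Ω) :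
    ⟪navVec ε X z, randersAcc ε X z - (ε * randersFun ε X z) • rotLin (velocity X z)⟫ = 0 := by
  rw [randersAcc_sub, inner_sub_right, real_inner_smul_right, real_inner_smul_right,
    inner_rotLin_self, inner_navVec_position hX hz]
  simp

/-! ### Derivatives along the candidate geodesic field -/

section Geodesic

variable {G : Coord 2}

theorem fderiv_velocity_geodesic (hX : IsSphereParam X Ω) (hz : z ∈ slit Ω)
    (hG : fderiv ℝ X z.1 G = (1 / 2 : ℝ) • (fderiv ℝ (fderiv ℝ X) z.1 z.2 z.2 - randersAcc ε X z)) :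
    fderiv ℝ (velocity X) z (z.2, -(2 : ℝ) • G) = randersAcc ε X z := by
  rw [hX.fderiv_velocity hz, map_smul, hG]
  module

theorem fderiv_randersFun_geodesic (hX : IsSphereParam X Ω) (hl : IsSlow ε X Ω) (hz : z ∈ slit Ω)
    (hG : fderiv ℝ X z.1 G = (1 / 2 : ℝ) • (fderiv ℝ (fderiv ℝ X) z.1 z.2 z.2 - randersAcc ε X z)) :
    fderiv ℝ (randersFun ε X) z (z.2, -(2 : ℝ) • G) = 0 := by
  have h := fderiv_randersFun_mul hX hl hz (z.2, -(2 : ℝ) • G)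
  rw [fderiv_velocity_geodesic hX hz hG] at h
  have h2 := inner_navVec_randersAcc_sub (ε := ε) hX hz
  exact (mul_eq_zero.1 (h.trans h2)).resolve_right (navDen_pos hX hl hz).ne'

theorem fderiv_navVec_geodesic (hX : IsSphereParam X Ω) (hl : IsSlow ε X Ω) (hz : z ∈ slit Ω)
    (hG : fderiv ℝ X z.1 G = (1 / 2 : ℝ) • (fderiv ℝ (fderiv ℝ X) z.1 z.2 z.2 - randersAcc ε X z)) :
    fderiv ℝ (navVec ε X) z (z.2, -(2 : ℝ) • G)
      = (ε * randersFun ε X z) • rotLin (navVec ε X z) - (randersFun ε X z ^ 2) • X z.1 := by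
  rw [fderiv_navVec hX hl hz, fderiv_velocity_geodesic hX hz hG,
    fderiv_randersFun_geodesic hX hl hz hG, ← randersAcc_sub, velocity]
  simp

/-- Besides `F`, the quantity `⟪w, v⟫` is conserved: it is the Clairaut integral of the great
circle. -/
theorem fderiv_navDen_geodesic (hX : IsSphereParam X Ω) (hl : IsSlow ε X Ω) (hz : z ∈ slit Ω)
    (hG : fderiv ℝ X z.1 G = (1 / 2 : ℝ) • (fderiv ℝ (fderiv ℝ X) z.1 z.2 z.2 - randersAcc ε X z)) :
    fderiv ℝ (navDen ε X) z (z.2, -(2 : ℝ) • G) = 0 := by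
  rw [fderiv_navDen hX hl hz, fderiv_navVec_geodesic hX hl hz hG,
    fderiv_randersFun_geodesic hX hl hz hG]
  have h1 : velocity X z = navVec ε X z + (ε * randersFun ε X z) • rotLin (X z.1) := by
    rw [navVec]; module
  have h2 : fderiv ℝ X z.1 z.2 = velocity X z := rfl
  have h3 := inner_rotLin_left (navVec ε X z) (rotLin (X z.1))
  have h4 := inner_rotLin_self (navVec ε X z)
  have h5 := inner_rotLin_self (X z.1)
  simp only [h2, h1, map_add, map_smul, inner_sub_left, inner_add_right, real_inner_smul_left,
    real_inner_smul_right]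
  linear_combination ε ^ 2 * randersFun ε X z * h3 + ε * h4
    - ε * randersFun ε X z ^ 2 * h5

/-- The Euler-Lagrange equation for `F`. After multiplication by `navDen` both sides contain `⟪w,
D²X(y, u)⟫`; the rest agrees because `J` is skew and `p` is orthogonal to `dX(u)`. -/
theorem fderiv_fderiv_randersFun_geodesic (hX : IsSphereParam X Ω) (hl : IsSlow ε X Ω)
    (hz : z ∈ slit Ω)
    (hG : fderiv ℝ X z.1 G = (1 / 2 : ℝ) • (fderiv ℝ (fderiv ℝ X) z.1 z.2 z.2 - randersAcc ε X z))
    (u : Coord 2) :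
    fderiv ℝ (fun z => fderiv ℝ (randersFun ε X) z (0, u)) z (z.2, -(2 : ℝ) • G)
      = fderiv ℝ (randersFun ε X) z (u, 0) := by
  refine mul_right_cancel₀ (navDen_pos hX hl hz).ne' ?_
  have h1 := fderiv_fderiv_randersFun_mul hX hl hz u (z.2, -(2 : ℝ) • G)
  have h2 := fderiv_randersFun_mul hX hl hz (u, 0)
  rw [fderiv_navDen_geodesic hX hl hz hG, fderiv_navVec_geodesic hX hl hz hG] at h1
  rw [hX.fderiv_velocity hz, smoothOn_snd_symm hX.smooth hX.isOpen hz.1] at h2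
  have h3 := inner_rotLin_left (navVec ε X z) (fderiv ℝ X z.1 u)
  have h4 := hX.inner_fderiv hz.1 u
  simp only [inner_sub_left, inner_sub_right, real_inner_smul_left, real_inner_smul_right, map_zero,
    add_zero] at h1 h2
  linear_combination h1 - h2 + ε * randersFun ε X z * h3 - randersFun ε X z ^ 2 * h4

end Geodesic

/-- The right side is tangent to the sphere, since `D²X(y, y)` and the acceleration have the same
normal part. Hence it comes from some `G`, and `spray_eq` identifies `G`. -/
theorem fderiv_spray_randersCoord (hX : IsSphereParam X Ω) (hl : IsSlow ε X Ω) (hz : z ∈ slit Ω) :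
    fderiv ℝ X z.1 (spray (randersCoord ε X) z)
      = (1 / 2 : ℝ) • (fderiv ℝ (fderiv ℝ X) z.1 z.2 z.2 - randersAcc ε X z) := by
  obtain ⟨G, hG⟩ := hX.exists_fderiv_eq hz.1
    (y := (1 / 2 : ℝ) • (fderiv ℝ (fderiv ℝ X) z.1 z.2 z.2 - randersAcc ε X z)) (by
      rw [real_inner_smul_right, inner_sub_right, hX.inner_fderiv_fderiv hz.1,
        inner_position_randersAcc hX hl hz]
      simp [velocity])
  rw [← hG, (isFinslerOn_randersCoord hX hl).spray_eq hz (G := G)]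
  intro u
  rw [fderiv_fderiv_energy_randersCoord hX hl hz, fderiv_energy_randersCoord hX hl hz,
    fderiv_randersFun_geodesic hX hl hz hG, fderiv_fderiv_randersFun_geodesic hX hl hz hG]
  ring

theorem smoothOn_randersAcc (hX : IsSphereParam X Ω) (hl : IsSlow ε X Ω) :
    ContDiffOn ℝ ∞ (randersAcc ε X) (slit Ω) := by
  have h0 := hX.smoothOn_position
  have h1 := smoothOn_randersFun hX hl
  exact ((contDiffOn_const.mul h1).smul (rotLin.contDiff.comp_contDiffOn hX.smoothOn_velocity)).sub
    ((h1.pow 2).smul (((rotLin.contDiff.comp_contDiffOn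
      (rotLin.contDiff.comp_contDiffOn h0)).const_smul (ε ^ 2)).add h0))

theorem fderiv_randersAcc (hX : IsSphereParam X Ω) (hl : IsSlow ε X Ω) (hz : z ∈ slit Ω)
    (ξ : Coord 2 × Coord 2) :
    fderiv ℝ (randersAcc ε X) z ξ
      = (2 * ε * fderiv ℝ (randersFun ε X) z ξ) • rotLin (velocity X z)
        + (2 * ε * randersFun ε X z) • rotLin (fderiv ℝ (velocity X) z ξ)
        - (2 * randersFun ε X z * fderiv ℝ (randersFun ε X) z ξ) •
          (ε ^ 2 • rotLin (rotLin (X z.1)) + X z.1)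
        - (randersFun ε X z ^ 2) •
          (ε ^ 2 • rotLin (rotLin (fderiv ℝ X z.1 ξ.1)) + fderiv ℝ X z.1 ξ.1) := by
  have h1 := (differentiableAt_randersFun hX hl hz).hasFDerivAt
  have h2 := (hX.differentiableAt_position hz).hasFDerivAt
  have h3 := (hX.differentiableAt_velocity hz).hasFDerivAt
  have h4 := ((h1.const_mul (2 * ε)).fun_smul (rotLin.hasFDerivAt.comp z h3)).fun_sub
    ((HasFDerivAt.pow h1 2).fun_smul (((rotLin.hasFDerivAt.comp z
      (rotLin.hasFDerivAt.comp z h2)).fun_const_smul (ε ^ 2)).fun_add h2))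
  rw [HasFDerivAt.fderiv (f := randersAcc ε X) h4, ← hX.fderiv_position hz]
  simp only [Function.comp_apply, sub_apply, add_apply, smul_apply,
    ContinuousLinearMap.comp_apply, ContinuousLinearMap.smulRight_apply, smul_eq_mul,
    nsmul_eq_mul]
  norm_num
  module

end Coordinates

/-! ### Flag curvature, projective flatness and S-curvature of `α + β` -/

section RandersCurvature

variable {ε : ℝ} {X : Coord 2 → E3} {Ω : Set (Coord 2)} {z : Coord 2 × Coord 2}

theorem fderiv_randersAcc_right (hX : IsSphereParam X Ω) (hl : IsSlow ε X Ω) (hz : z ∈ slit Ω)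
    (u : Coord 2) : fderiv ℝ (randersAcc ε X) z (0, u)
      = (2 * ε * fderiv ℝ (randersFun ε X) z (0, u)) • rotLin (velocity X z)
        + (2 * ε * randersFun ε X z) • rotLin (fderiv ℝ X z.1 u)
        - (2 * randersFun ε X z * fderiv ℝ (randersFun ε X) z (0, u)) •
          (ε ^ 2 • rotLin (rotLin (X z.1)) + X z.1) := by
  rw [fderiv_randersAcc hX hl hz, hX.fderiv_velocity hz]
  simp

theorem half_fderiv_randersAcc_right (hX : IsSphereParam X Ω) (hl : IsSlow ε X Ω)
    (hz : z ∈ slit Ω) (u : Coord 2) : (1 / 2 : ℝ) • fderiv ℝ (randersAcc ε X) z (0, u)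
      = fderiv ℝ (randersFun ε X) z (0, u) •
          (ε • rotLin (navVec ε X z) - randersFun ε X z • X z.1)
        + (ε * randersFun ε X z) • rotLin (fderiv ℝ X z.1 u) := by
  rw [fderiv_randersAcc_right hX hl hz, navVec]
  simp only [map_sub, map_smul]
  module

theorem fderiv_fderiv_randersAcc (hX : IsSphereParam X Ω) (hl : IsSlow ε X Ω) (hz : z ∈ slit Ω)
    (u : Coord 2) :
    fderiv ℝ (fun z => fderiv ℝ (randersAcc ε X) z (0, u)) z
        (z.2, -(2 : ℝ) • spray (randersCoord ε X) z)
      = (2 * ε * fderiv ℝ (randersFun ε X) z (u, 0)) • rotLin (velocity X z)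
        + (2 * ε * fderiv ℝ (randersFun ε X) z (0, u)) • rotLin (randersAcc ε X z)
        + (2 * ε * randersFun ε X z) • rotLin (fderiv ℝ (fderiv ℝ X) z.1 z.2 u)
        - (2 * randersFun ε X z * fderiv ℝ (randersFun ε X) z (u, 0)) •
          (ε ^ 2 • rotLin (rotLin (X z.1)) + X z.1)
        - (2 * randersFun ε X z * fderiv ℝ (randersFun ε X) z (0, u)) •
          (ε ^ 2 • rotLin (rotLin (velocity X z)) + velocity X z) := by
  have hO := isOpen_slit hX.isOpen
  have hG := fderiv_spray_randersCoord hX hl hz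
  rw [fderiv_eq_of_eqOn hO (fun z hz => fderiv_randersAcc_right hX hl hz u) hz]
  have h1 := (differentiableAt_randersFun hX hl hz).hasFDerivAt
  have h2 := (hX.differentiableAt_position hz).hasFDerivAt
  have h3 := (hX.differentiableAt_velocity hz).hasFDerivAt
  have h4 := (smoothOn_differentiableAt (smoothOn_fderiv_apply (smoothOn_randersFun hX hl) hO
    (0, u)) hO hz).hasFDerivAt
  have h5 := smoothOn_differentiableAt (smoothOn_fderiv_apply hX.smooth hX.isOpen u) hX.isOpen hz.1
  have h6 : HasFDerivAt (fun z : Coord 2 × Coord 2 => fderiv ℝ X z.1 u) _ z :=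
    (h5.comp z differentiableAt_fst).hasFDerivAt
  have h7 := (((h4.const_mul (2 * ε)).fun_smul (rotLin.hasFDerivAt.comp z h3)).fun_add
    ((h1.const_mul (2 * ε)).fun_smul (rotLin.hasFDerivAt.comp z h6))).fun_sub
    (((h1.const_mul 2).fun_mul h4).fun_smul (((rotLin.hasFDerivAt.comp z
      (rotLin.hasFDerivAt.comp z h2)).fun_const_smul (ε ^ 2)).fun_add h2))
  have h8 := fderiv_comp_fst h5 (z.2, -(2 : ℝ) • spray (randersCoord ε X) z)
  rw [smoothOn_fderiv_fderiv_apply hX.smooth hX.isOpen hz.1] at h8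
  simp only [Function.comp_def] at h7
  rw [HasFDerivAt.fderiv h7]
  simp only [sub_apply, add_apply, smul_apply,
    ContinuousLinearMap.comp_apply, ContinuousLinearMap.smulRight_apply, smul_eq_mul, h8,
    fderiv_randersFun_geodesic hX hl hz hG, fderiv_fderiv_randersFun_geodesic hX hl hz hG,
    fderiv_velocity_geodesic hX hz hG, hX.fderiv_position hz]
  change _ + _ - (_ • (ε ^ 2 • rotLin (rotLin (velocity X z)) + velocity X z) + _) = _
  module

theorem map_connection_randersCoord (hX : IsSphereParam X Ω) (hl : IsSlow ε X Ω)
    (hz : z ∈ slit Ω) (u : Coord 2) :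
    fderiv ℝ X z.1 (connection (randersCoord ε X) u z)
      = fderiv ℝ (fderiv ℝ X) z.1 z.2 u
        - fderiv ℝ (randersFun ε X) z (0, u) •
          (ε • rotLin (navVec ε X z) - randersFun ε X z • X z.1)
        - (ε * randersFun ε X z) • rotLin (fderiv ℝ X z.1 u) := by
  rw [(isFinslerOn_randersCoord hX hl).map_connection hX.smooth (smoothOn_randersAcc hX hl)
    (fun z hz => fderiv_spray_randersCoord hX hl hz) hz, half_fderiv_randersAcc_right hX hl hz]
  module

/-- The horizontal derivative of `F` vanishes. In the curvature formula this removes every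
`x`-derivative of `F`. -/
theorem fderiv_randersFun_connection (hX : IsSphereParam X Ω) (hl : IsSlow ε X Ω)
    (hz : z ∈ slit Ω) (u : Coord 2) :
    fderiv ℝ (randersFun ε X) z (0, connection (randersCoord ε X) u z)
      = fderiv ℝ (randersFun ε X) z (u, 0) := by
  refine mul_right_cancel₀ (navDen_pos hX hl hz).ne' ?_
  rw [fderiv_randersFun_right_mul hX hl hz, map_connection_randersCoord hX hl hz,
    fderiv_randersFun_mul hX hl hz, hX.fderiv_velocity hz,
    smoothOn_snd_symm hX.smooth hX.isOpen hz.1 u]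
  simp only [inner_sub_right, real_inner_smul_right, inner_navVec_position hX hz,
    inner_rotLin_self, map_zero, add_zero]
  ring

theorem curvOp_randersCoord (hX : IsSphereParam X Ω) (hl : IsSlow ε X Ω) (hz : z ∈ slit Ω)
    (u : Coord 2) :
    curvOp (randersCoord ε X) z u = randersFun ε X z ^ 2 • u
      - (randersFun ε X z * fderiv ℝ (randersFun ε X) z (0, u)) • z.2 := by
  have hF := isFinslerOn_randersCoord hX hl
  have ha := smoothOn_randersAcc hX hl
  have hG : ∀ z ∈ slit Ω, _ := fun z hz => fderiv_spray_randersCoord (z := z) hX hl hz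
  apply hX.injective z.1 hz.1
  rw [hF.map_curvOp hX.smooth ha hG hz, fderiv_fderiv_randersAcc hX hl hz,
    fderiv_randersAcc_right hX hl hz, map_connection_randersCoord hX hl hz,
    fderiv_randersFun_connection hX hl hz, fderiv_randersAcc hX hl hz, hX.fderiv_velocity hz,
    smoothOn_snd_symm hX.smooth hX.isOpen hz.1 u]
  simp only [randersAcc, navVec, map_sub, map_add, map_smul, map_zero, add_zero]
  have h : fderiv ℝ X z.1 z.2 = velocity X z := rfl
  rw [h]
  module

theorem pderiv_randersCoord (hX : IsSphereParam X Ω) (hl : IsSlow ε X Ω) (hz : z ∈ slit Ω)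
    (k : Fin 2) :
    pderiv k (randersCoord ε X z.1) z.2 = fderiv ℝ (randersFun ε X) z (0, unit k) :=
  fderiv_slice_right (f := randersFun ε X) (differentiableAt_randersFun hX hl hz) _

theorem riemannCurv_randersCoord (hX : IsSphereParam X Ω) (hl : IsSlow ε X Ω) (hz : z ∈ slit Ω)
    (i k : Fin 2) :
    riemannCurv (randersCoord ε X) i k z.1 z.2
      = randersCoord ε X z.1 z.2 ^ 2 * (if i = k then 1 else 0)
        - randersCoord ε X z.1 z.2 * pderiv k (randersCoord ε X z.1) z.2 * z.2 i := by
  rw [(isFinslerOn_randersCoord hX hl).riemannCurv_eq hz, curvOp_randersCoord hX hl hz,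
    pderiv_randersCoord hX hl hz]
  simp [PiLp.single_apply, randersCoord]

/-! ## Projective flatness -/

/-- For `y` along the meridian, the `g`-component of `dX(G) = P dX(y)` is zero. It balances a term
even in `y` against `2 ε F(y) J y`; comparing `y` with `-y` gives `ε c (F(y) + F(-y)) = 0`, hence `c
= 0`. -/
theorem inner_rotLin_eq_one_of_spray_eq (hX : IsSphereParam X Ω) (hl : IsSlow ε X Ω) (hε : ε ≠ 0)
    {x : Coord 2} (hx : x ∈ Ω)
    (h : ∀ y : Coord 2, y ≠ 0 → ∃ P : ℝ, spray (randersCoord ε X) (x, y) = P • y) :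
    ⟪rotLin (X x), rotLin (X x)⟫ = 1 := by
  obtain ⟨f, g, a, c, hf⟩ := exists_isFrame (hX.inner_self x hx)
  obtain ⟨y, hy⟩ := hX.exists_fderiv_eq hx hf.pf
  have hy0 : y ≠ 0 := by
    rintro rfl
    have := hf.ff
    rw [← hy] at this
    simp at this
  have hgf := (real_inner_comm f g).trans hf.fg
  have hgp := (real_inner_comm (X x) g).trans hf.pg
  have key : ∀ s : ℝ, s ≠ 0 → ⟪g, fderiv ℝ (fderiv ℝ X) x y y⟫ * s ^ 2
      = 2 * ε * randersFun ε X (x, s • y) * (s * c) := by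
    intro s hs
    have hz : (x, s • y) ∈ slit Ω := ⟨hx, smul_ne_zero hs hy0⟩
    obtain ⟨P, hP⟩ := h (s • y) hz.2
    have h1 := congrArg (fun v => ⟪g, v⟫) (fderiv_spray_randersCoord hX hl hz)
    simp only [hP, randersAcc, velocity, map_smul, hy, hf.rot_f, hf.rot_p, hf.rot_g,
      inner_sub_right, inner_add_right, real_inner_smul_right, hgf, hgp, hf.gg, smul_apply] at h1
    linarith
  have h1 := key 1 one_ne_zero
  have h2 := key (-1) (by norm_num)
  have hp : ∀ s : ℝ, s ≠ 0 → 0 < randersFun ε X (x, s • y) := fun s hs =>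
    randersFun_pos hX hl ⟨hx, smul_ne_zero hs hy0⟩
  have h3 := hp 1 one_ne_zero
  have h4 := hp (-1) (by norm_num)
  have h5 : ε * c * (randersFun ε X (x, (1 : ℝ) • y) + randersFun ε X (x, (-1 : ℝ) • y)) = 0 := by
    linarith
  have hc : c = 0 := by
    rcases mul_eq_zero.1 h5 with h6 | h6
    · exact (mul_eq_zero.1 h6).resolve_left hε
    · linarith
  rw [hf.inner_rot_self]
  have := hf.sq_add_sq
  rw [hc] at this
  linarith

/-! ## The S-curvature -/

/-- The unit ball of `F` is a translate of the round unit disk; this is the source of the simple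
volume form. -/
theorem randersAmb_lt_one_iff {p y : E3} (hl : 0 < 1 - ε ^ 2 * ⟪rotLin p, rotLin p⟫) :
    randersAmb ε p y < 1 ↔ ‖y - ε • rotLin p‖ < 1 := by
  have h1 := mul_randersAmb_add (y := y) hl
  have h2 : randersAmb ε p y < 1 ↔
      √(ε ^ 2 * ⟪rotLin p, y⟫ ^ 2 + ⟪y, y⟫ * (1 - ε ^ 2 * ⟪rotLin p, rotLin p⟫))
        < (1 - ε ^ 2 * ⟪rotLin p, rotLin p⟫) + ε * ⟪rotLin p, y⟫ := by
    rw [← h1, add_lt_add_iff_right, mul_lt_iff_lt_one_right hl]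
  have h3 : ‖y - ε • rotLin p‖ < 1 ↔
      ⟪y, y⟫ < 1 - ε ^ 2 * ⟪rotLin p, rotLin p⟫ + 2 * ε * ⟪rotLin p, y⟫ := by
    rw [← sq_lt_one_iff₀ (norm_nonneg _), ← real_inner_self_eq_norm_sq]
    simp only [inner_sub_left, inner_sub_right, real_inner_smul_left, real_inner_smul_right]
    rw [real_inner_comm y (rotLin p)]
    constructor <;> intro h <;> linarith
  rw [h2, h3]
  have h0 : 0 ≤ ⟪y, y⟫ := real_inner_self_nonneg
  set l := 1 - ε ^ 2 * ⟪rotLin p, rotLin p⟫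
  set s := ⟪rotLin p, y⟫
  constructor
  · intro h
    have h4 := (Real.sqrt_lt' (lt_of_le_of_lt (Real.sqrt_nonneg _) h)).1 h
    nlinarith
  · intro h
    -- Positivity of `l + ε s` follows from `0 ≤ |y|² < l + 2 ε s` and `0 < l`.
    rw [Real.sqrt_lt' (by linarith)]
    nlinarith

/-- The determinant of the first fundamental form. -/
def gramDet (X : Coord 2 → E3) (x : Coord 2) : ℝ :=
  ⟪fderiv ℝ X x (unit 0), fderiv ℝ X x (unit 0)⟫ * ⟪fderiv ℝ X x (unit 1), fderiv ℝ X x (unit 1)⟫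
    - ⟪fderiv ℝ X x (unit 0), fderiv ℝ X x (unit 1)⟫ ^ 2

theorem map_eq_add (T : Coord 2 →L[ℝ] E3) (y : Coord 2) :
    T y = y 0 • T (unit 0) + y 1 • T (unit 1) := by
  rw [map_eq_sum_unit, Fin.sum_univ_two]

/-- Written in the orthonormal basis `f, g`, the map `T` is an endomorphism `M` of the plane with
`|M y| = |T y|`, and the square of its determinant is the Gram determinant. The set is a translate
of the preimage of the unit disk under `M`. -/
theorem volume_preimage_ball {T : Coord 2 →L[ℝ] E3} (hT : Function.Injective T) {p f g : E3}
    {a c : ℝ} (hf : IsFrame p f g a c) (hp : ∀ y, ⟪p, T y⟫ = 0) (ξ : Coord 2) :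
    0 < ⟪T (unit 0), T (unit 0)⟫ * ⟪T (unit 1), T (unit 1)⟫ - ⟪T (unit 0), T (unit 1)⟫ ^ 2 ∧
    MeasureTheory.volume {y : Coord 2 | ‖T y - T ξ‖ < 1} =
      ENNReal.ofReal (√(⟪T (unit 0), T (unit 0)⟫ * ⟪T (unit 1), T (unit 1)⟫
        - ⟪T (unit 0), T (unit 1)⟫ ^ 2))⁻¹ *
      MeasureTheory.volume (Metric.ball (0 : Coord 2) 1) := by
  set A : Matrix (Fin 2) (Fin 2) ℝ :=
    !![⟪f, T (unit 0)⟫, ⟪f, T (unit 1)⟫; ⟪g, T (unit 0)⟫, ⟪g, T (unit 1)⟫] with hA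
  have hin : ∀ u v, ⟪T u, T v⟫ = ⟪f, T u⟫ * ⟪f, T v⟫ + ⟪g, T u⟫ * ⟪g, T v⟫ := by
    intro u v
    conv_lhs => rw [hf.eq_sum_of_tangent (hp u)]
    simp only [inner_add_left, real_inner_smul_left]
  have hdet : ⟪T (unit 0), T (unit 0)⟫ * ⟪T (unit 1), T (unit 1)⟫
      - ⟪T (unit 0), T (unit 1)⟫ ^ 2 = A.det ^ 2 := by
    rw [hA, Matrix.det_fin_two_of, hin, hin, hin]; ring
  set M : Coord 2 →ₗ[ℝ] Coord 2 := Matrix.toLin (PiLp.basisFun 2 ℝ (Fin 2))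
    (PiLp.basisFun 2 ℝ (Fin 2)) A with hM
  have hM0 : ∀ y, M y = WithLp.toLp 2 ![⟪f, T y⟫, ⟪g, T y⟫] := by
    intro y
    rw [hM, ← Matrix.toLpLin_eq_toLin, Matrix.toLpLin_apply]
    ext i
    fin_cases i <;> simp [hA, Matrix.mulVec, dotProduct, Fin.sum_univ_two, map_eq_add T y,
      inner_add_right, real_inner_smul_right, mul_comm]
  have hMn : ∀ y, ‖M y‖ = ‖T y‖ := by
    intro y
    rw [← sq_eq_sq₀ (norm_nonneg _) (norm_nonneg _), ← real_inner_self_eq_norm_sq (T y), hin, hM0,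
      EuclideanSpace.norm_sq_eq]
    simp [Fin.sum_univ_two, sq]
  have hMdet : LinearMap.det M = A.det := LinearMap.det_toLin _ _
  have hne : LinearMap.det M ≠ 0 := by
    have hinj : Function.Injective M := by
      rw [injective_iff_map_eq_zero]
      intro y hy
      have := hMn y
      rw [hy, norm_zero] at this
      exact hT (by rw [map_zero]; exact norm_eq_zero.1 this.symm)
    exact (LinearEquiv.ofInjectiveEndo M hinj).isUnit_det'.ne_zero
  rw [hdet]
  refine ⟨by rw [hMdet] at hne; positivity, ?_⟩
  have hset : {y : Coord 2 | ‖T y - T ξ‖ < 1}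
      = (fun y => y + -ξ) ⁻¹' (M ⁻¹' Metric.ball (0 : Coord 2) 1) := by
    ext y
    simp [hMn, ← map_sub, ← sub_eq_add_neg]
  rw [hset, MeasureTheory.measure_preimage_add_right,
    MeasureTheory.Measure.addHaar_preimage_linearMap _ hne, hMdet, Real.sqrt_sq_eq_abs, abs_inv]

theorem gramDet_pos (hX : IsSphereParam X Ω) {x : Coord 2} (hx : x ∈ Ω) : 0 < gramDet X x := by
  obtain ⟨f, g, a, c, hf⟩ := exists_isFrame (hX.inner_self x hx)
  exact (volume_preimage_ball (hX.injective x hx) hf (hX.inner_fderiv hx) 0).1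

theorem bhDensity_randersCoord (hX : IsSphereParam X Ω) (hl : IsSlow ε X Ω) {x : Coord 2}
    (hx : x ∈ Ω) : bhDensity (randersCoord ε X) x = √(gramDet X x) := by
  obtain ⟨f, g, a, c, hf⟩ := exists_isFrame (hX.inner_self x hx)
  obtain ⟨ξ, hξ⟩ := hX.exists_fderiv_eq hx (y := ε • rotLin (X x)) (by
    rw [real_inner_smul_right, inner_rotLin_self, mul_zero])
  have h1 : {y : Coord 2 | randersCoord ε X x y < 1}
      = {y | ‖fderiv ℝ X x y - fderiv ℝ X x ξ‖ < 1} := by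
    ext y
    rw [Set.mem_ofPred_eq, Set.mem_ofPred_eq, hξ]
    exact randersAmb_lt_one_iff (hl x hx)
  have h2 : 0 < (MeasureTheory.volume (Metric.ball (0 : Coord 2) 1)).toReal :=
    ENNReal.toReal_pos (Metric.measure_ball_pos _ _ one_pos).ne' MeasureTheory.measure_ball_lt_top.ne
  have h3 : 0 < √(gramDet X x) := Real.sqrt_pos.2 (gramDet_pos hX hx)
  rw [bhDensity, h1, (volume_preimage_ball (hX.injective x hx) hf (hX.inner_fderiv hx) ξ).2,
    ENNReal.toReal_mul, ENNReal.toReal_ofReal (by positivity)]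
  change _ / ((√(gramDet X x))⁻¹ * _) = _
  field_simp

theorem fderiv_gramDet (hX : IsSphereParam X Ω) {x : Coord 2} (hx : x ∈ Ω) (y : Coord 2) :
    DifferentiableAt ℝ (gramDet X) x ∧ fderiv ℝ (gramDet X) x y
      = 2 * (⟪fderiv ℝ (fderiv ℝ X) x y (unit 0), fderiv ℝ X x (unit 0)⟫
          * ⟪fderiv ℝ X x (unit 1), fderiv ℝ X x (unit 1)⟫
        + ⟪fderiv ℝ (fderiv ℝ X) x y (unit 1), fderiv ℝ X x (unit 1)⟫
          * ⟪fderiv ℝ X x (unit 0), fderiv ℝ X x (unit 0)⟫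
        - ⟪fderiv ℝ X x (unit 0), fderiv ℝ X x (unit 1)⟫
          * (⟪fderiv ℝ (fderiv ℝ X) x y (unit 0), fderiv ℝ X x (unit 1)⟫
            + ⟪fderiv ℝ (fderiv ℝ X) x y (unit 1), fderiv ℝ X x (unit 0)⟫)) := by
  have hd : ∀ i, DifferentiableAt ℝ (fun x => fderiv ℝ X x (unit i)) x := fun i =>
    smoothOn_differentiableAt (smoothOn_fderiv_apply hX.smooth hX.isOpen _) hX.isOpen hx
  have hd' : ∀ i, fderiv ℝ (fun x => fderiv ℝ X x (unit i)) x y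
      = fderiv ℝ (fderiv ℝ X) x y (unit i) := fun i =>
    smoothOn_fderiv_fderiv_apply hX.smooth hX.isOpen hx _ _
  have hi : ∀ i j, HasFDerivAt (fun x => ⟪fderiv ℝ X x (unit i), fderiv ℝ X x (unit j)⟫) _ x :=
    fun i j => ((hd i).inner ℝ (hd j)).hasFDerivAt
  have h := ((hi 0 0).fun_mul (hi 1 1)).fun_sub (HasFDerivAt.pow (hi 0 1) 2)
  refine ⟨h.differentiableAt, ?_⟩
  rw [HasFDerivAt.fderiv (f := gramDet X) h]
  simp only [sub_apply, add_apply, smul_apply, smul_eq_mul, fderiv_inner_apply ℝ (hd _) (hd _), hd',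
    nsmul_eq_mul]
  have h1 := real_inner_comm (fderiv ℝ X x (unit 0)) (fderiv ℝ (fderiv ℝ X) x y (unit 0))
  have h2 := real_inner_comm (fderiv ℝ X x (unit 1)) (fderiv ℝ (fderiv ℝ X) x y (unit 1))
  have h3 := real_inner_comm (fderiv ℝ X x (unit 0)) (fderiv ℝ (fderiv ℝ X) x y (unit 1))
  rw [← h1, ← h2, ← h3]
  norm_num
  ring

/-- A form of Jacobi's formula without inverse matrices, shaped to match `fderiv_gramDet` when `dX(N
i)` is replaced by `D²X(y, unit i)`. -/
theorem gramDet_mul_trace (X : Coord 2 → E3) (x : Coord 2) (N : Fin 2 → Coord 2) :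
    gramDet X x * ∑ i, N i i =
      ⟪fderiv ℝ X x (N 0), fderiv ℝ X x (unit 0)⟫
          * ⟪fderiv ℝ X x (unit 1), fderiv ℝ X x (unit 1)⟫
        + ⟪fderiv ℝ X x (N 1), fderiv ℝ X x (unit 1)⟫
          * ⟪fderiv ℝ X x (unit 0), fderiv ℝ X x (unit 0)⟫
        - ⟪fderiv ℝ X x (unit 0), fderiv ℝ X x (unit 1)⟫
          * (⟪fderiv ℝ X x (N 0), fderiv ℝ X x (unit 1)⟫
            + ⟪fderiv ℝ X x (N 1), fderiv ℝ X x (unit 0)⟫) := by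
  rw [map_eq_add _ (N 0), map_eq_add _ (N 1), gramDet, Fin.sum_univ_two]
  simp only [inner_add_left, real_inner_smul_left]
  rw [real_inner_comm (fderiv ℝ X x (unit 0)) (fderiv ℝ X x (unit 1))]
  ring

/-- In the trace of the connection, `D²X(y, ·)` yields the logarithmic derivative of the density.
The term `J dX` has trace zero by skewness. The remaining rank one term has trace proportional to
`⟪w, J w⟫ = 0`, since `F_y(u)` is proportional to `⟪w, dX(u)⟫`. -/
theorem sCurv_randersCoord (hX : IsSphereParam X Ω) (hl : IsSlow ε X Ω) (hz : z ∈ slit Ω) :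
    sCurv (randersCoord ε X) z.1 z.2 = 0 := by
  have hd := gramDet_pos hX hz.1
  have hs : 0 < √(gramDet X z.1) := Real.sqrt_pos.2 hd
  obtain ⟨h1, h2⟩ := fderiv_gramDet hX hz.1 z.2
  have h3 : ∑ i, z.2 i / bhDensity (randersCoord ε X) z.1 *
      pderiv i (bhDensity (randersCoord ε X)) z.1
        = fderiv ℝ (gramDet X) z.1 z.2 / (2 * gramDet X z.1) := by
    have h4 : ∀ u, fderiv ℝ (bhDensity (randersCoord ε X)) z.1 u
        = fderiv ℝ (gramDet X) z.1 u / (2 * √(gramDet X z.1)) := by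
      intro u
      rw [fderiv_eq_of_eqOn hX.isOpen (fun x hx => bhDensity_randersCoord hX hl hx) hz.1,
        fderiv_sqrt h1 hd.ne']
      simp only [smul_apply, smul_eq_mul]
      ring
    have h5 := map_eq_sum_unit (fderiv ℝ (gramDet X) z.1) z.2
    have h6 := Real.mul_self_sqrt hd.le
    simp only [pderiv, h4, bhDensity_randersCoord hX hl hz.1]
    rw [h5, Finset.sum_div]
    refine Finset.sum_congr rfl fun i _ => ?_
    rw [smul_eq_mul, div_mul_div_comm, mul_left_comm, h6]
  have h7 := gramDet_mul_trace X z.1 fun i => connection (randersCoord ε X) (unit i) z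
  have hF := isFinslerOn_randersCoord hX hl
  rw [sCurv, h3, sub_eq_zero, eq_div_iff (by positivity)]
  simp only [hF.pderiv_geodesicCoeff_right hz]
  simp only [map_connection_randersCoord hX hl hz] at h7
  -- Expanding `w = dX(q)` in the coordinate basis makes the vanishing of the rank one trace a
  -- polynomial identity.
  obtain ⟨q, hq⟩ := hX.exists_fderiv_eq hz.1 (y := navVec ε X z) (by
    rw [real_inner_comm]; exact inner_navVec_position hX hz)
  have hD := (navDen_pos hX hl hz).ne'
  have h8 := fun i => eq_div_of_mul_eq hD (fderiv_randersFun_right_mul hX hl hz (unit i))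
  have h9 := hX.inner_fderiv hz.1
  have h10 : ∀ i, ⟪rotLin (fderiv ℝ X z.1 (unit i)), fderiv ℝ X z.1 (unit i)⟫ = 0 := fun i => by
    rw [real_inner_comm]; exact inner_rotLin_self _
  have h11 : ⟪rotLin (fderiv ℝ X z.1 (unit 1)), fderiv ℝ X z.1 (unit 0)⟫
      = -⟪rotLin (fderiv ℝ X z.1 (unit 0)), fderiv ℝ X z.1 (unit 1)⟫ := by
    rw [inner_rotLin_left, real_inner_comm]
  simp only [h8, ← hq, map_eq_add _ q, map_add, map_smul, inner_add_left, inner_sub_left,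
    real_inner_smul_left, h9, h10, h11] at h7
  rw [real_inner_comm (fderiv ℝ X z.1 (unit 0)) (fderiv ℝ X z.1 (unit 1))] at h7
  rw [h2]
  linear_combination 2 * h7

end RandersCurvature

/-! ## The Riemannian metric `α` in local coordinates -/

/-- The factor `1 / (1 - ε² h(v, v))`. -/
def slowInv (ε : ℝ) (p : E3) : ℝ := (1 - ε ^ 2 * ⟪rotLin p, rotLin p⟫)⁻¹

/-- The derivative of `slowInv` in the direction `q`. -/
def slowInvDeriv (ε : ℝ) (p q : E3) : ℝ :=
  2 * ε ^ 2 * slowInv ε p ^ 2 * ⟪rotLin p, rotLin q⟫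

/-- The symmetric bilinear form of `α`. -/
def alphaForm (ε : ℝ) (p w₁ w₂ : E3) : ℝ :=
  slowInv ε p * ⟪w₁, w₂⟫ + ε ^ 2 * (slowInv ε p ^ 2 * (⟪rotLin p, w₁⟫ * ⟪rotLin p, w₂⟫))

/-- The derivative of `alphaForm` with respect to the point, in the direction `q`. -/
def alphaFormDeriv (ε : ℝ) (p q w₁ w₂ : E3) : ℝ :=
  slowInvDeriv ε p q * ⟪w₁, w₂⟫
    + ε ^ 2 * (2 * slowInv ε p * slowInvDeriv ε p q * (⟪rotLin p, w₁⟫ * ⟪rotLin p, w₂⟫)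
      + slowInv ε p ^ 2 * (⟪rotLin q, w₁⟫ * ⟪rotLin p, w₂⟫ + ⟪rotLin p, w₁⟫ * ⟪rotLin q, w₂⟫))

/-- The Christoffel symbols of `α`, as a symmetric bilinear map into `ℝ³`; the diagonal values are
the accelerations of the geodesics. -/
def alphaChr (ε : ℝ) (p w₁ w₂ : E3) : E3 :=
  -(ε ^ 2 * slowInv ε p) • (⟪rotLin p, rotLin w₁⟫ • w₂ + ⟪rotLin p, rotLin w₂⟫ • w₁
      + (⟪rotLin p, w₁⟫ • rotLin w₂ + ⟪rotLin p, w₂⟫ • rotLin w₁))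
    - (alphaForm ε p w₁ w₂ + ε ^ 2 * (slowInv ε p ^ 2 * (⟪rotLin p, w₁⟫ * ⟪rotLin p, w₂⟫))) •
      (ε ^ 2 • rotLin (rotLin p) + p)

/-- The derivative of `alphaChr` with respect to the point, in the direction `q`. -/
def alphaChrDeriv (ε : ℝ) (p q w₁ w₂ : E3) : E3 :=
  -(ε ^ 2 * slowInvDeriv ε p q) • (⟪rotLin p, rotLin w₁⟫ • w₂ + ⟪rotLin p, rotLin w₂⟫ • w₁
      + (⟪rotLin p, w₁⟫ • rotLin w₂ + ⟪rotLin p, w₂⟫ • rotLin w₁))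
    - (ε ^ 2 * slowInv ε p) • (⟪rotLin q, rotLin w₁⟫ • w₂ + ⟪rotLin q, rotLin w₂⟫ • w₁
      + (⟪rotLin q, w₁⟫ • rotLin w₂ + ⟪rotLin q, w₂⟫ • rotLin w₁))
    - (alphaFormDeriv ε p q w₁ w₂
      + ε ^ 2 * (2 * slowInv ε p * slowInvDeriv ε p q * (⟪rotLin p, w₁⟫ * ⟪rotLin p, w₂⟫)
      + slowInv ε p ^ 2 * (⟪rotLin q, w₁⟫ * ⟪rotLin p, w₂⟫ + ⟪rotLin p, w₁⟫ * ⟪rotLin q, w₂⟫))) •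
      (ε ^ 2 • rotLin (rotLin p) + p)
    - (alphaForm ε p w₁ w₂ + ε ^ 2 * (slowInv ε p ^ 2 * (⟪rotLin p, w₁⟫ * ⟪rotLin p, w₂⟫))) •
      (ε ^ 2 • rotLin (rotLin q) + q)

/-- The Gauss curvature of `α`. -/
def alphaCurv (ε : ℝ) (p : E3) : ℝ :=
  slowInv ε p * (1 - 5 * ε ^ 2 + (5 * ε ^ 2 - ε ^ 4) * ⟪rotLin p, rotLin p⟫)

theorem alphaForm_comm (ε : ℝ) (p w₁ w₂ : E3) : alphaForm ε p w₁ w₂ = alphaForm ε p w₂ w₁ := by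
  simp only [alphaForm, real_inner_comm w₁ w₂]; ring

theorem alphaChr_comm (ε : ℝ) (p w₁ w₂ : E3) : alphaChr ε p w₁ w₂ = alphaChr ε p w₂ w₁ := by
  simp only [alphaChr, alphaForm_comm ε p w₁ w₂]; module

theorem alphaChr_sub_right (ε : ℝ) (p w₁ w₂ w₃ : E3) :
    alphaChr ε p w₁ (w₂ - w₃) = alphaChr ε p w₁ w₂ - alphaChr ε p w₁ w₃ := by
  simp only [alphaChr, alphaForm, map_sub, inner_sub_right]; module

namespace IsFrame

variable {ε : ℝ} {p f g : E3} {a c : ℝ}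

/-- The Euler-Lagrange equation of `α²` with the second derivatives of `X` removed. In an adapted
frame it is an identity between rational functions of `ε`, `a`, `c` and the components of `w` and
`u`. -/
theorem alphaForm_geodesic (h : IsFrame p f g a c)
    (hl : 0 < 1 - ε ^ 2 * ⟪rotLin p, rotLin p⟫) {w u : E3} (hw : ⟪p, w⟫ = 0) (hu : ⟪p, u⟫ = 0) :
    2 * alphaFormDeriv ε p w w u + 2 * alphaForm ε p (alphaChr ε p w w) u
      = alphaFormDeriv ε p u w w := by
  have hgf := (real_inner_comm f g).trans h.fg
  have hgp := (real_inner_comm p g).trans h.pg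
  rw [h.inner_rot_self] at hl
  have hl' := hl.ne'
  have hs : slowInv ε p = 1 / (1 - ε ^ 2 * a ^ 2) := by rw [slowInv, h.inner_rot_self, one_div]
  rw [h.eq_sum_of_tangent hw, h.eq_sum_of_tangent hu]
  generalize ⟪f, w⟫ = w1
  generalize ⟪g, w⟫ = w2
  generalize ⟪f, u⟫ = u1
  generalize ⟪g, u⟫ = u2
  simp only [alphaFormDeriv, alphaForm, alphaChr, slowInvDeriv, map_add, map_smul, 
    inner_add_left, inner_add_right, inner_sub_left, inner_sub_right, real_inner_smul_left,
    real_inner_smul_right, h.rot_p, h.rot_f, h.rot_g, hgf,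
    hgp, h.ff, h.gg, h.pf, h.pg, h.fg, hs, mul_zero, add_zero, zero_add,
    mul_one, sub_zero, zero_sub]
  field_simp
  ring

/-- The left side is what `map_curvOp` leaves for a quadratic acceleration: the usual curvature
expression in the Christoffel symbols. -/
theorem alphaChr_curvature (h : IsFrame p f g a c)
    (hl : 0 < 1 - ε ^ 2 * ⟪rotLin p, rotLin p⟫) {w u : E3} (hw : ⟪p, w⟫ = 0) (hu : ⟪p, u⟫ = 0) :
    -alphaChrDeriv ε p u w w + alphaChrDeriv ε p w w u + alphaChr ε p (alphaChr ε p w w) u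
      - alphaChr ε p w (alphaChr ε p w u)
      = alphaCurv ε p • (alphaForm ε p w w • u - alphaForm ε p w u • w) := by
  have hgf := (real_inner_comm f g).trans h.fg
  have hgp := (real_inner_comm p g).trans h.pg
  have hfp := (real_inner_comm p f).trans h.pf
  have hc : c ^ 2 = 1 - a ^ 2 := by linarith [h.sq_add_sq]
  have hlp := h.inner_rot_self
  rw [hlp] at hl
  have hl' := hl.ne'
  have hs : slowInv ε p = 1 / (1 - ε ^ 2 * a ^ 2) := by rw [slowInv, h.inner_rot_self, one_div]
  rw [h.eq_sum_of_tangent hw, h.eq_sum_of_tangent hu]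
  generalize ⟪f, w⟫ = w1
  generalize ⟪g, w⟫ = w2
  generalize ⟪f, u⟫ = u1
  generalize ⟪g, u⟫ = u2
  simp only [alphaCurv, alphaChrDeriv, alphaFormDeriv, alphaForm, alphaChr, slowInvDeriv, map_add,
    map_sub, map_smul, 
    inner_add_left, inner_add_right, inner_sub_left, inner_sub_right, real_inner_smul_left,
    real_inner_smul_right, h.rot_p, h.rot_f, h.rot_g, hgf,
    hgp, hfp, h.pp, h.ff, h.gg, h.pf, h.pg, h.fg, hs, mul_zero, add_zero, zero_add,
    mul_one, sub_zero, zero_sub]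
  -- The identity is compared coefficient by coefficient in the frame; two of the coefficients use
  -- `c² = 1 - a²`.
  match_scalars
  · field_simp
    ring_nf
    simp only [hc]
    ring
  · field_simp
    ring_nf
    simp only [hc]
    ring
  · field_simp
    ring

end IsFrame

/-! ### Differentiation of the form and of the Christoffel symbols of `α` -/

section Derivatives

variable {E : Type*} [NormedAddCommGroup E] [NormedSpace ℝ E] {ε : ℝ} {P W₁ W₂ : E → E3} {z : E}

theorem hasFDerivAt_slowInv (hP : DifferentiableAt ℝ P z)
    (hl : 1 - ε ^ 2 * ⟪rotLin (P z), rotLin (P z)⟫ ≠ 0) :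
    DifferentiableAt ℝ (fun z => slowInv ε (P z)) z ∧ ∀ ξ,
      fderiv ℝ (fun z => slowInv ε (P z)) z ξ = slowInvDeriv ε (P z) (fderiv ℝ P z ξ) := by
  have h1 : HasFDerivAt (fun z => rotLin (P z)) _ z := rotLin.hasFDerivAt.comp z hP.hasFDerivAt
  have h2 := ((h1.inner ℝ h1).const_mul (ε ^ 2)).const_sub 1
  have h3 : HasFDerivAt (fun z => slowInv ε (P z)) _ z := (hasDerivAt_inv hl).comp_hasFDerivAt z h2
  refine ⟨h3.differentiableAt, fun ξ => ?_⟩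
  rw [h3.fderiv]
  simp only [smul_apply, neg_apply, ContinuousLinearMap.comp_apply, ContinuousLinearMap.prod_apply,
    fderivInnerCLM_apply, smul_eq_mul, slowInvDeriv, slowInv, inv_pow]
  rw [real_inner_comm (rotLin (P z)) (rotLin (fderiv ℝ P z ξ))]
  ring

theorem hasFDerivAt_alphaForm (hP : DifferentiableAt ℝ P z) (h₁ : DifferentiableAt ℝ W₁ z)
    (h₂ : DifferentiableAt ℝ W₂ z) (hl : 1 - ε ^ 2 * ⟪rotLin (P z), rotLin (P z)⟫ ≠ 0) :
    DifferentiableAt ℝ (fun z => alphaForm ε (P z) (W₁ z) (W₂ z)) z ∧ ∀ ξ,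
      fderiv ℝ (fun z => alphaForm ε (P z) (W₁ z) (W₂ z)) z ξ
        = alphaFormDeriv ε (P z) (fderiv ℝ P z ξ) (W₁ z) (W₂ z)
          + alphaForm ε (P z) (fderiv ℝ W₁ z ξ) (W₂ z)
          + alphaForm ε (P z) (W₁ z) (fderiv ℝ W₂ z ξ) := by
  obtain ⟨hi, hi'⟩ := hasFDerivAt_slowInv hP hl
  have hR : HasFDerivAt (fun z => rotLin (P z)) _ z := rotLin.hasFDerivAt.comp z hP.hasFDerivAt
  have h3 := (hi.hasFDerivAt.fun_mul (h₁.hasFDerivAt.inner ℝ h₂.hasFDerivAt)).fun_add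
    (((HasFDerivAt.pow hi.hasFDerivAt 2).fun_mul ((hR.inner ℝ h₁.hasFDerivAt).fun_mul
      (hR.inner ℝ h₂.hasFDerivAt))).const_mul (ε ^ 2))
  refine ⟨h3.differentiableAt, fun ξ => ?_⟩
  rw [HasFDerivAt.fderiv (f := fun z => alphaForm ε (P z) (W₁ z) (W₂ z)) h3]
  simp only [add_apply, smul_apply, ContinuousLinearMap.comp_apply, ContinuousLinearMap.prod_apply,
    fderivInnerCLM_apply, smul_eq_mul, nsmul_eq_mul, hi', alphaForm, alphaFormDeriv]
  norm_num
  ring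

theorem hasFDerivAt_alphaChr (hP : DifferentiableAt ℝ P z) (h₁ : DifferentiableAt ℝ W₁ z)
    (h₂ : DifferentiableAt ℝ W₂ z) (hl : 1 - ε ^ 2 * ⟪rotLin (P z), rotLin (P z)⟫ ≠ 0) :
    DifferentiableAt ℝ (fun z => alphaChr ε (P z) (W₁ z) (W₂ z)) z ∧ ∀ ξ,
      fderiv ℝ (fun z => alphaChr ε (P z) (W₁ z) (W₂ z)) z ξ
        = alphaChrDeriv ε (P z) (fderiv ℝ P z ξ) (W₁ z) (W₂ z)
          + alphaChr ε (P z) (fderiv ℝ W₁ z ξ) (W₂ z)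
          + alphaChr ε (P z) (W₁ z) (fderiv ℝ W₂ z ξ) := by
  obtain ⟨hi, hi'⟩ := hasFDerivAt_slowInv hP hl
  obtain ⟨hQ, hQ'⟩ := hasFDerivAt_alphaForm hP h₁ h₂ hl
  have d₁ := h₁.hasFDerivAt
  have d₂ := h₂.hasFDerivAt
  have hR : HasFDerivAt (fun z => rotLin (P z)) _ z := rotLin.hasFDerivAt.comp z hP.hasFDerivAt
  have hR₁ : HasFDerivAt (fun z => rotLin (W₁ z)) _ z := rotLin.hasFDerivAt.comp z d₁
  have hR₂ : HasFDerivAt (fun z => rotLin (W₂ z)) _ z := rotLin.hasFDerivAt.comp z d₂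
  have hRR : HasFDerivAt (fun z => rotLin (rotLin (P z))) _ z := rotLin.hasFDerivAt.comp z hR
  have h3 := ((hi.hasFDerivAt.const_mul (ε ^ 2)).fun_neg.fun_smul
    ((((hR.inner ℝ hR₁).fun_smul d₂).fun_add ((hR.inner ℝ hR₂).fun_smul d₁)).fun_add
      (((hR.inner ℝ d₁).fun_smul hR₂).fun_add ((hR.inner ℝ d₂).fun_smul hR₁)))).fun_sub
    ((hQ.hasFDerivAt.fun_add (((HasFDerivAt.pow hi.hasFDerivAt 2).fun_mul
      ((hR.inner ℝ d₁).fun_mul (hR.inner ℝ d₂))).const_mul (ε ^ 2))).fun_smul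
      ((hRR.fun_const_smul (ε ^ 2)).fun_add hP.hasFDerivAt))
  refine ⟨h3.differentiableAt, fun ξ => ?_⟩
  rw [HasFDerivAt.fderiv (f := fun z => alphaChr ε (P z) (W₁ z) (W₂ z)) h3]
  simp only [add_apply, sub_apply, neg_apply, smul_apply, ContinuousLinearMap.comp_apply,
    ContinuousLinearMap.smulRight_apply, ContinuousLinearMap.prod_apply,
    fderivInnerCLM_apply, smul_eq_mul, nsmul_eq_mul, hi', hQ', alphaChr, alphaChrDeriv]
  norm_num
  module

theorem contDiffOn_slowInv {O : Set E} (hP : ContDiffOn ℝ ∞ P O)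
    (hl : ∀ z ∈ O, 1 - ε ^ 2 * ⟪rotLin (P z), rotLin (P z)⟫ ≠ 0) :
    ContDiffOn ℝ ∞ (fun z => slowInv ε (P z)) O := by
  have h1 : ContDiffOn ℝ ∞ (fun z => rotLin (P z)) O := rotLin.contDiff.comp_contDiffOn hP
  exact (contDiffOn_const.sub (contDiffOn_const.mul (h1.inner ℝ h1))).inv hl

theorem contDiffOn_alphaForm {O : Set E} (hP : ContDiffOn ℝ ∞ P O) (h₁ : ContDiffOn ℝ ∞ W₁ O)
    (h₂ : ContDiffOn ℝ ∞ W₂ O) (hl : ∀ z ∈ O, 1 - ε ^ 2 * ⟪rotLin (P z), rotLin (P z)⟫ ≠ 0) :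
    ContDiffOn ℝ ∞ (fun z => alphaForm ε (P z) (W₁ z) (W₂ z)) O := by
  have hR : ContDiffOn ℝ ∞ (fun z => rotLin (P z)) O := rotLin.contDiff.comp_contDiffOn hP
  have hi := contDiffOn_slowInv hP hl
  exact (hi.mul (h₁.inner ℝ h₂)).add (contDiffOn_const.mul
    ((hi.pow 2).mul ((hR.inner ℝ h₁).mul (hR.inner ℝ h₂))))

theorem contDiffOn_alphaChr {O : Set E} (hP : ContDiffOn ℝ ∞ P O) (h₁ : ContDiffOn ℝ ∞ W₁ O)
    (h₂ : ContDiffOn ℝ ∞ W₂ O) (hl : ∀ z ∈ O, 1 - ε ^ 2 * ⟪rotLin (P z), rotLin (P z)⟫ ≠ 0) :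
    ContDiffOn ℝ ∞ (fun z => alphaChr ε (P z) (W₁ z) (W₂ z)) O := by
  have hR : ContDiffOn ℝ ∞ (fun z => rotLin (P z)) O := rotLin.contDiff.comp_contDiffOn hP
  have hR₁ : ContDiffOn ℝ ∞ (fun z => rotLin (W₁ z)) O := rotLin.contDiff.comp_contDiffOn h₁
  have hR₂ : ContDiffOn ℝ ∞ (fun z => rotLin (W₂ z)) O := rotLin.contDiff.comp_contDiffOn h₂
  have hRR : ContDiffOn ℝ ∞ (fun z => rotLin (rotLin (P z))) O :=
    rotLin.contDiff.comp_contDiffOn hR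
  have hi := contDiffOn_slowInv hP hl
  have hQ := contDiffOn_alphaForm hP h₁ h₂ hl
  exact ((contDiffOn_const.mul hi).neg.smul
    ((((hR.inner ℝ hR₁).smul h₂).add ((hR.inner ℝ hR₂).smul h₁)).add
      (((hR.inner ℝ h₁).smul hR₂).add ((hR.inner ℝ h₂).smul hR₁)))).sub
    ((hQ.add (contDiffOn_const.mul ((hi.pow 2).mul
      ((hR.inner ℝ h₁).mul (hR.inner ℝ h₂))))).smul ((hRR.const_smul (ε ^ 2)).add hP))

end Derivatives

/-! ## The spray and the curvature of `α` -/

theorem alphaForm_self_pos {ε : ℝ} {p w : E3} (hl : 0 < 1 - ε ^ 2 * ⟪rotLin p, rotLin p⟫)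
    (hw : w ≠ 0) : 0 < alphaForm ε p w w := by
  have h1 := real_inner_self_pos.2 hw
  have h2 : 0 < slowInv ε p := inv_pos.2 hl
  rw [alphaForm]
  have := mul_pos h2 h1
  nlinarith [mul_self_nonneg (ε * (slowInv ε p * ⟪rotLin p, w⟫))]

theorem alphaAmb_eq_sqrt {ε : ℝ} {p w : E3} (hl : 0 < 1 - ε ^ 2 * ⟪rotLin p, rotLin p⟫) :
    alphaAmb ε p w = √(alphaForm ε p w w) := by
  have hne := hl.ne'
  have h : alphaForm ε p w w = (ε ^ 2 * ⟪rotLin p, w⟫ ^ 2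
      + ⟪w, w⟫ * (1 - ε ^ 2 * ⟪rotLin p, rotLin p⟫)) / (1 - ε ^ 2 * ⟪rotLin p, rotLin p⟫) ^ 2 := by
    rw [alphaForm, slowInv]
    field_simp
    ring
  rw [h, Real.sqrt_div' _ (sq_nonneg _), Real.sqrt_sq hl.le, alphaAmb]

/-- The normal part that any curve on the unit sphere must have; it makes the equation for `G`
solvable. -/
theorem inner_alphaChr {ε : ℝ} {p w : E3} (hl : 0 < 1 - ε ^ 2 * ⟪rotLin p, rotLin p⟫)
    (hp : ⟪p, p⟫ = 1) (hw : ⟪p, w⟫ = 0) : ⟪p, alphaChr ε p w w⟫ = -⟪w, w⟫ := by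
  have h1 : ⟪p, rotLin w⟫ = -⟪rotLin p, w⟫ := by rw [inner_rotLin_left, neg_neg]
  have h2 : ⟪p, rotLin (rotLin p)⟫ = -⟪rotLin p, rotLin p⟫ := by rw [inner_rotLin_left, neg_neg]
  have hi : slowInv ε p * (1 - ε ^ 2 * ⟪rotLin p, rotLin p⟫) = 1 := inv_mul_cancel₀ hl.ne'
  simp only [alphaChr, alphaForm, inner_sub_right, inner_add_right, real_inner_smul_right, hp, hw,
    h1, h2]
  linear_combination (-⟪w, w⟫ - 2 * ε ^ 2 * slowInv ε p * ⟪rotLin p, w⟫ ^ 2) * hi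

/-! ### `α` in coordinates: geodesics and Gauss curvature -/

section AlphaCoord

variable {ε : ℝ} {X : Coord 2 → E3} {Ω : Set (Coord 2)} {z : Coord 2 × Coord 2}

/-- `α` in the coordinates given by `X`. -/
def alphaCoord (ε : ℝ) (X : Coord 2 → E3) (x y : Coord 2) : ℝ :=
  alphaAmb ε (X x) (fderiv ℝ X x y)

theorem alphaCoord_eq (hl : IsSlow ε X Ω) (hz : z ∈ slit Ω) :
    alphaCoord ε X z.1 z.2 = √(alphaForm ε (X z.1) (velocity X z) (velocity X z)) :=
  alphaAmb_eq_sqrt (hl z.1 hz.1)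

theorem smoothOn_alphaCoord (hX : IsSphereParam X Ω) (hl : IsSlow ε X Ω) :
    ContDiffOn ℝ ∞ (fun z : Coord 2 × Coord 2 => alphaCoord ε X z.1 z.2) (slit Ω) := by
  refine ContDiffOn.congr (ContDiffOn.sqrt (contDiffOn_alphaForm (ε := ε) hX.smoothOn_position
    hX.smoothOn_velocity hX.smoothOn_velocity fun z hz => (hl z.1 hz.1).ne') fun z hz => ?_)
    fun z hz => alphaCoord_eq hl hz
  exact (alphaForm_self_pos (hl z.1 hz.1) (hX.velocity_ne_zero hz)).ne'

theorem energy_alphaCoord (hX : IsSphereParam X Ω) (hl : IsSlow ε X Ω) (hz : z ∈ slit Ω) :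
    energy (alphaCoord ε X) z = alphaForm ε (X z.1) (velocity X z) (velocity X z) := by
  rw [energy, alphaCoord_eq hl hz, Real.sq_sqrt
    (alphaForm_self_pos (hl z.1 hz.1) (hX.velocity_ne_zero hz)).le]

theorem fderiv_energy_alphaCoord (hX : IsSphereParam X Ω) (hl : IsSlow ε X Ω) (hz : z ∈ slit Ω)
    (ξ : Coord 2 × Coord 2) : fderiv ℝ (energy (alphaCoord ε X)) z ξ
      = alphaFormDeriv ε (X z.1) (fderiv ℝ X z.1 ξ.1) (velocity X z) (velocity X z)
        + 2 * alphaForm ε (X z.1) (fderiv ℝ (velocity X) z ξ) (velocity X z) := by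
  rw [fderiv_eq_of_eqOn (isOpen_slit hX.isOpen) (fun z hz => energy_alphaCoord hX hl hz) hz,
    (hasFDerivAt_alphaForm (hX.differentiableAt_position hz) (hX.differentiableAt_velocity hz)
      (hX.differentiableAt_velocity hz) (hl z.1 hz.1).ne').2, hX.fderiv_position hz,
    alphaForm_comm ε (X z.1) (velocity X z) (fderiv ℝ (velocity X) z ξ)]
  ring

theorem fderiv_energy_alphaCoord_right (hX : IsSphereParam X Ω) (hl : IsSlow ε X Ω)
    (hz : z ∈ slit Ω) (u : Coord 2) : fderiv ℝ (energy (alphaCoord ε X)) z (0, u)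
      = 2 * alphaForm ε (X z.1) (velocity X z) (fderiv ℝ X z.1 u) := by
  rw [fderiv_energy_alphaCoord hX hl hz, hX.fderiv_velocity hz, alphaForm_comm]
  simp [alphaFormDeriv, slowInvDeriv]

theorem differentiableAt_fderiv_position (hX : IsSphereParam X Ω) (hz : z ∈ slit Ω) (u : Coord 2) :
    DifferentiableAt ℝ (fun z : Coord 2 × Coord 2 => fderiv ℝ X z.1 u) z ∧
      ∀ ξ, fderiv ℝ (fun z : Coord 2 × Coord 2 => fderiv ℝ X z.1 u) z ξ
        = fderiv ℝ (fderiv ℝ X) z.1 ξ.1 u := by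
  have h := smoothOn_differentiableAt (smoothOn_fderiv_apply hX.smooth hX.isOpen u) hX.isOpen hz.1
  refine ⟨h.comp z differentiableAt_fst, fun ξ => ?_⟩
  rw [fderiv_comp_fst h, smoothOn_fderiv_fderiv_apply hX.smooth hX.isOpen hz.1]

theorem fderiv_fderiv_energy_alphaCoord (hX : IsSphereParam X Ω) (hl : IsSlow ε X Ω)
    (hz : z ∈ slit Ω) (u : Coord 2) (ξ : Coord 2 × Coord 2) :
    fderiv ℝ (fun z => fderiv ℝ (energy (alphaCoord ε X)) z (0, u)) z ξ
      = 2 * (alphaFormDeriv ε (X z.1) (fderiv ℝ X z.1 ξ.1) (velocity X z) (fderiv ℝ X z.1 u)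
        + alphaForm ε (X z.1) (fderiv ℝ (velocity X) z ξ) (fderiv ℝ X z.1 u)
        + alphaForm ε (X z.1) (velocity X z) (fderiv ℝ (fderiv ℝ X) z.1 ξ.1 u)) := by
  obtain ⟨h1, h2⟩ := differentiableAt_fderiv_position hX hz u
  obtain ⟨h3, h4⟩ := hasFDerivAt_alphaForm (hX.differentiableAt_position hz)
    (hX.differentiableAt_velocity hz) h1 (hl z.1 hz.1).ne'
  rw [fderiv_eq_of_eqOn (isOpen_slit hX.isOpen)
    (fun z hz => fderiv_energy_alphaCoord_right hX hl hz u) hz, fderiv_const_mul h3, smul_apply,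
    h4, h2, hX.fderiv_position hz, smul_eq_mul]

theorem isFinslerOn_alphaCoord (hX : IsSphereParam X Ω) (hl : IsSlow ε X Ω) :
    IsFinslerOn (alphaCoord ε X) Ω where
  isOpen := hX.isOpen
  smooth := smoothOn_alphaCoord hX hl
  homogeneous x hx y hy c hc := by
    simp only [alphaCoord, map_smul]
    exact alphaAmb_smul c hc.le
  posDef x hx y hy := by
    have hz : (x, y) ∈ slit Ω := ⟨hx, hy⟩
    refine fundTensor_posDef (z := (x, y)) hX.isOpen (smoothOn_alphaCoord hX hl) hz fun u hu => ?_
    rw [fderiv_fderiv_energy_alphaCoord hX hl hz, hX.fderiv_velocity hz]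
    have h : fderiv ℝ X x u ≠ 0 := hX.velocity_ne_zero (z := (x, u)) ⟨hx, hu⟩
    have := alphaForm_self_pos (hl x hx) h
    simpa [alphaFormDeriv, slowInvDeriv, alphaForm] using this

theorem fderiv_spray_alphaCoord (hX : IsSphereParam X Ω) (hl : IsSlow ε X Ω) (hz : z ∈ slit Ω) :
    fderiv ℝ X z.1 (spray (alphaCoord ε X) z) = (1 / 2 : ℝ) •
      (fderiv ℝ (fderiv ℝ X) z.1 z.2 z.2 - alphaChr ε (X z.1) (velocity X z) (velocity X z)) := by
  obtain ⟨f, g, a, c, hf⟩ := exists_isFrame (hX.inner_self z.1 hz.1)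
  obtain ⟨G, hG⟩ := hX.exists_fderiv_eq hz.1 (y := (1 / 2 : ℝ) •
      (fderiv ℝ (fderiv ℝ X) z.1 z.2 z.2 - alphaChr ε (X z.1) (velocity X z) (velocity X z))) (by
    rw [real_inner_smul_right, inner_sub_right, hX.inner_fderiv_fderiv hz.1,
      inner_alphaChr (hl z.1 hz.1) (hX.inner_self z.1 hz.1) (hX.inner_velocity hz)]
    simp [velocity])
  rw [← hG, (isFinslerOn_alphaCoord hX hl).spray_eq hz (G := G)]
  intro u
  have hv : fderiv ℝ (velocity X) z (z.2, -(2 : ℝ) • G)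
      = alphaChr ε (X z.1) (velocity X z) (velocity X z) := by
    rw [hX.fderiv_velocity hz, map_smul, hG]
    module
  rw [fderiv_fderiv_energy_alphaCoord hX hl hz, fderiv_energy_alphaCoord hX hl hz, hv,
    hX.fderiv_velocity hz, smoothOn_snd_symm hX.smooth hX.isOpen hz.1 u,
    ← hf.alphaForm_geodesic (hl z.1 hz.1) (hX.inner_velocity hz) (hX.inner_fderiv hz.1 u),
    map_zero, add_zero, alphaForm_comm ε (X z.1) (fderiv ℝ (fderiv ℝ X) z.1 z.2 u)]
  change 2 * (alphaFormDeriv ε (X z.1) (velocity X z) (velocity X z) (fderiv ℝ X z.1 u) + _ + _) = _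
  ring

theorem fderiv_alphaAcc (hX : IsSphereParam X Ω) (hl : IsSlow ε X Ω) (hz : z ∈ slit Ω)
    (ξ : Coord 2 × Coord 2) :
    fderiv ℝ (fun z => alphaChr ε (X z.1) (velocity X z) (velocity X z)) z ξ
      = alphaChrDeriv ε (X z.1) (fderiv ℝ X z.1 ξ.1) (velocity X z) (velocity X z)
        + (2 : ℝ) • alphaChr ε (X z.1) (velocity X z) (fderiv ℝ (velocity X) z ξ) := by
  rw [(hasFDerivAt_alphaChr (hX.differentiableAt_position hz) (hX.differentiableAt_velocity hz)
    (hX.differentiableAt_velocity hz) (hl z.1 hz.1).ne').2, hX.fderiv_position hz,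
    alphaChr_comm ε (X z.1) (fderiv ℝ (velocity X) z ξ)]
  module

theorem fderiv_alphaAcc_right (hX : IsSphereParam X Ω) (hl : IsSlow ε X Ω) (hz : z ∈ slit Ω)
    (u : Coord 2) :
    fderiv ℝ (fun z => alphaChr ε (X z.1) (velocity X z) (velocity X z)) z (0, u)
      = (2 : ℝ) • alphaChr ε (X z.1) (velocity X z) (fderiv ℝ X z.1 u) := by
  rw [fderiv_alphaAcc hX hl hz, hX.fderiv_velocity hz]
  simp [alphaChrDeriv, alphaFormDeriv, slowInvDeriv]

/-- All terms with `D²X(y, u)` enter `map_curvOp` through the bilinear `alphaChr` and cancel; the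
rest is `alphaChr_curvature`. -/
theorem curvOp_alphaCoord (hX : IsSphereParam X Ω) (hl : IsSlow ε X Ω) (hz : z ∈ slit Ω)
    (u : Coord 2) :
    curvOp (alphaCoord ε X) z u = alphaCurv ε (X z.1) •
      (alphaForm ε (X z.1) (velocity X z) (velocity X z) • u
        - alphaForm ε (X z.1) (velocity X z) (fderiv ℝ X z.1 u) • z.2) := by
  obtain ⟨f, g, a, c, hf⟩ := exists_isFrame (hX.inner_self z.1 hz.1)
  have hF := isFinslerOn_alphaCoord hX hl
  have ha := contDiffOn_alphaChr (ε := ε) hX.smoothOn_position hX.smoothOn_velocity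
    hX.smoothOn_velocity fun z hz => (hl z.1 hz.1).ne'
  have hG : ∀ z ∈ slit Ω, _ := fun z hz => fderiv_spray_alphaCoord (z := z) hX hl hz
  have hv : fderiv ℝ (velocity X) z (z.2, -(2 : ℝ) • spray (alphaCoord ε X) z)
      = alphaChr ε (X z.1) (velocity X z) (velocity X z) := by
    rw [hX.fderiv_velocity hz, map_smul, hG z hz]
    module
  have hN := hF.map_connection hX.smooth ha hG hz u
  obtain ⟨h1, h2⟩ := differentiableAt_fderiv_position hX hz u
  obtain ⟨h3, h4⟩ := hasFDerivAt_alphaChr (ε := ε) (hX.differentiableAt_position hz)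
    (hX.differentiableAt_velocity hz) h1 (hl z.1 hz.1).ne'
  apply hX.injective z.1 hz.1
  rw [hF.map_curvOp hX.smooth ha hG hz, fderiv_alphaAcc_right hX hl hz, hN,
    fderiv_alphaAcc_right hX hl hz, fderiv_alphaAcc hX hl hz, hX.fderiv_velocity hz,
    fderiv_eq_of_eqOn (isOpen_slit hX.isOpen) (fun z hz => fderiv_alphaAcc_right hX hl hz u) hz,
    fderiv_fun_const_smul h3, smul_apply, h4, h2, hv, hX.fderiv_position hz,
    smoothOn_snd_symm hX.smooth hX.isOpen hz.1 u, map_zero, add_zero,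
    map_smul, map_sub, map_smul, map_smul]
  have h5 : fderiv ℝ X z.1 z.2 = velocity X z := rfl
  have h6 : (1 / 2 * 2 : ℝ) = 1 := by norm_num
  simp only [smul_smul, h6, one_smul, alphaChr_sub_right]
  rw [h5, ← hf.alphaChr_curvature (hl z.1 hz.1) (hX.inner_velocity hz) (hX.inner_fderiv hz.1 u)]
  module

theorem riemannCurv_alphaCoord (hX : IsSphereParam X Ω) (hl : IsSlow ε X Ω) (hz : z ∈ slit Ω)
    (i k : Fin 2) :
    riemannCurv (alphaCoord ε X) i k z.1 z.2 = alphaCurv ε (X z.1) *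
      (alphaCoord ε X z.1 z.2 ^ 2 * (if i = k then 1 else 0)
        - alphaCoord ε X z.1 z.2 * pderiv k (alphaCoord ε X z.1) z.2 * z.2 i) := by
  have hd := smoothOn_differentiableAt (smoothOn_alphaCoord hX hl) (isOpen_slit hX.isOpen) hz
  have h1 := fderiv_energy_alphaCoord_right hX hl hz (unit k)
  have h2 : fderiv ℝ (energy (alphaCoord ε X)) z (0, unit k)
      = 2 * (alphaCoord ε X z.1 z.2 * pderiv k (alphaCoord ε X z.1) z.2) := by
    have h3 : pderiv k (alphaCoord ε X z.1) z.2
        = fderiv ℝ (fun z : Coord 2 × Coord 2 => alphaCoord ε X z.1 z.2) z (0, unit k) :=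
      fderiv_slice_right (f := fun z : Coord 2 × Coord 2 => alphaCoord ε X z.1 z.2) hd _
    have h4 : energy (alphaCoord ε X) = fun z => alphaCoord ε X z.1 z.2 ^ 2 := rfl
    rw [h3, h4, fderiv_fun_pow 2 hd]
    simp only [smul_apply, smul_eq_mul, nsmul_eq_mul]
    norm_num
    ring
  have h5 : alphaCoord ε X z.1 z.2 ^ 2 = alphaForm ε (X z.1) (velocity X z) (velocity X z) :=
    energy_alphaCoord hX hl hz
  rw [(isFinslerOn_alphaCoord hX hl).riemannCurv_eq hz, curvOp_alphaCoord hX hl hz, h5,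
    show alphaCoord ε X z.1 z.2 * pderiv k (alphaCoord ε X z.1) z.2
      = alphaForm ε (X z.1) (velocity X z) (fderiv ℝ X z.1 (unit k)) by linarith]
  simp [PiLp.single_apply]

end AlphaCoord

/-! ## Charts of the sphere -/

/-- The parametrization of the sphere that is inverse to a chart. -/
def chartParam (e : OpenPartialHomeomorph S2 (Coord 2)) (x : Coord 2) : E3 := (e.symm x : E3)

theorem isOpen_coordDomain (e : OpenPartialHomeomorph S2 (Coord 2)) {U : Set S2} (hU : IsOpen U) :
    IsOpen (coordDomain e U) :=
  e.symm.isOpen_inter_preimage hU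

theorem inner_self_sphere (p : S2) : ⟪(p : E3), (p : E3)⟫ = 1 := by
  rw [real_inner_self_eq_norm_sq, norm_eq_of_mem_sphere, one_pow]

theorem contMDiffOn_chartParam {e : OpenPartialHomeomorph S2 (Coord 2)} (he : e ∈ charts) :
    ContMDiffOn 𝓘(ℝ, Coord 2) 𝓘(ℝ, E3) ∞ (chartParam e) e.target :=
  contMDiff_coe_sphere.comp_contMDiffOn (contMDiffOn_symm_of_mem_maximalAtlas he)

/-- The inverse chart is a local diffeomorphism and the inclusion of the sphere is an immersion. -/
theorem injective_fderiv_chartParam {e : OpenPartialHomeomorph S2 (Coord 2)} (he : e ∈ charts)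
    {x : Coord 2} (hx : x ∈ e.target) : Function.Injective (fderiv ℝ (chartParam e) x) := by
  have hd : OpenPartialHomeomorph.MDifferentiable (𝓡 2) (𝓡 2) e.symm :=
    ⟨(contMDiffOn_symm_of_mem_maximalAtlas he).mdifferentiableOn (by simp),
      (contMDiffOn_of_mem_maximalAtlas he).mdifferentiableOn (by simp)⟩
  have h1 : MDifferentiableAt (𝓡 2) (𝓡 2) e.symm x :=
    hd.1.mdifferentiableAt (e.open_target.mem_nhds hx)
  have h2 : MDifferentiableAt (𝓡 2) 𝓘(ℝ, E3) (Subtype.val : S2 → E3) (e.symm x) :=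
    (contMDiff_coe_sphere (m := 1)).mdifferentiable (by simp) _
  have h3 := mfderiv_comp x h2 h1
  have h4 : Function.Injective
      (mfderiv (𝓡 2) 𝓘(ℝ, E3) (Subtype.val : S2 → E3) (e.symm x)) :=
    injective_mvfderiv_subtypeVal_sphere (e.symm x)
  have h5 : fderiv ℝ (chartParam e) x
      = mfderiv (𝓡 2) 𝓘(ℝ, E3) ((Subtype.val : S2 → E3) ∘ e.symm) x := mfderiv_eq_fderiv.symm
  rw [h5, h3]
  exact h4.comp (hd.mfderiv_injective hx)

theorem isSphereParam_chartParam {e : OpenPartialHomeomorph S2 (Coord 2)} (he : e ∈ charts)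
    {U : Set S2} (hU : IsOpen U) : IsSphereParam (chartParam e) (coordDomain e U) where
  isOpen := isOpen_coordDomain e hU
  smooth := (contMDiffOn_iff_contDiffOn.1 (contMDiffOn_chartParam he)).mono fun _ hx => hx.1
  inner_self _ _ := inner_self_sphere _
  injective _ hx := injective_fderiv_chartParam he hx.1

theorem isOpen_domain (ε : ℝ) : IsOpen (domain ε) := by
  have h : Continuous fun p : S2 => ε ^ 2 * ⟪rotLin (p : E3), rotLin (p : E3)⟫ := by fun_prop
  exact isOpen_lt h continuous_const

theorem mem_domain_iff {ε : ℝ} {p : S2} :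
    p ∈ domain ε ↔ 0 < 1 - ε ^ 2 * ⟪rotLin (p : E3), rotLin (p : E3)⟫ :=
  (sub_pos (a := (1 : ℝ)) (b := ε ^ 2 * ⟪rotLin (p : E3), rotLin (p : E3)⟫)).symm

theorem isSlow_chartParam {ε : ℝ} (e : OpenPartialHomeomorph S2 (Coord 2)) {U : Set S2}
    (hU : U ⊆ domain ε) : IsSlow ε (chartParam e) (coordDomain e U) :=
  fun _ hx => mem_domain_iff.1 (hU hx.2)

/-! ## The navigation equation -/

theorem solves_iff {ε : ℝ} {p : S2} {y : E3} {t : ℝ} :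
    Solves ε p y t ↔ 0 < t ∧ (1 - ε ^ 2 * ⟪rotLin (p : E3), rotLin (p : E3)⟫) * t ^ 2
      + 2 * ε * t * ⟪rotLin (p : E3), y⟫ = ⟪y, y⟫ := by
  refine and_congr_right fun ht => ?_
  change ‖t⁻¹ • y - ε • rotLin (p : E3)‖ = 1 ↔ _
  rw [← pow_eq_one_iff_of_nonneg (norm_nonneg _) two_ne_zero,
    ← real_inner_self_eq_norm_sq]
  simp only [inner_sub_left, inner_sub_right, real_inner_smul_left, real_inner_smul_right]
  rw [real_inner_comm (rotLin (p : E3)) y]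
  have h : t⁻¹ * t = 1 := inv_mul_cancel₀ ht.ne'
  constructor
  · intro h1
    linear_combination -t ^ 2 * h1 + (⟪y, y⟫ * (t⁻¹ * t + 1) - 2 * ε * t * ⟪rotLin (p : E3), y⟫) * h
  · intro h1
    linear_combination -t⁻¹ ^ 2 * h1 + ((1 - ε ^ 2 * ⟪rotLin (p : E3), rotLin (p : E3)⟫)
      * (t⁻¹ * t + 1) + 2 * ε * t⁻¹ * ⟪rotLin (p : E3), y⟫) * h

theorem solves_randers {ε : ℝ} {p : S2} (hp : p ∈ domain ε) {y : E3} (hy : y ≠ 0) :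
    Solves ε p y (randers ε p y) :=
  solves_iff.2 ⟨randersAmb_pos (mem_domain_iff.1 hp) hy, mul_randersAmb_sq (mem_domain_iff.1 hp)⟩

/-- Two distinct roots of the quadratic equation have a product of the sign of `-|y|²`, so they
cannot both be positive. -/
theorem Solves.unique {ε : ℝ} {p : S2} (hp : p ∈ domain ε) {y : E3} {s t : ℝ}
    (hs : Solves ε p y s) (ht : Solves ε p y t) : s = t := by
  obtain ⟨hs0, hs⟩ := solves_iff.1 hs
  obtain ⟨ht0, ht⟩ := solves_iff.1 ht
  have hl := mem_domain_iff.1 hp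
  have h0 : 0 ≤ ⟪y, y⟫ := real_inner_self_nonneg
  by_contra hne
  have h1 : (1 - ε ^ 2 * ⟪rotLin (p : E3), rotLin (p : E3)⟫) * (s + t)
      + 2 * ε * ⟪rotLin (p : E3), y⟫ = 0 := by
    refine (mul_eq_zero.1 (?_ : (s - t) * _ = 0)).resolve_left (sub_ne_zero.2 hne)
    linear_combination hs - ht
  have h2 : ⟪y, y⟫ = -((1 - ε ^ 2 * ⟪rotLin (p : E3), rotLin (p : E3)⟫) * (s * t)) := by
    linear_combination -hs + s * h1
  have := mul_pos hl (mul_pos hs0 ht0)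
  linarith

theorem mem_domain_of_existsUnique {ε : ℝ} {p : S2}
    (h : ∀ y : E3, IsTangent p y → y ≠ 0 → ∃! t : ℝ, Solves ε p y t) : p ∈ domain ε := by
  rw [mem_domain_iff]
  by_contra hl
  rw [not_lt] at hl
  set v := rotLin (p : E3) with hv
  have hpos : 0 < ε ^ 2 * ⟪v, v⟫ := by linarith
  have hne : -ε • v ≠ 0 := by
    intro h0
    have h1 : ⟪-ε • v, -ε • v⟫ = ε ^ 2 * ⟪v, v⟫ := by
      rw [real_inner_smul_left, real_inner_smul_right]; ring
    rw [h0, inner_zero_left] at h1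
    linarith
  -- Heading against a wind of speed at least one: `y / t - ε v = -(1 / t + 1) ε v` is longer than
  -- `1` for every `t > 0`.
  obtain ⟨t, ht, -⟩ := h (-ε • v) (by
    rw [IsTangent, real_inner_smul_right, hv, inner_rotLin_self, mul_zero]) hne
  obtain ⟨ht0, ht⟩ := solves_iff.1 ht
  simp only [← hv, real_inner_smul_left, real_inner_smul_right] at ht
  nlinarith [mul_nonneg (sub_nonneg.2 hl) (sq_nonneg t), mul_pos hpos ht0]

theorem mem_domain_iff_existsUnique {ε : ℝ} {p : S2} :
    p ∈ domain ε ↔ ∀ y : E3, IsTangent p y → y ≠ 0 → ∃! t : ℝ, Solves ε p y t :=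
  ⟨fun hp _ _ hy => ⟨_, solves_randers hp hy, fun _ ht => ht.unique hp (solves_randers hp hy)⟩,
    mem_domain_of_existsUnique⟩

/-! ## The shape of the domain -/

theorem inner_rotLin_rotLin_sphere (p : S2) :
    ⟪rotLin (p : E3), rotLin (p : E3)⟫ = 1 - (p : E3) 2 ^ 2 := by
  have h := inner_self_sphere p
  rw [inner_E3] at h
  rw [inner_rotLin_rotLin]
  linarith

theorem domain_eq_univ {ε : ℝ} (hε : |ε| < 1) : domain ε = Set.univ := by
  refine Set.eq_univ_of_forall fun p => mem_domain_iff.2 ?_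
  rw [inner_rotLin_rotLin_sphere]
  have := (sq_lt_one_iff_abs_lt_one ε).2 hε
  nlinarith [mul_nonneg (sq_nonneg ε) (sq_nonneg ((p : E3) 2))]

theorem abs_apply_two_le (p : S2) : |(p : E3) 2| ≤ 1 := by
  rw [← sq_le_one_iff_abs_le_one]
  have h : 0 ≤ ⟪rotLin (p : E3), rotLin (p : E3)⟫ := real_inner_self_nonneg
  rw [inner_rotLin_rotLin_sphere] at h
  linarith

theorem norm_northPole : ‖northPole‖ = 1 := by
  rw [EuclideanSpace.norm_eq]
  simp [northPole, Fin.sum_univ_three]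

theorem angle_northPole (p : S2) :
    InnerProductGeometry.angle (p : E3) northPole = Real.arccos ((p : E3) 2) := by
  rw [InnerProductGeometry.angle, norm_northPole, norm_eq_of_mem_sphere, inner_E3]
  simp [northPole]

theorem angle_neg_northPole (p : S2) :
    InnerProductGeometry.angle (p : E3) (-northPole) = Real.arccos (-(p : E3) 2) := by
  rw [InnerProductGeometry.angle, norm_neg, norm_northPole, norm_eq_of_mem_sphere, inner_neg_right,
    inner_E3]
  simp [northPole]

theorem domain_eq_union {ε : ℝ} (hε : 1 ≤ |ε|) : domain ε =
    {p : S2 | InnerProductGeometry.angle (p : E3) northPole < Real.arcsin (1 / |ε|)} ∪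
      {p : S2 | InnerProductGeometry.angle (p : E3) (-northPole) < Real.arcsin (1 / |ε|)} := by
  ext p
  have hε0 : 0 < |ε| := lt_of_lt_of_le one_pos hε
  obtain ⟨h1, h2⟩ := abs_le.1 (abs_apply_two_le p)
  have hs : (1 / |ε|) ^ 2 = 1 / ε ^ 2 := by rw [div_pow, one_pow, sq_abs]
  have he : 0 < ε ^ 2 := by rw [← sq_abs]; positivity
  have he1 : 1 ≤ ε ^ 2 := (one_le_sq_iff_one_le_abs ε).2 hε
  have hd : 1 / ε ^ 2 ≤ 1 := by rw [div_le_one he]; exact he1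
  have hd0 : 0 < 1 / ε ^ 2 := by positivity
  have hr1 : √(1 - 1 / ε ^ 2) ≤ 1 :=
    Real.sqrt_le_iff.2 ⟨zero_le_one, by linarith⟩
  -- Membership in the domain means that the height satisfies `z² > 1 - 1 / ε²`; the two signs of
  -- `z` give the two polar disks.
  have key : ∀ z : ℝ, -1 ≤ z → z ≤ 1 →
      (Real.arccos z < Real.arcsin (1 / |ε|) ↔ √(1 - 1 / ε ^ 2) < z) := by
    intro z hz1 hz2
    rw [Real.arcsin_eq_arccos (by positivity), hs]
    exact Real.strictAntiOn_arccos.lt_iff_gt ⟨hz1, hz2⟩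
      ⟨by linarith [Real.sqrt_nonneg (1 - 1 / ε ^ 2)], hr1⟩
  rw [Set.mem_union, Set.mem_ofPred_eq, Set.mem_ofPred_eq, angle_northPole, angle_neg_northPole,
    key _ h1 h2, key _ (by linarith) (by linarith), ← lt_abs, ← Real.sqrt_sq_eq_abs,
    Real.sqrt_lt_sqrt_iff (by linarith), mem_domain_iff, inner_rotLin_rotLin_sphere]
  have hm : 1 / ε ^ 2 * ε ^ 2 = 1 := one_div_mul_cancel he.ne'
  constructor
  · intro h
    have := mul_pos hd0 h
    linear_combination this - (1 - (p : E3) 2 ^ 2) * hm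
  · intro h
    have := mul_pos he (sub_pos.2 h)
    linear_combination this + hm

/-! ## The Randers metric on the sphere -/

theorem isRiemannianNorm_alpha (ε : ℝ) : IsRiemannianNorm (alpha ε) (domain ε) := by
  intro e he
  have hX := isSphereParam_chartParam he (isOpen_domain ε)
  have hl := isSlow_chartParam e (le_refl (domain ε))
  have hbil : ∀ x, ∀ y : Coord 2, alphaForm ε (chartParam e x) (fderiv ℝ (chartParam e) x y)
      (fderiv ℝ (chartParam e) x y) = ∑ i, ∑ j, alphaForm ε (chartParam e x)
        (fderiv ℝ (chartParam e) x (unit i)) (fderiv ℝ (chartParam e) x (unit j)) * y i * y j := by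
    intro x y
    rw [map_eq_add _ y]
    simp only [Fin.sum_univ_two, alphaForm, inner_add_left, inner_add_right, real_inner_smul_left,
      real_inner_smul_right]
    ring
  refine ⟨fun x => Matrix.of fun i j => alphaForm ε (chartParam e x)
    (fderiv ℝ (chartParam e) x (unit i)) (fderiv ℝ (chartParam e) x (unit j)), fun i j => ?_,
    fun x hx => ⟨?_, fun y => ?_⟩⟩
  · exact contDiffOn_alphaForm hX.smooth (smoothOn_fderiv_apply hX.smooth hX.isOpen _)
      (smoothOn_fderiv_apply hX.smooth hX.isOpen _) fun x hx => (hl x hx).ne'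
  · refine Matrix.PosDef.of_dotProduct_mulVec_pos ?_ fun u hu => ?_
    · ext i j
      simp [alphaForm_comm]
    · have h1 := hbil x (WithLp.toLp 2 u)
      have h2 : fderiv ℝ (chartParam e) x (WithLp.toLp 2 u) ≠ 0 :=
        hX.velocity_ne_zero (z := (x, WithLp.toLp 2 u)) ⟨hx, by simpa using hu⟩
      have h3 := alphaForm_self_pos (hl x hx) h2
      rw [h1] at h3
      simp only [dotProduct, Matrix.mulVec, star_trivial, Finset.mul_sum, Matrix.of_apply]
      refine h3.trans_eq (Finset.sum_congr rfl fun i _ => Finset.sum_congr rfl fun j _ => ?_)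
      ring
  · change alphaAmb ε (chartParam e x) (fderiv ℝ (chartParam e) x y) = _
    rw [alphaAmb_eq_sqrt (hl x hx), hbil]
    rfl

theorem isOneForm_beta (ε : ℝ) : IsOneForm (beta ε) (domain ε) := by
  intro e he
  have hX := isSphereParam_chartParam he (isOpen_domain ε)
  have hl := isSlow_chartParam e (le_refl (domain ε))
  refine ⟨fun x i => betaAmb ε (chartParam e x) (fderiv ℝ (chartParam e) x (unit i)), fun i => ?_,
    fun x hx y => ?_⟩
  · have hR : ContDiffOn ℝ ∞ (fun x => rotLin (chartParam e x)) (coordDomain e (domain ε)) :=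
      rotLin.contDiff.comp_contDiffOn hX.smooth
    exact ((contDiffOn_const.mul (hR.inner ℝ (smoothOn_fderiv_apply hX.smooth hX.isOpen _))).neg).div
      (contDiffOn_const.sub (contDiffOn_const.mul (hR.inner ℝ hR))) fun x hx => (hl x hx).ne'
  · change betaAmb ε (chartParam e x) (fderiv ℝ (chartParam e) x y) = _
    rw [map_eq_add _ y]
    simp only [Fin.sum_univ_two, betaAmb, inner_add_right, real_inner_smul_right]
    ring

theorem exists_beta_le {ε : ℝ} {p : S2} (hp : p ∈ domain ε) :
    ∃ c < 1, ∀ y, IsTangent p y → beta ε p y ≤ c * alpha ε p y := by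
  have hl := mem_domain_iff.1 hp
  set v := rotLin (p : E3) with hv
  have h0 : 0 ≤ ε ^ 2 * ⟪v, v⟫ := mul_nonneg (sq_nonneg ε) real_inner_self_nonneg
  -- The constant is `|ε| |v|`; after squaring, the bound is Cauchy-Schwarz for `v` and `y`.
  refine ⟨√(ε ^ 2 * ⟪v, v⟫), (Real.sqrt_lt' one_pos).2 (by linarith), fun y _ => ?_⟩
  change -(ε * ⟪v, y⟫) / (1 - ε ^ 2 * ⟪v, v⟫) ≤ √(ε ^ 2 * ⟪v, v⟫) *
    (√(ε ^ 2 * ⟪v, y⟫ ^ 2 + ⟪y, y⟫ * (1 - ε ^ 2 * ⟪v, v⟫)) / (1 - ε ^ 2 * ⟪v, v⟫))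
  rw [← mul_div_assoc, ← Real.sqrt_mul h0]
  refine div_le_div_of_nonneg_right (Real.le_sqrt_of_sq_le ?_) hl.le
  have h1 : ⟪v, y⟫ * ⟪v, y⟫ ≤ ⟪v, v⟫ * ⟪y, y⟫ := real_inner_mul_inner_self_le v y
  have h2 := mul_nonneg hl.le (mul_nonneg (sq_nonneg ε) (sub_nonneg.2 h1))
  linear_combination h2

theorem isFinslerMetric_randers (ε : ℝ) :
    IsFinslerMetric (fun p y => alpha ε p y + beta ε p y) (domain ε) where
  pos _ hp _ _ hy := randersAmb_pos (mem_domain_iff.1 hp) hy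
  homogeneous p _ _ _ c hc := randersAmb_smul (ε := ε) (p := (p : E3)) c hc
  smooth e he := (isFinslerOn_randersCoord (isSphereParam_chartParam he (isOpen_domain ε))
    (isSlow_chartParam e (le_refl _))).smooth
  convex e he := (isFinslerOn_randersCoord (isSphereParam_chartParam he (isOpen_domain ε))
    (isSlow_chartParam e (le_refl _))).posDef

theorem isRandersMetric (ε : ℝ) : IsRandersMetric (alpha ε) (beta ε) (domain ε) where
  riemannian := isRiemannianNorm_alpha ε
  oneForm := isOneForm_beta ε
  norm_lt_one _ hp := exists_beta_le hp
  finsler := isFinslerMetric_randers ε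

theorem hasFlagCurvature_randers (ε : ℝ) :
    HasFlagCurvature (randers ε) (domain ε) (fun _ => 1) := by
  intro e he x hx y hy i k
  rw [one_mul]
  exact riemannCurv_randersCoord (z := (x, y)) (isSphereParam_chartParam he (isOpen_domain ε))
    (isSlow_chartParam e (le_refl _)) ⟨hx, hy⟩ i k

theorem hasZeroSCurvature_randers (ε : ℝ) : HasZeroSCurvature (randers ε) (domain ε) :=
  fun e he x hx y hy =>
    sCurv_randersCoord (z := (x, y)) (isSphereParam_chartParam he (isOpen_domain ε))
      (isSlow_chartParam e (le_refl _)) ⟨hx, hy⟩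

theorem hasFlagCurvature_alpha (ε : ℝ) :
    HasFlagCurvature (alpha ε) (domain ε) (fun p => alphaCurv ε (p : E3)) :=
  fun e he x hx y hy i k =>
    riemannCurv_alphaCoord (z := (x, y)) (isSphereParam_chartParam he (isOpen_domain ε))
      (isSlow_chartParam e (le_refl _)) ⟨hx, hy⟩ i k

/-- The length of the rotation field is not constant on any nonempty open set. -/
theorem exists_inner_rotLin_ne {W : Set S2} (hW : IsOpen W) {p : S2} (hp : p ∈ W) :
    ∃ q ∈ W, ⟪rotLin (q : E3), rotLin (q : E3)⟫ ≠ ⟪rotLin (p : E3), rotLin (p : E3)⟫ := by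
  obtain ⟨f, g, a, c, h⟩ := exists_isFrame (inner_self_sphere p)
  have hfp := (real_inner_comm (p : E3) f).trans h.pf
  have hmem : ∀ t : ℝ, Real.cos t • (p : E3) + Real.sin t • f ∈ Metric.sphere (0 : E3) 1 := by
    intro t
    rw [mem_sphere_zero_iff_norm, ← pow_eq_one_iff_of_nonneg (norm_nonneg _) two_ne_zero,
      ← real_inner_self_eq_norm_sq]
    simp only [inner_add_left, inner_add_right, real_inner_smul_left, real_inner_smul_right, h.pp,
      h.ff, h.pf, hfp]
    linear_combination Real.sin_sq_add_cos_sq t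
  -- The great circle through `p` in the direction of `f`, that is, along a meridian.
  set γ : ℝ → S2 := fun t => ⟨_, hmem t⟩ with hγ
  have hc : Continuous γ := by
    refine Continuous.subtype_mk ?_ _
    fun_prop
  have h0 : γ 0 = p := by
    ext1
    simp [hγ]
  have hval : ∀ t, ⟪rotLin (γ t : E3), rotLin (γ t : E3)⟫
      = (c * Real.sin t - a * Real.cos t) ^ 2 := by
    intro t
    simp only [hγ, map_add, map_smul, h.rot_p, h.rot_f, inner_add_left, inner_add_right,
      real_inner_smul_left, real_inner_smul_right, h.gg]
    ring
  by_contra hcon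
  push Not at hcon
  obtain ⟨δ, hδ, hball⟩ := Metric.isOpen_iff.1 (hW.preimage hc) 0 (by
    rw [Set.mem_preimage, h0]; exact hp)
  have hall : ∀ t, |t| < δ → (c * Real.sin t - a * Real.cos t) ^ 2 = a ^ 2 := by
    intro t ht
    rw [← hval, ← h.inner_rot_self]
    exact hcon _ (hball (by simpa using ht))
  set t := min (δ / 2) 1 with ht
  have ht0 : 0 < t := lt_min (by linarith) one_pos
  have htδ : |t| < δ := by
    rw [abs_of_pos ht0]
    exact (min_le_left _ _).trans_lt (by linarith)
  have ht1 : t ≤ 1 := min_le_right _ _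
  have hs : 0 < Real.sin t := Real.sin_pos_of_pos_of_lt_pi ht0 (by linarith [Real.pi_gt_three])
  have hk : 0 < Real.cos t := Real.cos_pos_of_mem_Ioo
    ⟨by linarith [Real.pi_gt_three], by linarith [Real.pi_gt_three]⟩
  -- Comparing `t` with `-t` separates the odd part, which gives `a c = 0`, from the even part,
  -- which gives `a² = c²`; this contradicts `a² + c² = 1`.
  have e1 := hall t htδ
  have e2 := hall (-t) (by rwa [abs_neg])
  rw [Real.sin_neg, Real.cos_neg] at e2
  have e3 : a * c = 0 := by
    refine (mul_eq_zero.1 (?_ : (a * c) * (Real.sin t * Real.cos t) = 0)).resolve_right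
      (mul_pos hs hk).ne'
    linarith
  have e4 : c ^ 2 - a ^ 2 = 0 := by
    refine (mul_eq_zero.1 (?_ : (c ^ 2 - a ^ 2) * Real.sin t ^ 2 = 0)).resolve_right
      (pow_pos hs 2).ne'
    linear_combination e1 / 2 + e2 / 2 - a ^ 2 * Real.sin_sq_add_cos_sq t
  have e5 := h.sq_add_sq
  have e6 : (a ^ 2) * (c ^ 2) = 0 := by rw [← mul_pow, e3]; norm_num
  nlinarith

theorem not_isLocallyProjectivelyFlat {ε : ℝ} (hε : ε ≠ 0) {W : Set S2} (hW : IsOpen W)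
    (hne : W.Nonempty) (hWd : W ⊆ domain ε) : ¬ IsLocallyProjectivelyFlat (randers ε) W := by
  intro h
  obtain ⟨p, hp⟩ := hne
  have key : ∀ p ∈ W, ⟪rotLin (p : E3), rotLin (p : E3)⟫ = 1 := by
    intro p hp
    obtain ⟨e, he, hpe, P, hP⟩ := h p hp
    have hx : e p ∈ coordDomain e W := ⟨e.map_source hpe, by rw [e.left_inv hpe]; exact hp⟩
    have := inner_rotLin_eq_one_of_spray_eq (isSphereParam_chartParam he hW)
      (isSlow_chartParam e hWd) hε hx fun y hy => ⟨P (e p) y, by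
        ext i
        exact hP (e p) hx y hy i⟩
    rwa [chartParam, e.left_inv hpe] at this
  obtain ⟨q, hq, hqp⟩ := exists_inner_rotLin_ne hW hp
  exact hqp ((key q hq).trans (key p hp).symm)

theorem alphaCurv_not_const {ε : ℝ} (h0 : ε ≠ 0) (h1 : ε ≠ 1) (h2 : ε ≠ -1) {W : Set S2}
    (hW : IsOpen W) (hne : W.Nonempty) (hWd : W ⊆ domain ε) :
    ¬ ∃ c : ℝ, ∀ p ∈ W, alphaCurv ε (p : E3) = c := by
  rintro ⟨c, hc⟩
  obtain ⟨p, hp⟩ := hne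
  obtain ⟨q, hq, hqp⟩ := exists_inner_rotLin_ne hW hp
  have hlp := (mem_domain_iff.1 (hWd hp)).ne'
  have hlq := (mem_domain_iff.1 (hWd hq)).ne'
  have h3 := (hc q hq).trans (hc p hp).symm
  rw [alphaCurv, alphaCurv, slowInv, slowInv, inv_mul_eq_div, inv_mul_eq_div,
    div_eq_div_iff hlq hlp] at h3
  -- The curvature is a Möbius function of `|v|²`; the factor `6 ε² (1 - ε²)` is its determinant `(5
  -- ε² - ε⁴) + ε² (1 - 5 ε²)`.
  have h4 : (⟪rotLin (q : E3), rotLin (q : E3)⟫ - ⟪rotLin (p : E3), rotLin (p : E3)⟫) *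
      (6 * ε ^ 2 * ((1 - ε) * (1 + ε))) = 0 := by
    linear_combination h3
  rcases mul_eq_zero.1 h4 with h | h
  · exact hqp (sub_eq_zero.1 h)
  · have h5 : 1 - ε ≠ 0 := sub_ne_zero.2 h1.symm
    have h6 : 1 + ε ≠ 0 := fun h => h2 (by linarith)
    exact (mul_ne_zero (by positivity) (mul_ne_zero h5 h6)) h

theorem alphaCurv_zero (p : E3) : alphaCurv 0 p = 1 := by
  simp [alphaCurv, slowInv]

theorem alphaCurv_of_sq_eq_one {ε : ℝ} (hε : ε ^ 2 = 1) {p : S2} (hp : p ∈ domain ε) :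
    alphaCurv ε (p : E3) = -4 := by
  have hl := (mem_domain_iff.1 hp).ne'
  have h4 : ε ^ 4 = 1 := by rw [show ε ^ 4 = (ε ^ 2) ^ 2 by ring, hε, one_pow]
  rw [hε] at hl
  rw [alphaCurv, slowInv, h4, hε, inv_mul_eq_div, div_eq_iff hl]
  ring

end Finsler

end

theorem theorem1 (ε : ℝ) :
    -- the domain: the set where the equation determines `F`, and its description
    (∀ p : Finsler.S2, p ∈ Finsler.domain ε ↔
      ∀ y : Finsler.E3, Finsler.IsTangent p y → y ≠ 0 → ∃! t : ℝ, Finsler.Solves ε p y t) ∧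
    (|ε| < 1 → Finsler.domain ε = Set.univ) ∧
    (1 ≤ |ε| → Finsler.domain ε =
      {p : Finsler.S2 |
          InnerProductGeometry.angle (p : Finsler.E3) Finsler.northPole < Real.arcsin (1 / |ε|)} ∪
        {p : Finsler.S2 |
          InnerProductGeometry.angle (p : Finsler.E3) (-Finsler.northPole)
            < Real.arcsin (1 / |ε|)}) ∧
    -- the solution is the Randers metric `α + β`
    (∀ p ∈ Finsler.domain ε, ∀ y : Finsler.E3, Finsler.IsTangent p y → y ≠ 0 →
      Finsler.Solves ε p y (Finsler.randers ε p y)) ∧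
    Finsler.IsRandersMetric (Finsler.alpha ε) (Finsler.beta ε) (Finsler.domain ε) ∧
    -- (a) flag curvature one
    Finsler.HasFlagCurvature (Finsler.randers ε) (Finsler.domain ε) (fun _ => 1) ∧
    -- (b) vanishing S-curvature
    Finsler.HasZeroSCurvature (Finsler.randers ε) (Finsler.domain ε) ∧
    -- (c) not locally projectively flat, on any open part of the domain
    (ε ≠ 0 → ∀ W : Set Finsler.S2, IsOpen W → W.Nonempty → W ⊆ Finsler.domain ε →
      ¬ Finsler.IsLocallyProjectivelyFlat (Finsler.randers ε) W) ∧
    -- (d) the Gauss curvature of `α`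
    ∃ K : Finsler.S2 → ℝ,
      Finsler.HasFlagCurvature (Finsler.alpha ε) (Finsler.domain ε) K ∧
      (ε ≠ 0 → ε ≠ 1 → ε ≠ -1 →
        ∀ W : Set Finsler.S2, IsOpen W → W.Nonempty → W ⊆ Finsler.domain ε →
          ¬ ∃ c : ℝ, ∀ p ∈ W, K p = c) ∧
      (ε = 0 → ∀ p ∈ Finsler.domain ε, K p = 1) ∧
      (ε = 1 ∨ ε = -1 → ∀ p ∈ Finsler.domain ε, K p = -4) := by
  refine ⟨fun p => Finsler.mem_domain_iff_existsUnique, Finsler.domain_eq_univ,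
    Finsler.domain_eq_union, fun p hp y _ hy => Finsler.solves_randers hp hy,
    Finsler.isRandersMetric ε, Finsler.hasFlagCurvature_randers ε,
    Finsler.hasZeroSCurvature_randers ε,
    fun hε W hW hne hWd => Finsler.not_isLocallyProjectivelyFlat hε hW hne hWd,
    fun p => Finsler.alphaCurv ε (p : Finsler.E3), Finsler.hasFlagCurvature_alpha ε,
    fun h0 h1 h2 W hW hne hWd => Finsler.alphaCurv_not_const h0 h1 h2 hW hne hWd, ?_, ?_⟩
  · rintro rfl p _
    exact Finsler.alphaCurv_zero _
  · rintro hε p hp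
    exact Finsler.alphaCurv_of_sq_eq_one (by rcases hε with rfl | rfl <;> norm_num) hp
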